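/- Let $V$ be a real vector space of dimension $n<\infty$, let $A=S(V^*)$ be the algebra of real polynomials on $V$, graded so that linear forms have degree $2$, and for a cone $\sigma$ put $V_\sigma=\operatorname{span}\sigma$, $A_\sigma=S(V_\sigma^*)$, $\det V_\sigma^*=\bigwedge^{\dim\sigma}V_\sigma^*$ (placed in degree $2\dim\sigma$). Let $\Delta$ be a fan in $V$, i.e. a finite non-empty set of strictly convex polyhedral cones, closed under taking faces, any two of which meet in a common face; its open sets are the subfans. Let $\partial\Delta$ consist of the faces of those $(n-1)$-dimensional cones that are a facet of exactly one $n$-dimensional cone of $\Delta$. Assume that $\Delta$ is *quasi-convex*: every cone of $\Delta$ is a face of an $n$-dimensional cone of $\Delta$, and the support $|\partial\Delta|$ is a real homology manifold, that is, for every $\tau\in\partial\Delta$ the local homology of $|\partial\Delta|$ at the points of the relative interior of $\tau$ (computed by the cellular chain complex with one generator in degree $\dim\gamma$ for each $\gamma\in\partial\Delta$, $\gamma\supseteq\tau$) is $\mathbb R$ in degree $n-1$ and $0$ in all other degrees. A *perverse sheaf* $\mathcal F$ on $\Delta$ is a flabby sheaf of ($\mathbb Z$-)graded modules over the sheaf $\sigma\mapsto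 A_\sigma$ such that each $F_\sigma=\mathcal F(\sigma)$ is a finitely generated free $A_\sigma$-module. Let $F_{(\sigma,\partial\sigma)}\subset F_\sigma$ be the sections over $\sigma$ vanishing on all proper faces of $\sigma$, and $F_{(\Delta,\partial\Delta)}$ the $A$-module of global sections vanishing on $\partial\Delta$. Fix an orientation of each $V_\sigma$, $\sigma\in\Delta$, constant on the $n$-dimensional cones. The *dual sheaf* $D\mathcal F$ is given by $$(D\mathcal F)_\sigma=\operatorname{Hom}_{A_\sigma}(F_{(\sigma,\partial\sigma)},A_\sigma)\otimes_{\mathbb R}\det V_\sigma^*,$$ with restriction to a facet $\tau$ of $\sigma$ equal to $\varepsilon^\sigma_\tau\,\varphi_h\otimes\psi_h$ (and restriction to arbitrary faces obtained by composition). Here $h\in V_\sigma^*$ is any linear form with kernel $V_\tau$; $\varphi_h(f)(g)=f(h\hat g)|_{V_\tau}$, where $\hat g\in F_\sigma$ restricts to $g\in F_{(\tau,\partial\tau)}$ on $\tau$ and to $0$ on every proper face of $\sigma$ other than $\tau$; $\psi_h(h\wedge\eta)=\eta|_{V_\tau}$; and $\varepsilon^\sigma_\tau=\pm1$ is the transition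 coefficient of the chosen orientations. Then for every perverse sheaf $\mathcal F$ on $\Delta$ there is an isomorphism of $A$-modules, homogeneous of degree $0$, $$(D\mathcal F)_\Delta\;\cong\;\operatorname{Hom}_A\bigl(F_{(\Delta,\partial\Delta)},A\bigr)\otimes_{\mathbb R}\det V^*,$$ which is natural: for each $n$-dimensional cone $\sigma$ the section of $D\mathcal F$ corresponding to $\psi\otimes\omega$ has on $\sigma$ the value $(\psi\circ\mathrm{ext}_\sigma)\otimes\omega$, where $\mathrm{ext}_\sigma\colon F_{(\sigma,\partial\sigma)}\to F_{(\Delta,\partial\Delta)}$ is extension by zero; and the isomorphisms commute with the maps induced by homomorphisms $\mathcal F\to\mathcal G$ of perverse sheaves. In particular, every non-zero $\omega\in\det V^*$ gives a bijection $\psi\mapsto\psi\otimes\omega$ from $\operatorname{Hom}_A(F_{(\Delta,\partial\Delta)},A)$ onto $(D\mathcal F)_\Delta$. -/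

import Mathlib

open scoped TensorProduct

universe u w

noncomputable section

namespace FanDuality

/-! ### Graded polynomial algebras and determinants -/

/-- The algebra `S(W^*)` of real polynomials on `W`. -/
abbrev Poly (W : Type u) [AddCommGroup W] [Module ℝ W] : Type u :=
  SymmetricAlgebra ℝ (Module.Dual ℝ W)

/-- The homogeneous part of degree `q` of `S(W^*)`, linear forms having degree `2`. -/
def polyGr (W : Type u) [AddCommGroup W] [Module ℝ W] (q : ℤ) : Submodule ℝ (Poly W) :=
  ⨆ (k : ℕ) (_ : q = 2 * (k : ℤ)), LinearMap.range (SymmetricAlgebra.ι ℝ (Module.Dual ℝ W)) ^ k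

/-- Pull-back of polynomials along a linear map; for an inclusion of subspaces this is the
restriction of polynomial functions. -/
def polyRes {U W : Type u} [AddCommGroup U] [Module ℝ U] [AddCommGroup W] [Module ℝ W]
    (f : U →ₗ[ℝ] W) : Poly W →ₐ[ℝ] Poly U :=
  SymmetricAlgebra.lift (SymmetricAlgebra.ι ℝ (Module.Dual ℝ U) ∘ₗ f.dualMap)

section polyRes

variable {U W X : Type u} [AddCommGroup U] [Module ℝ U] [AddCommGroup W] [Module ℝ W]
  [AddCommGroup X] [Module ℝ X]

theorem polyRes_ι (f : U →ₗ[ℝ] W) (l : Module.Dual ℝ W) :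
    polyRes f (SymmetricAlgebra.ι ℝ _ l) = SymmetricAlgebra.ι ℝ _ (f.dualMap l) := by
  simp [polyRes]

theorem polyRes_comp (f : U →ₗ[ℝ] W) (g : W →ₗ[ℝ] X) (a : Poly X) :
    polyRes f (polyRes g a) = polyRes (g ∘ₗ f) a := by
  have : (polyRes f).comp (polyRes g) = polyRes (g ∘ₗ f) := by
    apply SymmetricAlgebra.algHom_ext
    ext l
    simp [polyRes_ι]
    rfl
  exact DFunLike.congr_fun this a

theorem polyRes_surjective (f : U →ₗ[ℝ] W) (hf : Function.Injective f) :
    Function.Surjective (polyRes f) := by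
  intro b
  induction b using SymmetricAlgebra.induction with
  | algebraMap r => exact ⟨algebraMap ℝ _ r, by simp⟩
  | ι l =>
    obtain ⟨m, rfl⟩ := LinearMap.dualMap_surjective_of_injective hf l
    exact ⟨SymmetricAlgebra.ι ℝ _ m, polyRes_ι f m⟩
  | mul a b ha hb =>
    obtain ⟨a, rfl⟩ := ha
    obtain ⟨b, rfl⟩ := hb
    exact ⟨a * b, by simp⟩
  | add a b ha hb =>
    obtain ⟨a, rfl⟩ := ha
    obtain ⟨b, rfl⟩ := hb
    exact ⟨a + b, by simp⟩

end polyRes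

/-- `det W^*`, the top exterior power of the dual space, as the space of top degree alternating
forms on `W`. -/
abbrev DetDual (W : Type u) [AddCommGroup W] [Module ℝ W] : Type u :=
  W [⋀^Fin (Module.finrank ℝ W)]→ₗ[ℝ] ℝ

/-! ### Fans -/

variable {V : Type u} [AddCommGroup V] [Module ℝ V]

/-- A fan: a finite non-empty set of strictly convex polyhedral cones, closed under passing to
faces, any two of which meet in a common face. -/
structure Fan (V : Type u) [AddCommGroup V] [Module ℝ V] where
  cones : Finset (PointedCone ℝ V)
  nonempty : cones.Nonempty
  fg : ∀ σ ∈ cones, Submodule.FG σ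
  salient : ∀ σ ∈ cones, (σ : ConvexCone ℝ V).Salient
  face_mem : ∀ σ ∈ cones, ∀ τ : PointedCone ℝ V, τ.IsFaceOf σ → τ ∈ cones
  inf_isFaceOf : ∀ σ ∈ cones, ∀ τ ∈ cones, (σ ⊓ τ).IsFaceOf σ

namespace Fan

/-- The cones of a fan, ordered by inclusion; for two cones of a fan, `τ ≤ σ` means that `τ` is a
face of `σ` (see `Fan.isFaceOf_of_le`). -/
abbrev Cone (Δ : Fan V) : Type u := {σ : PointedCone ℝ V // σ ∈ Δ.cones}

variable {Δ : Fan V}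

theorem isFaceOf_of_le {τ σ : Δ.Cone} (h : τ ≤ σ) : τ.1.IsFaceOf σ.1 := by
  have := Δ.inf_isFaceOf σ.1 σ.2 τ.1 τ.2
  rwa [inf_eq_right.mpr h] at this

/-- The linear span `V_σ` of a cone. -/
abbrev lin (σ : Δ.Cone) : Submodule ℝ V := Submodule.span ℝ (σ.1 : Set V)

/-- The dimension of a cone. -/
def dim (σ : Δ.Cone) : ℕ := Module.finrank ℝ (lin σ)

theorem lin_mono {τ σ : Δ.Cone} (h : τ ≤ σ) : lin τ ≤ lin σ := Submodule.span_mono h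

/-- The inclusion `V_τ → V_σ` for `τ ≤ σ`. -/
abbrev linIncl {τ σ : Δ.Cone} (h : τ ≤ σ) : lin τ →ₗ[ℝ] lin σ := Submodule.inclusion (lin_mono h)

theorem exists_sub_of_mem_lin {σ : Δ.Cone} {x : V} (hx : x ∈ lin σ) :
    ∃ a ∈ σ.1, ∃ b ∈ σ.1, x = a - b := by
  induction hx using Submodule.span_induction with
  | mem x hx => exact ⟨x, hx, 0, zero_mem _, by simp⟩
  | zero => exact ⟨0, zero_mem _, 0, zero_mem _, by simp⟩
  | add x y _ _ hx hy =>
    obtain ⟨a, ha, b, hb, rfl⟩ := hx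
    obtain ⟨c, hc, d, hd, rfl⟩ := hy
    exact ⟨a + c, add_mem ha hc, b + d, add_mem hb hd, by abel⟩
  | smul r x _ hx =>
    obtain ⟨a, ha, b, hb, rfl⟩ := hx
    rcases le_total 0 r with hr | hr
    · exact ⟨r • a, PointedCone.smul_mem _ hr ha, r • b, PointedCone.smul_mem _ hr hb,
        smul_sub r a b⟩
    · refine ⟨(-r) • b, PointedCone.smul_mem _ (by linarith) hb, (-r) • a,
        PointedCone.smul_mem _ (by linarith) ha, ?_⟩
      simp only [neg_smul, smul_sub]
      abel

theorem mem_of_mem_of_mem_lin {τ σ : Δ.Cone} (h : τ ≤ σ) {x : V} (hx : x ∈ σ.1)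
    (hx' : x ∈ lin τ) : x ∈ τ.1 := by
  obtain ⟨a, ha, b, hb, rfl⟩ := exists_sub_of_mem_lin hx'
  have := (isFaceOf_of_le h).mem_of_smul_add_smul_mem_left (a := 1) (b := 1)
    hx (h hb) one_pos one_pos
  exact this (by simpa using ha)

theorem eq_of_le_of_dim_le [FiniteDimensional ℝ V] {τ σ : Δ.Cone} (h : τ ≤ σ)
    (hd : dim σ ≤ dim τ) : τ = σ := by
  apply le_antisymm h
  intro x hx
  have : lin τ = lin σ := Submodule.eq_of_le_of_finrank_le (lin_mono h) hd
  exact mem_of_mem_of_mem_lin h hx (this ▸ Submodule.subset_span hx)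

/-- `τ` is a facet of `σ`. -/
def IsFacet (τ σ : Δ.Cone) : Prop := τ ≤ σ ∧ dim τ + 1 = dim σ

theorem IsFacet.lt {τ σ : Δ.Cone} (h : IsFacet τ σ) : τ < σ :=
  lt_of_le_of_ne h.1 (by rintro rfl; have := h.2; omega)

theorem IsFacet.eq_of_le_of_lt [FiniteDimensional ℝ V] {τ σ ρ : Δ.Cone} (h : IsFacet τ σ)
    (h₁ : τ ≤ ρ) (h₂ : ρ < σ) : ρ = τ := by
  by_contra hne
  have h3 : dim τ < dim ρ := by
    by_contra hc
    exact hne (eq_of_le_of_dim_le h₁ (not_lt.mp hc)).symm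
  have h4 : dim ρ < dim σ := by
    by_contra hc
    exact h₂.ne (eq_of_le_of_dim_le h₂.le (not_lt.mp hc))
  have := h.2
  omega

/-- The linear forms `h` on `V_σ` with kernel `V_τ`. -/
def IsFacetForm {τ σ : Δ.Cone} (h : Module.Dual ℝ (lin σ)) (_ : IsFacet τ σ) : Prop :=
  LinearMap.ker h = (lin τ).comap (lin σ).subtype

theorem IsFacetForm.dualMap_eq_zero {τ σ : Δ.Cone} {h : Module.Dual ℝ (lin σ)} {hf : IsFacet τ σ}
    (hh : IsFacetForm h hf) : (linIncl hf.1).dualMap h = 0 := by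
  ext x
  have : linIncl hf.1 x ∈ LinearMap.ker h := by
    rw [hh]
    exact x.2
  exact this

theorem IsFacet.comap_ne_top {τ σ : Δ.Cone} (hf : IsFacet τ σ) :
    (lin τ).comap (lin σ).subtype ≠ ⊤ := by
  intro hc
  have : lin σ ≤ lin τ := by
    intro x hx
    have : (⟨x, hx⟩ : lin σ) ∈ (lin τ).comap (lin σ).subtype := hc ▸ Submodule.mem_top
    exact this
  have h1 : lin σ = lin τ := le_antisymm this (lin_mono hf.1)
  have h2 : dim τ = dim σ := by rw [dim, dim, h1]
  have h3 := hf.2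
  omega

theorem IsFacetForm.exists_eq_one {τ σ : Δ.Cone} {h : Module.Dual ℝ (lin σ)} {hf : IsFacet τ σ}
    (hh : IsFacetForm h hf) : ∃ v : lin σ, h v = 1 := by
  have hne : h ≠ 0 := by
    rintro rfl
    rw [IsFacetForm, LinearMap.ker_zero] at hh
    exact hf.comap_ne_top hh.symm
  obtain ⟨v, hv⟩ := DFunLike.ne_iff.mp hne
  have hv : h v ≠ 0 := hv
  exact ⟨(h v)⁻¹ • v, by simp [hv]⟩

/-- A facet `τ` of `σ` is cut out by a linear form that is non-negative on `σ`. -/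
theorem exists_inner_facetForm [FiniteDimensional ℝ V] {τ σ : Δ.Cone} (hf : IsFacet τ σ) :
    ∃ h : Module.Dual ℝ (lin σ), IsFacetForm h hf ∧
      ∀ x (hx : x ∈ σ.1), 0 ≤ h ⟨x, Submodule.subset_span hx⟩ := by
  set P := (lin τ).comap (lin σ).subtype with hP
  have hPdim : Module.finrank ℝ P = dim τ :=
    (Submodule.comapSubtypeEquivOfLe (lin_mono hf.1)).finrank_eq
  obtain ⟨x₀, -, hx₀⟩ := SetLike.exists_of_lt (lt_top_iff_ne_top.mpr hf.comap_ne_top)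
  obtain ⟨h, hne, hle⟩ := Submodule.exists_le_ker_of_notMem hx₀
  have hker : LinearMap.ker h = P := by
    symm
    apply Submodule.eq_of_le_of_finrank_le hle
    have h1 := LinearMap.finrank_range_add_finrank_ker h
    have h2 : LinearMap.range h ≠ ⊥ := by
      intro hc
      rw [LinearMap.range_eq_bot] at hc
      exact hne (by simp [hc])
    have h3 : Module.finrank ℝ (LinearMap.range h) ≠ 0 := by
      rwa [Ne, Submodule.finrank_eq_zero]
    have h4 := hf.2
    have h5 : Module.finrank ℝ (lin σ) = dim σ := rfl
    rw [hPdim]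
    omega
  have key : ∀ x (hx : x ∈ σ.1) y (hy : y ∈ σ.1), 0 < h ⟨x, Submodule.subset_span hx⟩ →
      h ⟨y, Submodule.subset_span hy⟩ < 0 → False := by
    intro x hx y hy hpos hneg
    set X : lin σ := ⟨x, Submodule.subset_span hx⟩ with hX
    set Y : lin σ := ⟨y, Submodule.subset_span hy⟩ with hY
    have hz : (-(h Y)) • X + (h X) • Y ∈ LinearMap.ker h := by
      simp only [LinearMap.mem_ker, map_add, map_smul, smul_eq_mul]
      ring
    rw [hker] at hz
    have hz' : (-(h Y)) • x + (h X) • y ∈ lin τ := hz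
    have hzσ : (-(h Y)) • x + (h X) • y ∈ σ.1 :=
      add_mem (PointedCone.smul_mem _ (by linarith) hx) (PointedCone.smul_mem _ hpos.le hy)
    have hzτ := mem_of_mem_of_mem_lin hf.1 hzσ hz'
    have hxτ := (isFaceOf_of_le hf.1).mem_of_smul_add_smul_mem_left hx hy
      (neg_pos.mpr hneg) hpos hzτ
    have : X ∈ LinearMap.ker h := by
      rw [hker]
      exact Submodule.subset_span hxτ
    exact hpos.ne' this
  by_cases hc : ∀ x (hx : x ∈ σ.1), 0 ≤ h ⟨x, Submodule.subset_span hx⟩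
  · exact ⟨h, hker, hc⟩
  · push Not at hc
    obtain ⟨y, hy, hneg⟩ := hc
    refine ⟨-h, ?_, ?_⟩
    · rw [IsFacetForm, ← hP, ← hker]
      ext z
      simp
    · intro x hx
      by_contra hlt
      exact key x hx y hy (by simpa using hlt) hneg

/-- A linear form on `V_σ` with kernel `V_τ` that is non-negative on `σ`. -/
def facetForm [FiniteDimensional ℝ V] {τ σ : Δ.Cone} (hf : IsFacet τ σ) : Module.Dual ℝ (lin σ) :=
  (exists_inner_facetForm hf).choose

theorem isFacetForm_facetForm [FiniteDimensional ℝ V] {τ σ : Δ.Cone} (hf : IsFacet τ σ) :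
    IsFacetForm (facetForm hf) hf :=
  (exists_inner_facetForm hf).choose_spec.1

/-- The map `ψ_h : det V_σ^* → det V_τ^*`, `h ∧ η ↦ η|_{V_τ}`, for a linear form `h` with kernel
`V_τ`. In terms of alternating forms it inserts in the first slot a vector `v` with `h v = 1`,
and restricts to `V_τ`. -/
def psi {τ σ : Δ.Cone} {hf : IsFacet τ σ} {h : Module.Dual ℝ (lin σ)} (hh : IsFacetForm h hf) :
    DetDual (lin σ) →ₗ[ℝ] DetDual (lin τ) where
  toFun ω := ((ω.domDomCongr (finCongr hf.2.symm)).curryLeft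
    hh.exists_eq_one.choose).compLinearMap (linIncl hf.1)
  map_add' _ _ := rfl
  map_smul' _ _ := rfl

/-- Restriction of a volume form from `V` to `V_σ = V` for a cone `σ` of full dimension. -/
def detRes (σ : Δ.Cone) (h : dim σ = Module.finrank ℝ V) : DetDual V →ₗ[ℝ] DetDual (lin σ) where
  toFun ω := (ω.domDomCongr (finCongr h.symm)).compLinearMap (lin σ).subtype
  map_add' _ _ := rfl
  map_smul' _ _ := rfl

/-- A choice of an orientation for every cone of the fan, constant on the full-dimensional cones.
The orientation of `σ` is given by a non-zero top form on `V_σ`, only the class of which up to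
positive multiples matters. -/
structure Orientation (Δ : Fan V) where
  form : ∀ σ : Δ.Cone, DetDual (lin σ)
  form_ne_zero : ∀ σ, form σ ≠ 0
  const : ∃ ω : DetDual V, ∀ (σ : Δ.Cone) (h : dim σ = Module.finrank ℝ V),
    ∃ c : ℝ, 0 < c ∧ form σ = c • detRes σ h ω

open Classical in
/-- The transition coefficient `ε^σ_τ = ±1`: it is `1` if the orientation of `σ` is represented by
`h ∧ η`, where `h` is non-negative on `σ`, has kernel `V_τ`, and `η|_{V_τ}` represents the
orientation of `τ`. -/
def Orientation.sign [FiniteDimensional ℝ V] (o : Δ.Orientation) {τ σ : Δ.Cone}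
    (hf : IsFacet τ σ) : ℝ :=
  if ∃ c : ℝ, 0 < c ∧ psi (isFacetForm_facetForm hf) (o.form σ) = c • o.form τ then 1 else -1

/-! ### Quasi-convex fans -/

/-- Every cone is a face of a cone of full dimension. -/
def IsPure (Δ : Fan V) : Prop :=
  ∀ τ : Δ.Cone, ∃ σ : Δ.Cone, τ ≤ σ ∧ dim σ = Module.finrank ℝ V

/-- The boundary fan: the faces of those cones of dimension `n - 1` that are a facet of precisely
one `n`-dimensional cone. -/
def boundary (Δ : Fan V) : Set Δ.Cone :=
  {ρ | ∃ τ : Δ.Cone, ρ ≤ τ ∧ dim τ + 1 = Module.finrank ℝ V ∧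
    ∃! σ : Δ.Cone, τ ≤ σ ∧ dim σ = Module.finrank ℝ V}

/-- The cones of the boundary fan that contain `τ`. -/
abbrev BdStar (τ : Δ.Cone) : Type u := {γ : Δ.Cone // γ ∈ Δ.boundary ∧ τ ≤ γ}

/-- Chains of dimension `i` in the relative cellular complex of the star of `τ` in `∂Δ`. -/
def bdChains (τ : Δ.Cone) (i : ℕ) : Submodule ℝ (BdStar τ → ℝ) where
  carrier := {c | ∀ γ, dim γ.1 ≠ i → c γ = 0}
  zero_mem' _ _ := rfl
  add_mem' ha hb γ h := by simp [ha γ h, hb γ h]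
  smul_mem' r a ha γ h := by simp [ha γ h]

open Classical in
/-- The cellular boundary operator `∂[γ] = ∑ ε^γ_δ [δ]`, the sum running over the facets `δ` of `γ`
that contain `τ`. -/
def bdMap [FiniteDimensional ℝ V] (o : Δ.Orientation) (τ : Δ.Cone) :
    (BdStar τ → ℝ) →ₗ[ℝ] (BdStar τ → ℝ) where
  toFun c δ := ∑ γ : BdStar τ, if h : IsFacet δ.1 γ.1 then o.sign h * c γ else 0
  map_add' a b := by
    ext δ
    simp only [Pi.add_apply, ← Finset.sum_add_distrib]
    refine Finset.sum_congr rfl fun γ _ => ?_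
    split_ifs <;> simp [mul_add]
  map_smul' r a := by
    ext δ
    simp only [Pi.smul_apply, smul_eq_mul, RingHom.id_apply, Finset.mul_sum]
    refine Finset.sum_congr rfl fun γ _ => ?_
    split_ifs <;> ring

/-- The local homology `H_i(|∂Δ|, |∂Δ| ∖ {x}; ℝ)` of the support of `∂Δ` at a point `x` in the
relative interior of `τ`: the homology of the cellular chains of `∂Δ` modulo those of the
subcomplex of cones not containing `τ`. -/
abbrev LocalHomology [FiniteDimensional ℝ V] (o : Δ.Orientation) (τ : Δ.Cone) (i : ℕ) : Type u :=
  ↥(LinearMap.ker (bdMap o τ) ⊓ bdChains τ i) ⧸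
    ((bdChains τ (i + 1)).map (bdMap o τ)).comap
      (LinearMap.ker (bdMap o τ) ⊓ bdChains τ i).subtype

/-- `|∂Δ|` is a real homology manifold of dimension `n - 1`: at each of its points, that is, on the
relative interior of each cone of `∂Δ`, the local homology is that of `ℝ^(n-1)`. (The local homology
does not depend on the orientations.) -/
def BoundaryIsHomologyManifold [FiniteDimensional ℝ V] (Δ : Fan V) : Prop :=
  ∃ o : Δ.Orientation, ∀ τ ∈ Δ.boundary, ∀ i : ℕ,
    Module.finrank ℝ (LocalHomology o τ i) = if i + 1 = Module.finrank ℝ V then 1 else 0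

/-- Quasi-convex fans: purely `n`-dimensional, with `|∂Δ|` a real homology manifold. -/
def IsQuasiConvex [FiniteDimensional ℝ V] (Δ : Fan V) : Prop :=
  Δ.IsPure ∧ Δ.BoundaryIsHomologyManifold

end Fan

open Fan

/-! ### Perverse sheaves -/

/-- A sheaf of graded modules over the sheaf `σ ↦ S(V_σ^*)` of piecewise polynomials on the fan
space (whose open sets are the subfans), given by its sections over the affine open fans and the
restriction maps between them. -/
structure FanSheaf (Δ : Fan V) where
  obj : Δ.Cone → Type w
  [addCommGroup : ∀ σ, AddCommGroup (obj σ)]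
  [module : ∀ σ, Module (Poly (lin σ)) (obj σ)]
  res : ∀ {σ τ : Δ.Cone}, τ ≤ σ → obj σ →+ obj τ
  res_refl : ∀ (σ : Δ.Cone) (x : obj σ), res (le_refl σ) x = x
  res_res : ∀ {σ τ ρ : Δ.Cone} (h₁ : τ ≤ σ) (h₂ : ρ ≤ τ) (x : obj σ),
    res h₂ (res h₁ x) = res (h₂.trans h₁) x
  res_smul : ∀ {σ τ : Δ.Cone} (h : τ ≤ σ) (a : Poly (lin σ)) (x : obj σ),
    res h (a • x) = polyRes (linIncl h) a • res h x
  gr : ∀ σ : Δ.Cone, ℤ → AddSubgroup (obj σ)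
  isInternal_gr : ∀ σ, DirectSum.IsInternal (gr σ)
  smul_mem_gr : ∀ (σ : Δ.Cone) {i j : ℤ} {a : Poly (lin σ)} {x : obj σ},
    a ∈ polyGr (lin σ) i → x ∈ gr σ j → a • x ∈ gr σ (i + j)
  res_mem_gr : ∀ {σ τ : Δ.Cone} (h : τ ≤ σ) {i : ℤ} {x : obj σ}, x ∈ gr σ i → res h x ∈ gr τ i

namespace FanSheaf

variable {Δ : Fan V}

attribute [instance] FanSheaf.addCommGroup FanSheaf.module

section sheaf

variable (F : FanSheaf.{u, w} Δ)

/-- Every module of sections over a cone is an `S(V^*)`-module through `S(V^*) → S(V_σ^*)`. -/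
instance (σ : Δ.Cone) : Module (Poly V) (F.obj σ) :=
  Module.compHom (F.obj σ) (polyRes (lin σ).subtype).toRingHom

theorem smul_eq {σ : Δ.Cone} (a : Poly V) (x : F.obj σ) :
    a • x = polyRes (lin σ).subtype a • x := rfl

theorem res_poly_smul {σ τ : Δ.Cone} (h : τ ≤ σ) (a : Poly V) (x : F.obj σ) :
    F.res h (a • x) = a • F.res h x := by
  rw [smul_eq, F.res_smul, polyRes_comp]
  rfl

/-- The sections `F_Λ` over a subfan `Λ`: compatible families. -/
def sections (Λ : Set Δ.Cone) : Submodule (Poly V) (∀ σ : Λ, F.obj σ) where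
  carrier := {s | ∀ (σ τ : Λ) (h : τ.1 ≤ σ.1), F.res h (s σ) = s τ}
  zero_mem' _ _ _ := map_zero _
  add_mem' ha hb σ τ h := by simp [ha σ τ h, hb σ τ h]
  smul_mem' r a ha σ τ h := by simp [res_poly_smul, ha σ τ h]

/-- The restriction map `F_Λ → F_{Λ₀}`. -/
def restrict {Λ Λ₀ : Set Δ.Cone} (h : Λ₀ ⊆ Λ) : F.sections Λ →ₗ[Poly V] F.sections Λ₀ where
  toFun s := ⟨fun σ => s.1 ⟨σ.1, h σ.2⟩, fun σ τ hτ => s.2 ⟨σ.1, h σ.2⟩ ⟨τ.1, h τ.2⟩ hτ⟩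
  map_add' _ _ := rfl
  map_smul' _ _ := rfl

/-- The sections `F_{(Λ,Λ₀)}` over `Λ` that vanish on `Λ₀`. -/
def rel {Λ Λ₀ : Set Δ.Cone} (h : Λ₀ ⊆ Λ) : Submodule (Poly V) (F.sections Λ) :=
  LinearMap.ker (F.restrict h)

/-- The module `F_{(Δ,∂Δ)}` of global sections that vanish on `∂Δ`. -/
abbrev compactSections : Submodule (Poly V) (F.sections Set.univ) :=
  F.rel (Set.subset_univ Δ.boundary)

/-- The `S(V_σ^*)`-module `F_{(σ,∂σ)}` of sections over `σ` that vanish on all proper faces. -/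
def relCone (σ : Δ.Cone) : Submodule (Poly (lin σ)) (F.obj σ) where
  carrier := {x | ∀ (τ : Δ.Cone) (h : τ < σ), F.res h.le x = 0}
  zero_mem' _ _ := map_zero _
  add_mem' ha hb τ h := by simp [ha τ h, hb τ h]
  smul_mem' r a ha τ h := by simp [F.res_smul, ha τ h]

/-- A sheaf is flabby if all sections over open sets (i.e. subfans) extend to global sections. -/
def IsFlabby : Prop :=
  ∀ Λ : Set Δ.Cone, IsLowerSet Λ → Function.Surjective (F.restrict (Set.subset_univ Λ))

/-- Perverse sheaves: flabby, with finitely generated free modules of sections over the cones. -/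
structure IsPerverse : Prop where
  flabby : F.IsFlabby
  finite : ∀ σ, Module.Finite (Poly (lin σ)) (F.obj σ)
  free : ∀ σ, Module.Free (Poly (lin σ)) (F.obj σ)

/-- The trivial extension `F_{(σ,∂σ)} → F_{(Δ,∂Δ)}` for a cone `σ` of full dimension: the section
which is `x` on `σ` and zero on every other cone. -/
def extendByZero [FiniteDimensional ℝ V] (σ : Δ.Cone) (hσ : dim σ = Module.finrank ℝ V)
    (x : F.relCone σ) : F.compactSections :=
  open Classical in
  ⟨⟨fun τ => Pi.single (M := F.obj) σ x.1 τ.1, by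
    intro ρ τ h
    obtain ⟨ρ, -⟩ := ρ
    obtain ⟨τ, -⟩ := τ
    dsimp only at h ⊢
    by_cases hρ : ρ = σ
    · subst hρ
      rcases h.eq_or_lt with h' | h'
      · subst h'
        exact F.res_refl _ _
      · rw [Pi.single_eq_same, Pi.single_eq_of_ne h'.ne]
        exact x.2 τ h'
    · have hτ : τ ≠ σ := by
        rintro rfl
        exact hρ (eq_of_le_of_dim_le h (hσ ▸ Submodule.finrank_le _)).symm
      rw [Pi.single_eq_of_ne hρ, Pi.single_eq_of_ne hτ, map_zero]⟩, by
    refine LinearMap.mem_ker.mpr (Subtype.ext (funext fun τ => ?_))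
    refine Pi.single_eq_of_ne ?_ _
    intro hτ
    obtain ⟨ρ, hρ, hd, -⟩ := τ.2
    rw [hτ] at hρ
    have : dim σ ≤ dim ρ := Submodule.finrank_mono (lin_mono hρ)
    omega⟩

/-! ### The dual sheaf -/

/-- `k ∈ F_σ` extends the section of `F_{∂σ}` which is `g` on the facet `τ` and zero on the
other proper faces of `σ`. -/
def IsExt {τ σ : Δ.Cone} (hf : IsFacet τ σ) (g : F.relCone τ) (k : F.obj σ) : Prop :=
  F.res hf.1 k = g ∧ ∀ (ρ : Δ.Cone) (h : ρ < σ), ρ ≠ τ → F.res h.le k = 0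

variable {F}

theorem IsFlabby.exists_isExt [FiniteDimensional ℝ V] (hF : F.IsFlabby) {τ σ : Δ.Cone}
    (hf : IsFacet τ σ) (g : F.relCone τ) : ∃ k : F.obj σ, F.IsExt hf g k := by
  classical
  let s : F.sections (Set.Iio σ) := ⟨fun ρ => Pi.single (M := F.obj) τ g.1 ρ.1, by
    intro ρ κ h
    obtain ⟨ρ, hρσ⟩ := ρ
    obtain ⟨κ, -⟩ := κ
    dsimp only at h ⊢
    by_cases hρ : ρ = τ
    · subst hρ
      rcases h.eq_or_lt with h' | h'
      · subst h'
        exact F.res_refl _ _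
      · rw [Pi.single_eq_same, Pi.single_eq_of_ne h'.ne]
        exact g.2 κ h'
    · have hκ : κ ≠ τ := by
        intro hκ
        exact hρ (hf.eq_of_le_of_lt (hκ ▸ h) hρσ)
      rw [Pi.single_eq_of_ne hρ, Pi.single_eq_of_ne hκ, map_zero]⟩
  obtain ⟨t, ht⟩ := hF (Set.Iio σ) (isLowerSet_Iio σ) s
  have key : ∀ (ρ : Δ.Cone) (h : ρ < σ),
      F.res h.le (t.1 ⟨σ, trivial⟩) = Pi.single (M := F.obj) τ g.1 ρ := by
    intro ρ h
    rw [t.2 ⟨σ, trivial⟩ ⟨ρ, trivial⟩ h.le]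
    exact congrFun (congrArg Subtype.val ht) ⟨ρ, h⟩
  refine ⟨t.1 ⟨σ, trivial⟩, ?_, fun ρ h hne => ?_⟩
  · rw [key τ hf.lt, Pi.single_eq_same]
  · rw [key ρ h, Pi.single_eq_of_ne hne]

theorem IsExt.smul_mem {τ σ : Δ.Cone} {hf : IsFacet τ σ} {g : F.relCone τ} {k : F.obj σ}
    (hk : F.IsExt hf g k) {h : Module.Dual ℝ (lin σ)} (hh : IsFacetForm h hf) :
    SymmetricAlgebra.ι ℝ _ h • k ∈ F.relCone σ := by
  intro ρ hρ
  rw [F.res_smul]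
  by_cases hne : ρ = τ
  · subst hne
    rw [polyRes_ι, hh.dualMap_eq_zero, map_zero, zero_smul]
  · rw [hk.2 ρ hρ hne, smul_zero]

/-- The polynomial `f(h k)|_τ` depends only on the section that `k` extends. -/
theorem IsExt.congr {τ σ : Δ.Cone} {hf : IsFacet τ σ} {g : F.relCone τ} {k k' : F.obj σ}
    (hk : F.IsExt hf g k) (hk' : F.IsExt hf g k') {h : Module.Dual ℝ (lin σ)}
    (hh : IsFacetForm h hf) (f : F.relCone σ →ₗ[Poly (lin σ)] Poly (lin σ)) :
    polyRes (linIncl hf.1) (f ⟨_, hk.smul_mem hh⟩) =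
      polyRes (linIncl hf.1) (f ⟨_, hk'.smul_mem hh⟩) := by
  have hd : k - k' ∈ F.relCone σ := by
    intro ρ hρ
    by_cases hne : ρ = τ
    · subst hne
      rw [map_sub, hk.1, hk'.1, sub_self]
    · rw [map_sub, hk.2 ρ hρ hne, hk'.2 ρ hρ hne, sub_self]
  rw [← sub_eq_zero, ← map_sub, ← map_sub]
  have : (⟨_, hk.smul_mem hh⟩ : F.relCone σ) - ⟨_, hk'.smul_mem hh⟩ =
      SymmetricAlgebra.ι ℝ _ h • (⟨k - k', hd⟩ : F.relCone σ) :=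
    Subtype.ext (smul_sub _ _ _).symm
  rw [this, map_smul, smul_eq_mul, map_mul, polyRes_ι, hh.dualMap_eq_zero, map_zero, zero_mul]

/-- The map `φ_h : Hom(F_{(σ,∂σ)}, S(V_σ^*)) → Hom(F_{(τ,∂τ)}, S(V_τ^*))`: extend
`g ∈ F_{(τ,∂τ)}` trivially to `∂σ`, then to a section `k` over `σ`, and send `g` to `f(h k)|_τ`. -/
def phi [FiniteDimensional ℝ V] (hF : F.IsFlabby) {τ σ : Δ.Cone} {hf : IsFacet τ σ}
    {h : Module.Dual ℝ (lin σ)} (hh : IsFacetForm h hf) :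
    (F.relCone σ →ₗ[Poly (lin σ)] Poly (lin σ)) →ₗ[ℝ]
      (F.relCone τ →ₗ[Poly (lin τ)] Poly (lin τ)) where
  toFun f :=
    { toFun := fun g => polyRes (linIncl hf.1)
        (f ⟨_, (hF.exists_isExt hf g).choose_spec.smul_mem hh⟩)
      map_add' := by
        intro g g'
        have h1 := (hF.exists_isExt hf g).choose_spec
        have h2 := (hF.exists_isExt hf g').choose_spec
        have h3 : F.IsExt hf (g + g')
            ((hF.exists_isExt hf g).choose + (hF.exists_isExt hf g').choose) :=
          ⟨by rw [map_add, h1.1, h2.1]; rfl,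
            fun ρ hρ hne => by rw [map_add, h1.2 ρ hρ hne, h2.2 ρ hρ hne, add_zero]⟩
        rw [(hF.exists_isExt hf (g + g')).choose_spec.congr h3 hh, ← map_add, ← map_add]
        congr 2
        apply Subtype.ext
        exact smul_add (SymmetricAlgebra.ι ℝ _ h) _ _
      map_smul' := by
        intro a g
        obtain ⟨b, rfl⟩ := polyRes_surjective (linIncl hf.1)
          (Submodule.inclusion_injective _) a
        have h1 := (hF.exists_isExt hf g).choose_spec
        have h3 : F.IsExt hf (polyRes (linIncl hf.1) b • g) (b • (hF.exists_isExt hf g).choose) :=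
          ⟨by rw [F.res_smul, h1.1]; rfl,
            fun ρ hρ hne => by rw [F.res_smul, h1.2 ρ hρ hne, smul_zero]⟩
        rw [(hF.exists_isExt hf _).choose_spec.congr h3 hh, RingHom.id_apply, smul_eq_mul,
          ← map_mul, ← smul_eq_mul, ← map_smul]
        congr 2
        apply Subtype.ext
        exact smul_comm (SymmetricAlgebra.ι ℝ _ h) b _ }
  map_add' f f' := by
    ext g
    simp
  map_smul' r f := by
    ext g
    simp

variable (F)

/-- The module `(DF)_σ = Hom(F_{(σ,∂σ)}, S(V_σ^*)) ⊗ det V_σ^*`. -/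
abbrev DualObj (σ : Δ.Cone) : Type (max u w) :=
  (F.relCone σ →ₗ[Poly (lin σ)] Poly (lin σ)) ⊗[ℝ] DetDual (lin σ)

/-- `(DF)_σ` is an `S(V^*)`-module through `S(V^*) → S(V_σ^*)`. -/
instance dualObjModule (σ : Δ.Cone) : Module (Poly V) (F.DualObj σ) :=
  Module.compHom (F.DualObj σ) (polyRes (lin σ).subtype).toRingHom

theorem dual_smul_eq {σ : Δ.Cone} (a : Poly V) (x : F.DualObj σ) :
    a • x = polyRes (lin σ).subtype a • x := rfl

variable {F}

/-- The restriction map `ϱ^σ_τ = ε^σ_τ (φ_h ⊗ ψ_h)` of the dual sheaf for a facet `τ` of `σ`. (Here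
`φ_h ⊗ ψ_h` is the same for all linear forms `h` with kernel `V_τ`.) -/
def dualRes [FiniteDimensional ℝ V] (o : Δ.Orientation) (hF : F.IsFlabby) {τ σ : Δ.Cone}
    (hf : IsFacet τ σ) : F.DualObj σ →ₗ[ℝ] F.DualObj τ :=
  o.sign hf • TensorProduct.map (phi hF (isFacetForm_facetForm hf))
    (psi (isFacetForm_facetForm hf))

theorem phi_smul [FiniteDimensional ℝ V] (hF : F.IsFlabby) {τ σ : Δ.Cone} {hf : IsFacet τ σ}
    {h : Module.Dual ℝ (lin σ)} (hh : IsFacetForm h hf) (a : Poly (lin σ))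
    (f : F.relCone σ →ₗ[Poly (lin σ)] Poly (lin σ)) :
    phi hF hh (a • f) = polyRes (linIncl hf.1) a • phi hF hh f := by
  ext g
  simp [phi]

theorem dualRes_smul [FiniteDimensional ℝ V] (o : Δ.Orientation) (hF : F.IsFlabby)
    {τ σ : Δ.Cone} (hf : IsFacet τ σ) (a : Poly V) (t : F.DualObj σ) :
    dualRes o hF hf (a • t) = a • dualRes o hF hf t := by
  induction t using TensorProduct.induction_on with
  | zero => simp
  | add x y hx hy => rw [smul_add, map_add, hx, hy, map_add, smul_add]
  | tmul f ω =>
    rw [dual_smul_eq, TensorProduct.smul_tmul', dual_smul_eq, dualRes, LinearMap.smul_apply,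
      LinearMap.smul_apply, TensorProduct.map_tmul, TensorProduct.map_tmul, phi_smul, polyRes_comp,
      ← TensorProduct.smul_tmul', smul_comm]
    rfl

/-- The `S(V^*)`-module `(DF)_Δ` of global sections of the dual sheaf: families that are compatible
with the restriction maps. Since the restriction map for an arbitrary pair of cones `τ ≤ σ` is the
composition of those along a chain of facets from `σ` down to `τ`, compatibility with the latter is
what is required. -/
def dualSections [FiniteDimensional ℝ V] (o : Δ.Orientation) (hF : F.IsFlabby) :
    Submodule (Poly V) (∀ σ : Δ.Cone, F.DualObj σ) where
  carrier := {s | ∀ (τ σ : Δ.Cone) (hf : IsFacet τ σ), dualRes o hF hf (s σ) = s τ}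
  zero_mem' _ _ _ := map_zero _
  add_mem' ha hb τ σ h := by simp [ha τ σ h, hb τ σ h]
  smul_mem' r a ha τ σ h := by simp [dualRes_smul, ha τ σ h]

variable (F)

/-- The degree `q` part of `Hom(F_{(σ,∂σ)}, S(V_σ^*)) ⊗ det V_σ^*`, where `det V_σ^*` has degree
`2 dim σ`. -/
def dualGr (σ : Δ.Cone) (q : ℤ) : Submodule ℝ (F.DualObj σ) :=
  Submodule.span ℝ {t | ∃ (f : F.relCone σ →ₗ[Poly (lin σ)] Poly (lin σ)) (ω : DetDual (lin σ)),
    (∀ (p : ℤ) (x : F.relCone σ), x.1 ∈ F.gr σ p →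
      f x ∈ polyGr (lin σ) (p + (q - 2 * (dim σ : ℤ)))) ∧ t = f ⊗ₜ[ℝ] ω}

/-- The `S(V^*)`-module `Hom(F_{(Δ,∂Δ)}, S(V^*)) ⊗ det V^*`. -/
abbrev GlobalDual : Type (max u w) :=
  (F.compactSections →ₗ[Poly V] Poly V) ⊗[ℝ] DetDual V

/-- The degree `q` part of `Hom(F_{(Δ,∂Δ)}, S(V^*)) ⊗ det V^*`, where `det V^*` has degree `2n`. -/
def globalDualGr (q : ℤ) : Submodule ℝ F.GlobalDual :=
  Submodule.span ℝ {t | ∃ (f : F.compactSections →ₗ[Poly V] Poly V) (ω : DetDual V),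
    (∀ (p : ℤ) (s : F.compactSections), (∀ σ, s.1.1 σ ∈ F.gr σ.1 p) →
      f s ∈ polyGr V (p + (q - 2 * (Module.finrank ℝ V : ℤ)))) ∧ t = f ⊗ₜ[ℝ] ω}

end sheaf

/-! ### Morphisms -/

/-- Homomorphisms of sheaves of modules. -/
structure Hom (F G : FanSheaf.{u, w} Δ) where
  app : ∀ σ : Δ.Cone, F.obj σ →ₗ[Poly (lin σ)] G.obj σ
  app_res : ∀ {σ τ : Δ.Cone} (h : τ ≤ σ) (x : F.obj σ), app τ (F.res h x) = G.res h (app σ x)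

namespace Hom

variable {F G : FanSheaf.{u, w} Δ} (f : Hom F G)

/-- The induced map `F_{(σ,∂σ)} → G_{(σ,∂σ)}`. -/
def relCone (σ : Δ.Cone) : F.relCone σ →ₗ[Poly (lin σ)] G.relCone σ :=
  (f.app σ).restrict fun x hx τ h => by rw [← f.app_res, hx τ h, map_zero]

/-- The induced map `(DG)_σ → (DF)_σ`. -/
def dualObj (σ : Δ.Cone) : G.DualObj σ →ₗ[ℝ] F.DualObj σ :=
  TensorProduct.map (LinearMap.lcomp ℝ (Poly (lin σ)) (f.relCone σ)) LinearMap.id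

/-- The induced map `F_Λ → G_Λ`. -/
def sections (Λ : Set Δ.Cone) : F.sections Λ →ₗ[Poly V] G.sections Λ where
  toFun s := ⟨fun σ => f.app σ (s.1 σ), fun σ τ h => by
    rw [← f.app_res, s.2 σ τ h]⟩
  map_add' s t := Subtype.ext (funext fun σ => map_add (f.app σ) _ _)
  map_smul' a s := Subtype.ext (funext fun σ => map_smul (f.app σ) _ _)

/-- The induced map `F_{(Δ,∂Δ)} → G_{(Δ,∂Δ)}`. -/
def compactSections : F.compactSections →ₗ[Poly V] G.compactSections :=
  (f.sections Set.univ).restrict fun s hs => by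
    refine LinearMap.mem_ker.mpr (Subtype.ext (funext fun σ => ?_))
    have h : s.1 ⟨σ.1, trivial⟩ = 0 :=
      congrFun (congrArg Subtype.val (LinearMap.mem_ker.mp hs)) σ
    change f.app σ (s.1 ⟨σ.1, trivial⟩) = 0
    rw [h, map_zero]

/-- The induced map `Hom(G_{(Δ,∂Δ)}, S(V^*)) ⊗ det V^* → Hom(F_{(Δ,∂Δ)}, S(V^*)) ⊗ det V^*`. -/
def globalDual : G.GlobalDual →ₗ[ℝ] F.GlobalDual :=
  TensorProduct.map (LinearMap.lcomp ℝ (Poly V) f.compactSections) LinearMap.id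

end Hom

end FanSheaf

end FanDuality

end

/-!
Let `n = dim V`. A section of the dual sheaf over a pure fan is determined by its values on the
`n`-dimensional cones, and so is a linear form `ψ` on `F_{(Δ,∂Δ)}` by its restrictions
`ψ ∘ ext_σ` to them: if `p` is the product of linear forms defining the hyperplanes spanned by the
cones of dimension `n - 1` (`formProd Δ.walls`), then `p s = ∑ ext_σ (p s_σ)` for every compactly
supported section `s`, and `S(V^*)` is a domain (`eq_of_dualRestrict_eq`). So both sides of the
isomorphism are submodules of the product of the `(DF)_σ` over the `n`-dimensional cones `σ`. Both
turn out to be given by the same conditions, one for each pair of `n`-dimensional cones `σ`, `σ'`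
with a common facet `τ`: that `φ_h` of the form on `F_{(σ,∂σ)}` and `φ_{-h}` of the form on
`F_{(σ',∂σ')}` agree, where `h` is a linear form on `V` with kernel `V_τ`.

For linear forms on `F_{(Δ,∂Δ)}` the condition is necessary since, for a section `s` supported on
the star of `τ`, the section `h s` is a sum of extensions from `σ` and `σ'`, and `ψ (h s) = h ψ s`
vanishes on `τ` (`smul_phi_dualRestrict`). It is sufficient since it makes `∑ φ_σ (p s_σ)` divisible
by each wall form, hence by `p`, and `p⁻¹ ∑ φ_σ (p s_σ)` is the form required
(`exists_dualRestrict_eq`).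

For sections of the dual sheaf the condition is compatibility on `τ`, as the orientations are
constant on the `n`-dimensional cones (`dualRes_tmul_detRes_eq_iff`). That compatibility in
codimension one is sufficient (`IsQuasiConvex.exists_compatible`) rests on two facts. The
restriction maps along the two chains between cones of codimension two agree, because the
compositions of the maps `ψ_h` and the products of the transition coefficients both change sign
(`dualRes_dualRes`). And for each cone `ρ` of
codimension at least two any two cones having `ρ` as a facet are linked by cones of dimension
`dim ρ + 2` (`IsQuasiConvex.eq_of_diamond`). Inside one cone this is the connectedness of its
boundary away from `ρ` (`exists_facets_meeting`). Between different cones it uses that the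
`n`-dimensional cones containing `ρ` are connected through common facets containing `ρ`
(`IsQuasiConvex.facet_connected`), where the homology manifold condition enters: each class of a
decomposition of these cones has a boundary, which is a cycle of `∂Δ` at `ρ`. If there were two
classes, both cycles would be non-zero, since a non-empty class with zero boundary is everything
(`mem_of_crossing_closed`), and they would have disjoint supports; but the local homology in degree
`n - 1` has dimension one.

Homogeneity is read off from the values on the `n`-dimensional cones, using that a cofactor of the
homogeneous polynomial `p` in a homogeneous product is homogeneous; naturality holds on these cones
by construction, and passes to faces.
-/

noncomputable section

namespace FanDuality

/-! ### Finitely generated cones -/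

section cones

variable {V : Type u} [AddCommGroup V] [Module ℝ V]

/-- One step of Fourier–Motzkin elimination: adding a generator to a cone that is cut out by
finitely many linear inequalities. -/
theorem exists_inequalities_sup_span_singleton {C : PointedCone ℝ V} {s : Set (Module.Dual ℝ V)}
    (hs : s.Finite) (hC : ∀ x, x ∈ C ↔ ∀ f ∈ s, 0 ≤ f x) (g : V) :
    ∃ s' : Set (Module.Dual ℝ V), s'.Finite ∧
      ∀ x, x ∈ PointedCone.hull ℝ {g} ⊔ C ↔ ∀ f ∈ s', 0 ≤ f x := by
  -- the inequalities are those that `g` satisfies, and the positive combinations vanishing on `g`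
  -- of one that `g` satisfies and one that it violates
  refine ⟨{f ∈ s | 0 ≤ f g} ∪
    Set.image2 (fun f k => (f g) • k - (k g) • f) {f ∈ s | 0 ≤ f g} {k ∈ s | k g < 0},
    (hs.subset (Set.sep_subset _ _)).union ((hs.subset (Set.sep_subset _ _)).image2 _
      (hs.subset (Set.sep_subset _ _))), fun x => ⟨fun hx => ?_, fun hx => ?_⟩⟩
  · obtain ⟨y, hy, z, hz, rfl⟩ := Submodule.mem_sup.mp hx
    obtain ⟨c, rfl⟩ := Submodule.mem_span_singleton.mp hy
    have hc : 0 ≤ (c : ℝ) := c.2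
    have hcg : c • g = (c : ℝ) • g := rfl
    rw [hC] at hz
    rintro f (⟨hf, hfg⟩ | ⟨f, ⟨hf, hfg⟩, k, ⟨hk, hkg⟩, rfl⟩)
    · rw [map_add, hcg, map_smul, smul_eq_mul]
      have := hz f hf
      positivity
    · have h1 := hz f hf
      have h2 := hz k hk
      simp only [LinearMap.sub_apply, LinearMap.smul_apply, smul_eq_mul, map_add, hcg, map_smul]
      nlinarith [mul_nonneg hfg h2, mul_nonneg (neg_nonneg.mpr hkg.le) h1]
  · -- `c` is the smallest multiple of `g` whose subtraction satisfies the violated inequalities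
    set L : Set ℝ := insert 0 ((fun k : Module.Dual ℝ V => k x / k g) '' {k ∈ s | k g < 0}) with hL
    have hLfin : L.Finite := ((hs.subset (Set.sep_subset _ _)).image _).insert _
    obtain ⟨c, hcL, hc⟩ := Set.exists_max_image L id hLfin ⟨0, Set.mem_insert _ _⟩
    have hc0 : 0 ≤ c := hc 0 (Set.mem_insert _ _)
    refine Submodule.mem_sup.mpr ⟨c • g, ?_, x - c • g, (hC _).mpr fun f hf => ?_, by abel⟩
    · exact Submodule.mem_span_singleton.mpr ⟨⟨c, hc0⟩, rfl⟩
    · rw [map_sub, map_smul, smul_eq_mul]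
      rcases lt_or_ge (f g) 0 with hfg | hfg
      · have h1 : f x / f g ≤ c := hc _ (Set.mem_insert_of_mem _ ⟨f, ⟨hf, hfg⟩, rfl⟩)
        rw [div_le_iff_of_neg hfg] at h1
        linarith
      · rcases hcL with rfl | ⟨k, ⟨hk, hkg⟩, rfl⟩
        · have := hx f (Or.inl ⟨hf, hfg⟩)
          linarith
        · have h1 := hx _ (Or.inr ⟨f, ⟨hf, hfg⟩, k, ⟨hk, hkg⟩, rfl⟩)
          simp only [LinearMap.sub_apply, LinearMap.smul_apply, smul_eq_mul] at h1
          have h2 : f x - k x / k g * f g = (f g * k x - k g * f x) / (-(k g)) := by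
            have := hkg.ne
            field_simp
            ring
          rw [h2]
          exact div_nonneg h1 (by linarith)

/-- Finitely generated cones are cut out by finitely many linear inequalities. -/
theorem exists_inequalities_of_fg [FiniteDimensional ℝ V] {C : PointedCone ℝ V}
    (hC : Submodule.FG C) :
    ∃ s : Set (Module.Dual ℝ V), s.Finite ∧ ∀ x, x ∈ C ↔ ∀ f ∈ s, 0 ≤ f x := by
  classical
  obtain ⟨t, rfl⟩ := hC
  induction t using Finset.induction_on with
  | empty =>
    let b := Module.finBasis ℝ V
    refine ⟨Set.range b.coord ∪ Set.range (fun i => -b.coord i),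
      (Set.finite_range _).union (Set.finite_range _), fun x => ⟨fun hx => ?_, fun hx => ?_⟩⟩
    · have : x = 0 := by simpa using hx
      intro f _
      rw [this, map_zero]
    · have : x = 0 := by
        apply b.ext_elem
        intro i
        have h1 := hx _ (Or.inl ⟨i, rfl⟩)
        have h2 := hx _ (Or.inr ⟨i, rfl⟩)
        simp only [LinearMap.neg_apply, Module.Basis.coord_apply] at h1 h2
        rw [map_zero, Finsupp.zero_apply]
        linarith
      rw [this]
      exact zero_mem _
  | insert g t _ ih =>
    obtain ⟨s, hs, hst⟩ := ih
    obtain ⟨s', hs', h⟩ := exists_inequalities_sup_span_singleton hs hst g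
    refine ⟨s', hs', fun x => ?_⟩
    rw [Finset.coe_insert, Submodule.span_insert]
    exact h x

theorem isClosed_setOf_add_smul_mem [FiniteDimensional ℝ V] {C : PointedCone ℝ V}
    (hC : Submodule.FG C) (x v : V) : IsClosed {t : ℝ | x + t • v ∈ C} := by
  obtain ⟨s, -, h⟩ := exists_inequalities_of_fg hC
  have : {t : ℝ | x + t • v ∈ C} = ⋂ f ∈ s, {t : ℝ | 0 ≤ f x + t * f v} := by
    ext t
    simp [h]
  rw [this]
  exact isClosed_biInter fun f _ => isClosed_le continuous_const (by fun_prop)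

theorem add_smul_mem_of_le {C : PointedCone ℝ V} {x v : V} {ε δ : ℝ} (hx : x ∈ C)
    (h : x + ε • v ∈ C) (hδ : 0 ≤ δ) (hε : δ ≤ ε) : x + δ • v ∈ C := by
  rcases hδ.eq_or_lt with rfl | hδ
  · simpa using hx
  have h0 : 0 < ε := hδ.trans_le hε
  have : x + δ • v = (1 - δ / ε) • x + (δ / ε) • (x + ε • v) := by
    rw [smul_add, smul_smul, div_mul_cancel₀ _ h0.ne', sub_smul, one_smul]
    abel
  rw [this]
  have h1 : δ / ε ≤ 1 := (div_le_one h0).mpr hε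
  exact add_mem (PointedCone.smul_mem _ (by linarith) hx) (PointedCone.smul_mem _ (by positivity) h)

/-- Continuous induction along a segment that runs inside a union of finitely many cones. -/
theorem exists_mem_of_segment [FiniteDimensional ℝ V] {𝒞 : Set (PointedCone ℝ V)}
    (hfin : 𝒞.Finite) (hfg : ∀ C ∈ 𝒞, Submodule.FG C) {x y : V} (hx : ∃ C ∈ 𝒞, x ∈ C)
    (hstep : ∀ t : ℝ, 0 ≤ t → t < 1 → ∀ C ∈ 𝒞, x + t • (y - x) ∈ C →
      ∃ C' ∈ 𝒞, x + t • (y - x) ∈ C' ∧ ∃ ε : ℝ, 0 < ε ∧ x + t • (y - x) + ε • (y - x) ∈ C') :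
    ∃ C ∈ 𝒞, y ∈ C := by
  set S : Set ℝ := ⋃ C ∈ 𝒞, {t : ℝ | x + t • (y - x) ∈ C} with hS
  have hmem : ∀ t, t ∈ S ↔ ∃ C ∈ 𝒞, x + t • (y - x) ∈ C := by
    intro t
    simp [hS]
  have hcl : IsClosed S :=
    hfin.isClosed_biUnion fun C hC => isClosed_setOf_add_smul_mem (hfg C hC) _ _
  have key : Set.Icc (0 : ℝ) 1 ⊆ S := by
    apply IsClosed.Icc_subset_of_forall_mem_nhdsWithin (hcl.inter isClosed_Icc)
    · rw [hmem]
      simpa using hx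
    · rintro t ⟨htS, ht0, ht1⟩
      obtain ⟨C, hC, hxC⟩ := (hmem t).mp htS
      obtain ⟨C', hC', hxC', ε, hε, h⟩ := hstep t ht0 ht1 C hC hxC
      have hlt : t < t + ε := by linarith
      filter_upwards [Ioc_mem_nhdsGT hlt] with r hr
      rw [hmem]
      refine ⟨C', hC', ?_⟩
      have := add_smul_mem_of_le hxC' h (δ := r - t) (by linarith [hr.1]) (by linarith [hr.2])
      rw [add_assoc, ← add_smul] at this
      simpa using this
  have := (hmem 1).mp (key ⟨zero_le_one, le_rfl⟩)
  simpa using this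

/-- `p` lies in the relative interior of the cone `C`. -/
def IsRelInterior (C : PointedCone ℝ V) (p : V) : Prop :=
  p ∈ C ∧ ∀ y ∈ Submodule.span ℝ (C : Set V), ∃ ε : ℝ, 0 < ε ∧ p + ε • y ∈ C

theorem exists_sub_of_mem_span {C : PointedCone ℝ V} {y : V}
    (hy : y ∈ Submodule.span ℝ (C : Set V)) : ∃ a ∈ C, ∃ b ∈ C, y = a - b := by
  induction hy using Submodule.span_induction with
  | mem x hx => exact ⟨x, hx, 0, zero_mem _, by simp⟩
  | zero => exact ⟨0, zero_mem _, 0, zero_mem _, by simp⟩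
  | add x y _ _ hx hy =>
    obtain ⟨a, ha, b, hb, rfl⟩ := hx
    obtain ⟨c, hc, d, hd, rfl⟩ := hy
    exact ⟨a + c, add_mem ha hc, b + d, add_mem hb hd, by abel⟩
  | smul r x _ hx =>
    obtain ⟨a, ha, b, hb, rfl⟩ := hx
    rcases le_total 0 r with hr | hr
    · exact ⟨r • a, PointedCone.smul_mem _ hr ha, r • b, PointedCone.smul_mem _ hr hb,
        smul_sub r a b⟩
    · refine ⟨(-r) • b, PointedCone.smul_mem _ (by linarith) hb, (-r) • a,
        PointedCone.smul_mem _ (by linarith) ha, ?_⟩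
      simp only [neg_smul, smul_sub]
      abel

theorem isRelInterior_of_sub {C : PointedCone ℝ V} {p : V} (hp : p ∈ C)
    (h : ∀ y ∈ C, ∃ ε : ℝ, 0 < ε ∧ p - ε • y ∈ C) : IsRelInterior C p := by
  refine ⟨hp, fun y hy => ?_⟩
  obtain ⟨a, ha, b, hb, rfl⟩ := exists_sub_of_mem_span hy
  obtain ⟨ε, hε, h1⟩ := h b hb
  refine ⟨ε, hε, ?_⟩
  have : p + ε • (a - b) = (p - ε • b) + ε • a := by
    rw [smul_sub]
    abel
  rw [this]
  exact add_mem h1 (PointedCone.smul_mem _ hε.le ha)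

theorem IsRelInterior.exists_sub {C : PointedCone ℝ V} {p : V} (hp : IsRelInterior C p) {y : V}
    (hy : y ∈ C) : ∃ ε : ℝ, 0 < ε ∧ p - ε • y ∈ C := by
  obtain ⟨ε, hε, h⟩ := hp.2 (-y) (neg_mem (Submodule.subset_span hy))
  exact ⟨ε, hε, by simpa [sub_eq_add_neg] using h⟩

theorem IsRelInterior.add {C : PointedCone ℝ V} {p y : V} (hp : IsRelInterior C p) (hy : y ∈ C) :
    IsRelInterior C (p + y) := by
  refine ⟨add_mem hp.1 hy, fun z hz => ?_⟩
  obtain ⟨ε, hε, h⟩ := hp.2 z hz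
  refine ⟨ε, hε, ?_⟩
  rw [add_right_comm]
  exact add_mem h hy

theorem IsRelInterior.smul {C : PointedCone ℝ V} {p : V} (hp : IsRelInterior C p) {c : ℝ}
    (hc : 0 < c) : IsRelInterior C (c • p) := by
  refine ⟨PointedCone.smul_mem _ hc.le hp.1, fun z hz => ?_⟩
  obtain ⟨ε, hε, h⟩ := hp.2 z hz
  refine ⟨c * ε, by positivity, ?_⟩
  rw [mul_smul, ← smul_add]
  exact PointedCone.smul_mem _ hc.le h

/-- The sum of finitely many generators lies in the relative interior. -/
theorem exists_isRelInterior {C : PointedCone ℝ V} (hC : Submodule.FG C) :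
    ∃ p, IsRelInterior C p := by
  classical
  obtain ⟨t, rfl⟩ := hC
  have hmem : ∀ g ∈ t, g ∈ PointedCone.hull ℝ (t : Set V) := fun g hg => Submodule.subset_span hg
  refine ⟨∑ g ∈ t, g, isRelInterior_of_sub (Submodule.sum_mem _ hmem) fun y hy => ?_⟩
  induction hy using Submodule.span_induction with
  | mem g hg =>
    refine ⟨1, one_pos, ?_⟩
    rw [one_smul, ← Finset.add_sum_erase t (fun g => g) hg, add_sub_cancel_left]
    exact Submodule.sum_mem _ fun i hi => hmem i (Finset.mem_of_mem_erase hi)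
  | zero => exact ⟨1, one_pos, by rw [smul_zero, sub_zero]; exact Submodule.sum_mem _ hmem⟩
  | add x y _ _ hx hy =>
    obtain ⟨a, ha, h1⟩ := hx
    obtain ⟨b, hb, h2⟩ := hy
    refine ⟨a * b / (a + b), by positivity, ?_⟩
    have : ∑ g ∈ t, g - (a * b / (a + b)) • (x + y) = (b / (a + b)) • (∑ g ∈ t, g - a • x) +
        (a / (a + b)) • (∑ g ∈ t, g - b • y) := by
      match_scalars <;> (field_simp; try ring)
    rw [this]
    exact add_mem (PointedCone.smul_mem _ (by positivity) h1)
      (PointedCone.smul_mem _ (by positivity) h2)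
  | smul r x _ hx =>
    obtain ⟨a, ha, h1⟩ := hx
    have hr : 0 ≤ (r : ℝ) := r.2
    refine ⟨a / (r + 1), by positivity, ?_⟩
    have h3 : r • x = (r : ℝ) • x := rfl
    have : ∑ g ∈ t, g - (a / (r + 1)) • (r • x) =
        (r / (r + 1) : ℝ) • (∑ g ∈ t, g - a • x) + (1 / (r + 1) : ℝ) • ∑ g ∈ t, g := by
      rw [h3]
      match_scalars
      · field_simp
      · field_simp
    rw [this]
    exact add_mem (PointedCone.smul_mem _ (by positivity) h1)
      (PointedCone.smul_mem _ (by positivity) (Submodule.sum_mem _ hmem))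

theorem eq_of_isFaceOf_of_isRelInterior {F C : PointedCone ℝ V} (hF : F.IsFaceOf C) {p : V}
    (hp : IsRelInterior C p) (hpF : p ∈ F) : F = C := by
  refine le_antisymm hF.le fun y hy => ?_
  obtain ⟨ε, hε, h⟩ := hp.exists_sub hy
  refine hF.mem_of_smul_add_mem hy h hε ?_
  simpa using hpF

/-- The face of `C` that contains `x` in its relative interior. -/
def carrierFace (C : PointedCone ℝ V) {x : V} (hx : x ∈ C) : PointedCone ℝ V where
  carrier := {y | y ∈ C ∧ ∃ ε : ℝ, 0 < ε ∧ x - ε • y ∈ C}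
  zero_mem' := ⟨zero_mem _, 1, one_pos, by simpa using hx⟩
  add_mem' := by
    rintro y z ⟨hy, a, ha, h1⟩ ⟨hz, b, hb, h2⟩
    refine ⟨add_mem hy hz, a * b / (a + b), by positivity, ?_⟩
    have : x - (a * b / (a + b)) • (y + z) = (b / (a + b)) • (x - a • y) +
        (a / (a + b)) • (x - b • z) := by
      match_scalars <;> (field_simp; try ring)
    rw [this]
    exact add_mem (PointedCone.smul_mem _ (by positivity) h1)
      (PointedCone.smul_mem _ (by positivity) h2)
  smul_mem' := by
    rintro r y ⟨hy, a, ha, h1⟩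
    have hr : 0 ≤ (r : ℝ) := r.2
    have h3 : r • y = (r : ℝ) • y := rfl
    refine ⟨Submodule.smul_mem _ _ hy, a / (r + 1), by positivity, ?_⟩
    have : x - (a / (r + 1)) • (r • y) =
        (r / (r + 1) : ℝ) • (x - a • y) + (1 / (r + 1) : ℝ) • x := by
      rw [h3]
      match_scalars
      · field_simp
      · field_simp
    rw [this]
    exact add_mem (PointedCone.smul_mem _ (by positivity) h1)
      (PointedCone.smul_mem _ (by positivity) hx)

theorem carrierFace_isFaceOf (C : PointedCone ℝ V) {x : V} (hx : x ∈ C) :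
    (carrierFace C hx).IsFaceOf C where
  le _ hy := hy.1
  mem_of_smul_add_mem := by
    rintro y z a hy hz ha ⟨-, ε, hε, h⟩
    refine ⟨hy, ε * a, by positivity, ?_⟩
    have : x - (ε * a) • y = (x - ε • (a • y + z)) + ε • z := by
      module
    rw [this]
    exact add_mem h (PointedCone.smul_mem _ hε.le hz)

theorem isRelInterior_carrierFace (C : PointedCone ℝ V) {x : V} (hx : x ∈ C) :
    IsRelInterior (carrierFace C hx) x := by
  refine isRelInterior_of_sub ⟨hx, 1, one_pos, by simp⟩ ?_
  rintro y ⟨hy, ε, hε, h⟩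
  exact ⟨ε, hε, h, 1, one_pos, by simpa using PointedCone.smul_mem _ hε.le hy⟩

end cones

namespace Fan

/-! ### Faces, facets and local cones of a fan -/

section faces

variable {V : Type u} [AddCommGroup V] [Module ℝ V] {Δ : Fan V}

theorem exists_relInterior (σ : Δ.Cone) : ∃ p, IsRelInterior σ.1 p :=
  exists_isRelInterior (Δ.fg σ.1 σ.2)

theorem le_of_isRelInterior {κ τ : Δ.Cone} {p : V} (hp : IsRelInterior κ.1 p) (hpτ : p ∈ τ.1) :
    κ ≤ τ := by
  have h := eq_of_isFaceOf_of_isRelInterior (Δ.inf_isFaceOf κ.1 κ.2 τ.1 τ.2) hp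
    (Submodule.mem_inf.mpr ⟨hp.1, hpτ⟩)
  exact inf_eq_left.mp h

/-- The cone `σ - ρ`; for a face `ρ` of `σ` it is the cone of those directions that point from the
relative interior of `ρ` into `σ`. -/
def localCone (σ ρ : Δ.Cone) : PointedCone ℝ V :=
  σ.1 ⊔ PointedCone.map (-LinearMap.id) ρ.1

theorem mem_localCone {σ ρ : Δ.Cone} {x : V} : x ∈ localCone σ ρ ↔ ∃ y ∈ ρ.1, x + y ∈ σ.1 := by
  constructor
  · intro h
    obtain ⟨a, ha, b, hb, rfl⟩ := Submodule.mem_sup.mp h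
    obtain ⟨c, hc, rfl⟩ := PointedCone.mem_map.mp hb
    exact ⟨c, hc, by simpa using ha⟩
  · rintro ⟨y, hy, h⟩
    exact Submodule.mem_sup.mpr ⟨x + y, h, -y, PointedCone.mem_map.mpr ⟨y, hy, by simp⟩, by simp⟩

theorem localCone_fg (σ ρ : Δ.Cone) : Submodule.FG (localCone σ ρ) :=
  (Δ.fg σ.1 σ.2).sup ((Δ.fg ρ.1 ρ.2).map _)

theorem mem_localCone_of_mem {σ ρ : Δ.Cone} {x : V} (hx : x ∈ σ.1) : x ∈ localCone σ ρ :=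
  Submodule.mem_sup_left hx

theorem mem_localCone_of_mem_lin {σ ρ : Δ.Cone} (h : ρ ≤ σ) {x : V} (hx : x ∈ lin ρ) :
    x ∈ localCone σ ρ := by
  obtain ⟨a, ha, b, hb, rfl⟩ := exists_sub_of_mem_lin hx
  exact mem_localCone.mpr ⟨b, hb, by simpa using h ha⟩

/-- The lineality space of the local cone of `σ` at a face `ρ` is `V_ρ`. -/
theorem mem_lin_of_mem_localCone_of_neg_mem {σ ρ : Δ.Cone} (h : ρ ≤ σ) {x : V}
    (hx : x ∈ localCone σ ρ) (hx' : -x ∈ localCone σ ρ) : x ∈ lin ρ := by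
  obtain ⟨y, hy, hxy⟩ := mem_localCone.mp hx
  obtain ⟨z, hz, hxz⟩ := mem_localCone.mp hx'
  have h1 : (x + y) + (-x + z) ∈ ρ.1 := by
    have : (x + y) + (-x + z) = y + z := by abel
    rw [this]
    exact add_mem hy hz
  have h2 : x + y ∈ ρ.1 := (isFaceOf_of_le h).mem_of_add_mem_left hxy hxz h1
  have h3 : x + y ∈ lin ρ := Submodule.subset_span h2
  simpa using sub_mem h3 (Submodule.subset_span hy : y ∈ lin ρ)

/-- A point of the local cone of `σ` at `ρ` lies, after a translation by a point of `ρ`, in the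
relative interior of a face of `σ` containing `ρ`. -/
theorem exists_carrier {σ ρ : Δ.Cone} (h : ρ ≤ σ) {x : V} (hx : x ∈ localCone σ ρ) :
    ∃ κ : Δ.Cone, ρ ≤ κ ∧ κ ≤ σ ∧ ∃ y ∈ ρ.1, IsRelInterior κ.1 (x + y) := by
  obtain ⟨y, hy, hxy⟩ := mem_localCone.mp hx
  obtain ⟨p, hp⟩ := exists_relInterior ρ
  have hm : x + (y + p) ∈ σ.1 := by
    rw [← add_assoc]
    exact add_mem hxy (h hp.1)
  refine ⟨⟨carrierFace σ.1 hm, Δ.face_mem σ.1 σ.2 _ (carrierFace_isFaceOf _ _)⟩, ?_,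
    (carrierFace_isFaceOf σ.1 hm).le, y + p, add_mem hy hp.1, isRelInterior_carrierFace σ.1 hm⟩
  intro r hr
  obtain ⟨ε, hε, h1⟩ := hp.exists_sub hr
  refine ⟨h hr, ε, hε, ?_⟩
  have : x + (y + p) - ε • r = (x + y) + (p - ε • r) := by abel
  rw [this]
  exact add_mem hxy (h h1)

theorem mem_lin_of_add_isRelInterior {ρ κ : Δ.Cone} (h : ρ ≤ κ) {x y : V} (hy : y ∈ ρ.1)
    (hxy : IsRelInterior κ.1 (x + y)) : x ∈ lin κ := by
  have h1 : x + y ∈ lin κ := Submodule.subset_span hxy.1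
  simpa using sub_mem h1 (Submodule.subset_span (h hy) : y ∈ lin κ)

/-- From a point in the relative interior of `κ`, one can move a little in each direction of the
local cone at `κ`. -/
theorem exists_add_smul_mem_localCone {σ ρ κ : Δ.Cone} (hκ : κ ≤ σ) {x y w : V}
    (hy : y ∈ ρ.1) (hxy : IsRelInterior κ.1 (x + y)) (hw : w ∈ localCone σ κ) :
    ∃ ε : ℝ, 0 < ε ∧ x + ε • w ∈ localCone σ ρ := by
  obtain ⟨z, hz, hwz⟩ := mem_localCone.mp hw
  obtain ⟨ε, hε, h1⟩ := hxy.exists_sub hz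
  refine ⟨ε, hε, mem_localCone.mpr ⟨y, hy, ?_⟩⟩
  have : x + ε • w + y = (x + y - ε • z) + ε • (w + z) := by
    rw [smul_add]
    abel
  rw [this]
  exact add_mem (hκ h1) (PointedCone.smul_mem _ hε.le hwz)

/-- A cone of codimension one belongs to the boundary if it does not separate two
full-dimensional cones. -/
theorem mem_boundary_of_unique {τ σ : Δ.Cone} (hf : IsFacet τ σ) (hσ : dim σ = Module.finrank ℝ V)
    (h : ∀ σ', IsFacet τ σ' → σ' = σ) : τ ∈ Δ.boundary :=
  ⟨τ, le_rfl, hf.2.trans hσ, σ, ⟨hf.1, hσ⟩, fun σ' h' => h σ' ⟨h'.1, by rw [h'.2, hf.2, hσ]⟩⟩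

variable [FiniteDimensional ℝ V]

theorem dim_lt_of_lt {τ σ : Δ.Cone} (h : τ < σ) : dim τ < dim σ := by
  by_contra hc
  exact h.ne (eq_of_le_of_dim_le h.le (not_lt.mp hc))

theorem dim_le_of_le {τ σ : Δ.Cone} (h : τ ≤ σ) : dim τ ≤ dim σ :=
  Submodule.finrank_mono (lin_mono h)

theorem dim_le_finrank (σ : Δ.Cone) : dim σ ≤ Module.finrank ℝ V := Submodule.finrank_le _

theorem lin_eq_top {σ : Δ.Cone} (h : dim σ = Module.finrank ℝ V) : lin σ = ⊤ :=
  Submodule.eq_top_of_finrank_eq h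

theorem mem_lin_of_dim_eq {σ : Δ.Cone} (h : dim σ = Module.finrank ℝ V) (x : V) : x ∈ lin σ := by
  rw [lin_eq_top h]
  trivial

/-- Every proper face is contained in a facet. -/
theorem exists_isFacet_ge {ρ σ : Δ.Cone} (h : ρ < σ) : ∃ τ : Δ.Cone, IsFacet τ σ ∧ ρ ≤ τ := by
  obtain ⟨τ, hρτ, ⟨hτ, hmax⟩⟩ :=
    (Set.toFinite {τ : Δ.Cone | τ < σ}).exists_le_maximal (a := ρ) h
  have hτ : τ < σ := hτ
  refine ⟨τ, ⟨hτ.le, ?_⟩, hρτ⟩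
  by_contra hne
  have hlt : dim τ + 1 < dim σ := lt_of_le_of_ne (dim_lt_of_lt hτ) hne
  -- by maximality, the local cone at `τ` is open in `V_σ` away from `V_τ`
  have hopen : ∀ x ∈ localCone σ τ, x ∉ lin τ → ∀ w ∈ lin σ,
      ∃ ε : ℝ, 0 < ε ∧ x + ε • w ∈ localCone σ τ := by
    intro x hx hxτ w hw
    obtain ⟨κ, h1, h2, y, hy, hxy⟩ := exists_carrier hτ.le hx
    have hκ : κ = σ := by
      by_contra hc
      have : κ ≤ τ := hmax (lt_of_le_of_ne h2 hc) h1
      exact hxτ (lin_mono this (mem_lin_of_add_isRelInterior h1 hy hxy))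
    subst hκ
    exact exists_add_smul_mem_localCone le_rfl hy hxy (mem_localCone_of_mem_lin le_rfl hw)
  obtain ⟨x, hxσ, hxτ⟩ := SetLike.not_le_iff_exists.mp
    (show ¬ σ.1 ≤ τ.1 from not_le_of_gt hτ)
  have hxτ : x ∉ lin τ := fun hc => hxτ (mem_of_mem_of_mem_lin hτ.le hxσ hc)
  -- hence it contains every `y` such that the segment from `x` to `y` does not meet `V_τ`
  have hall : ∀ y ∈ lin σ, y ∉ lin τ ⊔ Submodule.span ℝ {x} → y ∈ localCone σ τ := by
    intro y hy hyx
    have := exists_mem_of_segment (Set.finite_singleton (localCone σ τ))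
      (by rintro C rfl; exact localCone_fg _ _) (x := x) (y := y)
      ⟨_, rfl, mem_localCone_of_mem hxσ⟩ (by
        rintro t ht0 ht1 C rfl hC
        have hm : x + t • (y - x) ∉ lin τ := by
          intro hc
          rcases ht0.eq_or_lt with rfl | ht0
          · exact hxτ (by simpa using hc)
          · refine hyx ?_
            have : y = t⁻¹ • (x + t • (y - x)) + (1 - t⁻¹) • x := by
              match_scalars
              · field_simp
              · field_simp
                ring
            rw [this]
            exact add_mem (Submodule.mem_sup_left (Submodule.smul_mem _ _ hc))
              (Submodule.mem_sup_right (Submodule.smul_mem _ _ (Submodule.mem_span_singleton_self x)))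
        exact ⟨_, rfl, hC, hopen _ hC hm _ (sub_mem hy (Submodule.subset_span hxσ))⟩)
    obtain ⟨C, rfl, h⟩ := this
    exact h
  obtain ⟨y, hyσ, hy⟩ : ∃ y ∈ lin σ, y ∉ lin τ ⊔ Submodule.span ℝ {x} := by
    by_contra hc
    push Not at hc
    have h1 : dim σ ≤ Module.finrank ℝ ↥(lin τ ⊔ Submodule.span ℝ {x}) := Submodule.finrank_mono hc
    have h2 := Submodule.finrank_add_le_finrank_add_finrank (lin τ) (Submodule.span ℝ {x})
    have h3 := finrank_span_singleton (K := ℝ) (v := x) (by rintro rfl; exact hxτ (zero_mem _))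
    have h4 : Module.finrank ℝ (lin τ) = dim τ := rfl
    omega
  exact hy (Submodule.mem_sup_left (mem_lin_of_mem_localCone_of_neg_mem hτ.le (hall y hyσ hy)
    (hall (-y) (neg_mem hyσ) (by rwa [neg_mem_iff]))))

/-- A linear form on `V` that extends `facetForm`. -/
def facetFormExt {τ σ : Δ.Cone} (hf : IsFacet τ σ) : Module.Dual ℝ V :=
  (LinearMap.exists_extend (facetForm hf)).choose

theorem facetFormExt_apply {τ σ : Δ.Cone} (hf : IsFacet τ σ) (x : lin σ) :
    facetFormExt hf x = facetForm hf x :=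
  DFunLike.congr_fun (LinearMap.exists_extend (facetForm hf)).choose_spec x

theorem facetForm_eq_zero_iff {τ σ : Δ.Cone} (hf : IsFacet τ σ) {x : lin σ} :
    facetForm hf x = 0 ↔ x.1 ∈ lin τ := by
  have := isFacetForm_facetForm hf
  rw [IsFacetForm] at this
  rw [← LinearMap.mem_ker, this]
  rfl

theorem facetFormExt_eq_zero_iff {τ σ : Δ.Cone} (hf : IsFacet τ σ) {x : V} (hx : x ∈ lin σ) :
    facetFormExt hf x = 0 ↔ x ∈ lin τ :=
  (facetFormExt_apply hf ⟨x, hx⟩).symm ▸ facetForm_eq_zero_iff hf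

theorem facetFormExt_nonneg {τ σ : Δ.Cone} (hf : IsFacet τ σ) {x : V} (hx : x ∈ σ.1) :
    0 ≤ facetFormExt hf x :=
  (facetFormExt_apply hf ⟨x, Submodule.subset_span hx⟩).symm ▸
    (exists_inner_facetForm hf).choose_spec.2 x hx

theorem mem_of_facetFormExt_eq_zero {τ σ : Δ.Cone} (hf : IsFacet τ σ) {x : V} (hx : x ∈ σ.1)
    (h : facetFormExt hf x = 0) : x ∈ τ.1 :=
  mem_of_mem_of_mem_lin hf.1 hx ((facetFormExt_eq_zero_iff hf (Submodule.subset_span hx)).mp h)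

theorem facetFormExt_pos {τ σ : Δ.Cone} (hf : IsFacet τ σ) {x : V} (hx : x ∈ σ.1) (h : x ∉ τ.1) :
    0 < facetFormExt hf x :=
  (facetFormExt_nonneg hf hx).lt_of_ne' fun h0 => h (mem_of_facetFormExt_eq_zero hf hx h0)

theorem facetFormExt_pos_of_isRelInterior {τ σ : Δ.Cone} (hf : IsFacet τ σ) {x : V}
    (hx : IsRelInterior σ.1 x) : 0 < facetFormExt hf x :=
  facetFormExt_pos hf hx.1 fun h => (le_of_isRelInterior hx h).not_gt hf.lt

/-- The local cone of `σ` at a face `ρ` is cut out by the facets of `σ` that contain `ρ`. -/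
theorem mem_localCone_iff {σ ρ : Δ.Cone} (h : ρ ≤ σ) {x : V} (hx : x ∈ lin σ) :
    x ∈ localCone σ ρ ↔
      ∀ (τ : Δ.Cone) (hf : IsFacet τ σ), ρ ≤ τ → 0 ≤ facetFormExt hf x := by
  constructor
  · intro hxl τ hf hρτ
    obtain ⟨y, hy, hxy⟩ := mem_localCone.mp hxl
    have h1 := facetFormExt_nonneg hf hxy
    have h2 : facetFormExt hf y = 0 :=
      (facetFormExt_eq_zero_iff hf (Submodule.subset_span (h hy))).mpr
        (Submodule.subset_span (hρτ hy))
    rwa [map_add, h2, add_zero] at h1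
  · intro hpos
    obtain ⟨q, hq⟩ := exists_relInterior σ
    obtain ⟨C, rfl, hC⟩ := exists_mem_of_segment (Set.finite_singleton (localCone σ ρ))
      (by rintro C rfl; exact localCone_fg _ _) (x := q) (y := x)
      ⟨_, rfl, mem_localCone_of_mem hq.1⟩ (by
        rintro t ht0 ht1 C rfl hC
        obtain ⟨κ, h1, h2, y, hy, hxy⟩ := exists_carrier h hC
        have hκ : κ = σ := by
          by_contra hc
          obtain ⟨τ, hf, hκτ⟩ := exists_isFacet_ge (lt_of_le_of_ne h2 hc)
          have h3 := facetFormExt_pos_of_isRelInterior hf hq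
          have h4 := hpos τ hf (h1.trans hκτ)
          have h5 : q + t • (x - q) ∈ lin τ :=
            lin_mono hκτ (mem_lin_of_add_isRelInterior h1 hy hxy)
          rw [← facetFormExt_eq_zero_iff hf (lin_mono hf.1 h5), map_add, map_smul, map_sub,
            smul_eq_mul] at h5
          nlinarith [mul_nonneg ht0 h4, mul_pos (sub_pos.mpr ht1) h3]
        subst hκ
        exact ⟨_, rfl, hC, exists_add_smul_mem_localCone le_rfl hy hxy
          (mem_localCone_of_mem_lin le_rfl (sub_mem hx (Submodule.subset_span hq.1)))⟩)
    exact hC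

theorem IsFacet.eq_of_le {τ τ' σ : Δ.Cone} (hf : IsFacet τ σ) (hf' : IsFacet τ' σ) (h : τ ≤ τ') :
    τ = τ' := by
  apply eq_of_le_of_dim_le h
  have := hf.2
  have := hf'.2
  omega

/-- The local cone at a facet is a half-space. -/
theorem mem_localCone_facet_iff {τ σ : Δ.Cone} (hf : IsFacet τ σ) {x : V} (hx : x ∈ lin σ) :
    x ∈ localCone σ τ ↔ 0 ≤ facetFormExt hf x := by
  rw [mem_localCone_iff hf.1 hx]
  constructor
  · intro h
    exact h τ hf le_rfl
  · intro h τ' hf' hle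
    obtain rfl := hf.eq_of_le hf' hle
    exact h

end faces

/-! ### Incidence of facets and connectivity -/

section incidence

variable {V : Type u} [AddCommGroup V] [Module ℝ V] {Δ : Fan V}

theorem exists_mem_notMem_of_lt {ρ τ : Δ.Cone} (h : ρ < τ) : ∃ v ∈ τ.1, v ∉ lin ρ := by
  obtain ⟨v, hv, hv'⟩ := SetLike.not_le_iff_exists.mp (show ¬ τ.1 ≤ ρ.1 from not_le_of_gt h)
  exact ⟨v, hv, fun hc => hv' (mem_of_mem_of_mem_lin h.le hv hc)⟩

/-- The intersection of two cones of a fan. -/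
def inf (σ τ : Δ.Cone) : Δ.Cone := ⟨σ.1 ⊓ τ.1, Δ.face_mem _ σ.2 _ (Δ.inf_isFaceOf _ σ.2 _ τ.2)⟩

theorem inf_le_left' (σ τ : Δ.Cone) : inf σ τ ≤ σ := (inf_le_left : σ.1 ⊓ τ.1 ≤ σ.1)

theorem inf_le_right' (σ τ : Δ.Cone) : inf σ τ ≤ τ := (inf_le_right : σ.1 ⊓ τ.1 ≤ τ.1)

theorem le_inf' {ρ σ τ : Δ.Cone} (h : ρ ≤ σ) (h' : ρ ≤ τ) : ρ ≤ inf σ τ :=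
  (le_inf h h' : ρ.1 ≤ σ.1 ⊓ τ.1)

variable [FiniteDimensional ℝ V]

theorem IsFacet.exists_sub_smul_mem_lin {τ σ : Δ.Cone} (hf : IsFacet τ σ) {v : V}
    (hv : v ∈ lin σ) (hvτ : v ∉ lin τ) {x : V} (hx : x ∈ lin σ) : ∃ c : ℝ, x - c • v ∈ lin τ := by
  have h0 : facetFormExt hf v ≠ 0 := fun h => hvτ ((facetFormExt_eq_zero_iff hf hv).mp h)
  refine ⟨facetFormExt hf x / facetFormExt hf v, ?_⟩
  rw [← facetFormExt_eq_zero_iff hf (sub_mem hx (Submodule.smul_mem _ _ hv)), map_sub, map_smul,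
    smul_eq_mul, div_mul_cancel₀ _ h0, sub_self]

/-- A face of codimension two is contained in at least two facets. -/
theorem exists_isFacet_ne {ρ τ σ : Δ.Cone} (hτ : IsFacet τ σ) (hρ : IsFacet ρ τ) :
    ∃ τ' : Δ.Cone, IsFacet τ' σ ∧ IsFacet ρ τ' ∧ τ' ≠ τ := by
  by_contra hc
  obtain ⟨x, hx, hxρ⟩ := exists_mem_notMem_of_lt hρ.lt
  have hle : ρ ≤ σ := hρ.1.trans hτ.1
  have hxσ : x ∈ lin σ := Submodule.subset_span (hτ.1 hx)
  have h0 : ∀ (τ' : Δ.Cone) (hf : IsFacet τ' σ), ρ ≤ τ' → facetFormExt hf x = 0 := by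
    intro τ' hf hρτ'
    have h1 : IsFacet ρ τ' := by
      refine ⟨hρτ', ?_⟩
      have := hf.2
      have := hτ.2
      have := hρ.2
      omega
    obtain rfl : τ' = τ := by
      by_contra hne
      exact hc ⟨τ', hf, h1, hne⟩
    exact (facetFormExt_eq_zero_iff hf hxσ).mpr (Submodule.subset_span hx)
  refine hxρ (mem_lin_of_mem_localCone_of_neg_mem hle ?_ ?_)
  · rw [mem_localCone_iff hle hxσ]
    intro τ' hf h
    exact (h0 τ' hf h).ge
  · rw [mem_localCone_iff hle (neg_mem hxσ)]
    intro τ' hf h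
    rw [map_neg, h0 τ' hf h, neg_zero]

/-- A face of codimension two is contained in at most two facets. -/
theorem eq_or_eq_of_lt_of_lt {ρ τ₁ τ₂ σ κ : Δ.Cone} (h₁ : IsFacet τ₁ σ) (h₂ : IsFacet τ₂ σ)
    (hρ₁ : IsFacet ρ τ₁) (hρ₂ : IsFacet ρ τ₂) (hne : τ₁ ≠ τ₂) (hρκ : ρ < κ) (hκ : κ < σ) :
    κ = τ₁ ∨ κ = τ₂ := by
  by_contra! hc
  have hdρ := dim_lt_of_lt hρκ
  have hdσ := dim_lt_of_lt hκ
  have e1 := h₁.2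
  have e2 := hρ₁.2
  have e3 := h₂.2
  obtain ⟨v₁, hv₁, hv₁ρ⟩ := exists_mem_notMem_of_lt hρ₁.lt
  obtain ⟨v₂, hv₂, hv₂ρ⟩ := exists_mem_notMem_of_lt hρ₂.lt
  obtain ⟨v, hv, hvρ⟩ := exists_mem_notMem_of_lt hρκ
  -- two distinct cones of the intermediate dimension have no more than `ρ` in common
  have key : ∀ {α β : Δ.Cone}, ρ ≤ α → ρ ≤ β → dim α = dim ρ + 1 → dim β = dim ρ + 1 →
      ∀ x ∈ α.1, x ∈ β.1 → x ∉ lin ρ → α = β := by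
    intro α β hα hβ dα dβ x hx hx' hxρ
    have hlt : ρ < inf α β := by
      refine lt_of_le_of_ne (le_inf' hα hβ) ?_
      intro he
      apply hxρ
      rw [he]
      exact Submodule.subset_span (show x ∈ α.1 ⊓ β.1 from ⟨hx, hx'⟩)
    have hd := dim_lt_of_lt hlt
    exact (eq_of_le_of_dim_le (inf_le_left' α β) (by omega)).symm.trans
      (eq_of_le_of_dim_le (inf_le_right' α β) (by omega))
  have hv₂τ : v₂ ∉ τ₁.1 := fun h => hne (key hρ₁.1 hρ₂.1 (by omega) (by omega) v₂ h hv₂ hv₂ρ)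
  have hv₁τ : v₁ ∉ τ₂.1 := fun h => hne (key hρ₁.1 hρ₂.1 (by omega) (by omega) v₁ hv₁ h hv₁ρ)
  have hvτ₁ : v ∉ τ₁.1 := fun h => hc.1 (key hρκ.le hρ₁.1 (by omega) (by omega) v hv h hvρ)
  have hvτ₂ : v ∉ τ₂.1 := fun h => hc.2 (key hρκ.le hρ₂.1 (by omega) (by omega) v hv h hvρ)
  -- modulo `V_ρ`, the point `v` of `κ` is `a v₁ + b v₂` with positive coefficients, so that the face
  -- `κ` contains `v₁`
  obtain ⟨b, hb⟩ := h₁.exists_sub_smul_mem_lin (v := v₂) (Submodule.subset_span (h₂.1 hv₂))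
    (fun h => hv₂τ (mem_of_mem_of_mem_lin h₁.1 (h₂.1 hv₂) h))
    (x := v) (Submodule.subset_span (hκ.le hv))
  obtain ⟨a, ha⟩ := hρ₁.exists_sub_smul_mem_lin (v := v₁) (Submodule.subset_span hv₁) hv₁ρ hb
  obtain ⟨r, hr, r', hr', hrr⟩ := exists_sub_of_mem_lin ha
  have z1 : facetFormExt h₁ v = b * facetFormExt h₁ v₂ := by
    have := (facetFormExt_eq_zero_iff h₁ (lin_mono h₁.1 hb)).mpr hb
    rw [map_sub, map_smul, smul_eq_mul] at this
    linarith
  have z2 : facetFormExt h₂ v = a * facetFormExt h₂ v₁ := by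
    have h3 : v - b • v₂ - a • v₁ ∈ lin τ₂ := lin_mono hρ₂.1 ha
    have h4 := (facetFormExt_eq_zero_iff h₂ (lin_mono h₂.1 h3)).mpr h3
    have h5 := (facetFormExt_eq_zero_iff h₂ (lin_mono h₂.1 (Submodule.subset_span hv₂))).mpr
      (Submodule.subset_span hv₂)
    rw [map_sub, map_sub, map_smul, map_smul, smul_eq_mul, smul_eq_mul, h5] at h4
    linarith
  have hbpos : 0 < b := by
    have p1 := facetFormExt_pos h₁ (hκ.le hv) hvτ₁
    have p2 := facetFormExt_pos h₁ (h₂.1 hv₂) hv₂τ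
    rw [z1] at p1
    exact pos_of_mul_pos_left p1 p2.le
  have hapos : 0 < a := by
    have p1 := facetFormExt_pos h₂ (hκ.le hv) hvτ₂
    have p2 := facetFormExt_pos h₂ (h₁.1 hv₁) hv₁τ
    rw [z2] at p1
    exact pos_of_mul_pos_left p1 p2.le
  have hmem : a • v₁ + (b • v₂ + r) ∈ κ.1 := by
    have : a • v₁ + (b • v₂ + r) = v + r' := by
      have h6 : r = v - b • v₂ - a • v₁ + r' := by
        rw [hrr]
        abel
      rw [h6]
      abel
    rw [this]
    exact add_mem hv (hρκ.le hr')
  have hv₁κ : v₁ ∈ κ.1 := (isFaceOf_of_le hκ.le).mem_of_smul_add_mem (h₁.1 hv₁)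
    (add_mem (PointedCone.smul_mem _ hbpos.le (h₂.1 hv₂)) (h₁.1 (hρ₁.1 hr))) hapos hmem
  exact hc.1 (key hρκ.le hρ₁.1 (by omega) (by omega) v₁ hv₁κ hv₁ hv₁ρ)

/-- Two cones of full dimension with a common facet lie on different sides of it. -/
theorem facetFormExt_neg {τ σ σ' : Δ.Cone} (hf : IsFacet τ σ) (hf' : IsFacet τ σ')
    (hσ : dim σ = Module.finrank ℝ V) (hσ' : dim σ' = Module.finrank ℝ V) (hne : σ ≠ σ') {w : V}
    (hw : 0 < facetFormExt hf w) : facetFormExt hf' w < 0 := by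
  by_contra! hw'
  have h1 := (mem_localCone_facet_iff hf (mem_lin_of_dim_eq hσ w)).mpr hw.le
  have h2 := (mem_localCone_facet_iff hf' (mem_lin_of_dim_eq hσ' w)).mpr hw'
  obtain ⟨y, hy, hwy⟩ := mem_localCone.mp h1
  obtain ⟨z, hz, hwz⟩ := mem_localCone.mp h2
  have m1 : w + (y + z) ∈ σ.1 := by
    rw [← add_assoc]
    exact add_mem hwy (hf.1 hz)
  have m2 : w + (y + z) ∈ σ'.1 := by
    rw [add_comm y z, ← add_assoc]
    exact add_mem hwz (hf'.1 hy)
  have hle : τ ≤ inf σ σ' := le_inf' hf.1 hf'.1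
  have hneτ : inf σ σ' ≠ τ := by
    intro he
    have h3 : w + (y + z) ∈ lin τ := by
      rw [← he]
      exact Submodule.subset_span (show w + (y + z) ∈ σ.1 ⊓ σ'.1 from ⟨m1, m2⟩)
    have h4 : w ∈ lin τ := by
      simpa using sub_mem h3 (Submodule.subset_span (add_mem hy hz) : y + z ∈ lin τ)
    exact hw.ne' ((facetFormExt_eq_zero_iff hf (mem_lin_of_dim_eq hσ w)).mpr h4)
  have e1 : inf σ σ' = σ := by
    by_contra hc
    exact hneτ (hf.eq_of_le_of_lt hle (lt_of_le_of_ne (inf_le_left' _ _) hc))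
  have e2 : inf σ σ' = σ' := by
    by_contra hc
    exact hneτ (hf'.eq_of_le_of_lt hle (lt_of_le_of_ne (inf_le_right' _ _) hc))
  exact hne (e1.symm.trans e2)

theorem exists_facetFormExt_eq_neg_smul {τ σ σ' : Δ.Cone} (hf : IsFacet τ σ) (hf' : IsFacet τ σ')
    (hσ : dim σ = Module.finrank ℝ V) (hσ' : dim σ' = Module.finrank ℝ V) (hne : σ ≠ σ') :
    ∃ c : ℝ, 0 < c ∧ facetFormExt hf' = -c • facetFormExt hf := by
  obtain ⟨q, hq⟩ := exists_relInterior σ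
  have h1 := facetFormExt_pos_of_isRelInterior hf hq
  have h2 := facetFormExt_neg hf hf' hσ hσ' hne h1
  refine ⟨-(facetFormExt hf' q / facetFormExt hf q), neg_pos.mpr (div_neg_of_neg_of_pos h2 h1), ?_⟩
  ext x
  have hqτ : q ∉ lin τ := fun h =>
    h1.ne' ((facetFormExt_eq_zero_iff hf (mem_lin_of_dim_eq hσ q)).mpr h)
  obtain ⟨c, hc⟩ := hf.exists_sub_smul_mem_lin (mem_lin_of_dim_eq hσ q) hqτ
    (mem_lin_of_dim_eq hσ x)
  have e1 := (facetFormExt_eq_zero_iff hf (mem_lin_of_dim_eq hσ _)).mpr hc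
  have e2 := (facetFormExt_eq_zero_iff hf' (mem_lin_of_dim_eq hσ' _)).mpr hc
  rw [map_sub, map_smul, smul_eq_mul, sub_eq_zero] at e1 e2
  rw [LinearMap.smul_apply, smul_eq_mul, neg_neg, e1, e2]
  field_simp

/-- A cone of codimension one is contained in at most two cones of full dimension. -/
theorem eq_or_eq_of_isFacet {τ σ σ' κ : Δ.Cone} (hf : IsFacet τ σ) (hf' : IsFacet τ σ')
    (hκ : IsFacet τ κ) (hσ : dim σ = Module.finrank ℝ V) (hne : σ ≠ σ') : κ = σ ∨ κ = σ' := by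
  by_contra! hc
  have hσ' : dim σ' = Module.finrank ℝ V := by rw [← hf'.2, hf.2, hσ]
  have hdκ : dim κ = Module.finrank ℝ V := by rw [← hκ.2, hf.2, hσ]
  obtain ⟨q, hq⟩ := exists_relInterior σ
  have h1 := facetFormExt_pos_of_isRelInterior hf hq
  have h2 := facetFormExt_neg hf hf' hσ hσ' hne h1
  have h3 := facetFormExt_neg hf hκ hσ hdκ hc.1.symm h1
  have h4 := facetFormExt_neg hf' hκ hσ' hdκ hc.2.symm (w := -q) (by rw [map_neg]; linarith)
  rw [map_neg] at h4
  linarith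

/-- A cone of full dimension has interior points in general position. -/
theorem exists_relInterior_notMem {σ : Δ.Cone} (hσ : dim σ = Module.finrank ℝ V)
    {s : Set (Submodule ℝ V)} (hs : s.Finite) (hs' : ⊤ ∉ s) :
    ∃ y, IsRelInterior σ.1 y ∧ ∀ L ∈ s, y ∉ L := by
  lift s to Finset (Submodule ℝ V) using hs
  have hcov := Subspace.biUnion_ne_univ_of_top_notMem (s := s) (by simpa using hs')
  obtain ⟨v, hv⟩ := (Set.ne_univ_iff_exists_notMem _).mp hcov
  have hv : ∀ L ∈ s, v ∉ L := by simpa using hv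
  obtain ⟨p, hp⟩ := exists_relInterior σ
  obtain ⟨ε, hε, h⟩ := hp.2 v (mem_lin_of_dim_eq hσ v)
  have hbad : (⋃ L ∈ s, {δ : ℝ | p + δ • v ∈ L}).Finite := by
    refine s.finite_toSet.biUnion fun L hL => Set.Subsingleton.finite ?_
    intro a ha b hb
    by_contra hab
    have h1 : (a - b) • v ∈ L := by
      have : (a - b) • v = (p + a • v) - (p + b • v) := by
        rw [sub_smul]
        abel
      rw [this]
      exact sub_mem ha hb
    exact hv L hL ((L.smul_mem_iff (sub_ne_zero.mpr hab)).mp h1)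
  obtain ⟨δ, ⟨hδ0, hδε⟩, hδ⟩ := (Set.Ioo_infinite hε).exists_notMem_finite hbad
  refine ⟨p + δ • v, ?_, by simpa using hδ⟩
  have : p + δ • v = (1 - δ / ε) • p + (δ / ε) • (p + ε • v) := by
    match_scalars <;> (field_simp; try ring)
  rw [this]
  exact (hp.smul (sub_pos.mpr ((div_lt_one hε).mpr hδε))).add
    (PointedCone.smul_mem _ (by positivity) h)

/-- A non-empty set of full-dimensional cones containing `ρ` that is closed under crossing
facets containing `ρ` consists of all full-dimensional cones containing `ρ`: a segment in general
position between interior points meets no cones of codimension two. -/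
theorem mem_of_crossing_closed {ρ : Δ.Cone} {𝒞 : Set Δ.Cone}
    (h𝒞 : ∀ σ ∈ 𝒞, ρ ≤ σ ∧ dim σ = Module.finrank ℝ V)
    (hcross : ∀ σ ∈ 𝒞, ∀ τ, IsFacet τ σ → ρ ≤ τ → ∃ σ' ∈ 𝒞, σ' ≠ σ ∧ IsFacet τ σ')
    {σ₀ : Δ.Cone} (h₀ : σ₀ ∈ 𝒞) {σ₁ : Δ.Cone} (hd : dim σ₁ = Module.finrank ℝ V) (hρ₁ : ρ ≤ σ₁) :
    σ₁ ∈ 𝒞 := by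
  set n := Module.finrank ℝ V with hn
  -- `x` avoids the spans of all cones of codimension two, and `y` avoids their joins with `x`, so
  -- that the segment from `x` to `y` avoids these cones
  have hfin1 : (Set.range fun κ : {κ : Δ.Cone // dim κ + 2 ≤ n} => lin κ.1).Finite :=
    Set.finite_range _
  obtain ⟨x, hx, hxgen⟩ := exists_relInterior_notMem (h𝒞 _ h₀).2 hfin1 (by
    rintro ⟨κ, hκ⟩
    have h1 : dim κ.1 = n := by
      have : Module.finrank ℝ (lin κ.1) = n := by
        rw [show lin κ.1 = ⊤ from hκ]
        exact finrank_top ℝ V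
      exact this
    have := κ.2
    omega)
  have hfin2 : (Set.range fun κ : {κ : Δ.Cone // dim κ + 2 ≤ n} =>
      lin κ.1 ⊔ Submodule.span ℝ {x}).Finite := Set.finite_range _
  obtain ⟨y, hy, hygen⟩ := exists_relInterior_notMem hd hfin2 (by
    rintro ⟨κ, hκ⟩
    have h1 : Module.finrank ℝ ↥(lin κ.1 ⊔ Submodule.span ℝ {x}) = n := by
      rw [show lin κ.1 ⊔ Submodule.span ℝ {x} = ⊤ from hκ]
      exact finrank_top ℝ V
    have h2 := Submodule.finrank_add_le_finrank_add_finrank (lin κ.1) (Submodule.span ℝ {x})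
    have h3 := finrank_span_le_card (R := ℝ) ({x} : Set V)
    simp only [Set.toFinset_singleton, Finset.card_singleton] at h3
    have h4 : Module.finrank ℝ (lin κ.1) = dim κ.1 := rfl
    have := κ.2
    omega)
  have hxgen : ∀ κ : Δ.Cone, dim κ + 2 ≤ n → x ∉ lin κ := fun κ hκ => hxgen _ ⟨⟨κ, hκ⟩, rfl⟩
  have hygen : ∀ κ : Δ.Cone, dim κ + 2 ≤ n → y ∉ lin κ ⊔ Submodule.span ℝ {x} :=
    fun κ hκ => hygen _ ⟨⟨κ, hκ⟩, rfl⟩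
  obtain ⟨_, ⟨σ, hσ, rfl⟩, hyσ⟩ := exists_mem_of_segment
    (𝒞 := (fun σ => localCone σ ρ) '' 𝒞) (Set.toFinite _)
    (by rintro _ ⟨σ, -, rfl⟩; exact localCone_fg _ _) (x := x) (y := y)
    ⟨_, ⟨σ₀, h₀, rfl⟩, mem_localCone_of_mem hx.1⟩ (by
      rintro t ht0 ht1 _ ⟨σ, hσ, rfl⟩ hxt
      obtain ⟨hρσ, hdσ⟩ := h𝒞 σ hσ
      obtain ⟨κ, hρκ, hκσ, z, hz, hint⟩ := exists_carrier hρσ hxt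
      have hκ : n ≤ dim κ + 1 := by
        by_contra hlt
        have hlt : dim κ + 2 ≤ n := by omega
        have hm := mem_lin_of_add_isRelInterior hρκ hz hint
        rcases ht0.eq_or_lt with rfl | ht0
        · exact hxgen κ hlt (by simpa using hm)
        · refine hygen κ hlt ?_
          have : y = t⁻¹ • (x + t • (y - x)) + (1 - t⁻¹) • x := by
            match_scalars
            · field_simp
            · field_simp
              ring
          rw [this]
          exact add_mem (Submodule.mem_sup_left (Submodule.smul_mem _ _ hm))
            (Submodule.mem_sup_right (Submodule.smul_mem _ _ (Submodule.mem_span_singleton_self x)))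
      -- the segment is inside `σ` or crosses a facet `κ` of it, into `σ` or into the cone beyond
      rcases hκσ.eq_or_lt with rfl | hlt
      · exact ⟨_, ⟨κ, hσ, rfl⟩, hxt, exists_add_smul_mem_localCone le_rfl hz hint
          (mem_localCone_of_mem_lin le_rfl (mem_lin_of_dim_eq hdσ _))⟩
      · have hf : IsFacet κ σ := ⟨hκσ, by have := dim_lt_of_lt hlt; omega⟩
        obtain ⟨σ', hσ', hne, hf'⟩ := hcross σ hσ κ hf hρκ
        have hdσ' := (h𝒞 σ' hσ').2
        rcases le_or_gt 0 (facetFormExt hf (y - x)) with hpos | hneg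
        · exact ⟨_, ⟨σ, hσ, rfl⟩, hxt, exists_add_smul_mem_localCone hκσ hz hint
            ((mem_localCone_facet_iff hf (mem_lin_of_dim_eq hdσ _)).mpr hpos)⟩
        · obtain ⟨c, hc, he⟩ := exists_facetFormExt_eq_neg_smul hf hf' hdσ hdσ' hne.symm
          refine ⟨_, ⟨σ', hσ', rfl⟩, mem_localCone.mpr ⟨z, hz, hf'.1 hint.1⟩,
            exists_add_smul_mem_localCone hf'.1 hz hint
            ((mem_localCone_facet_iff hf' (mem_lin_of_dim_eq hdσ' _)).mpr ?_)⟩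
          rw [he, LinearMap.smul_apply, smul_eq_mul]
          nlinarith)
  obtain ⟨z, hz, hyz⟩ := mem_localCone.mp hyσ
  have hle : σ₁ ≤ σ := le_of_isRelInterior (hy.add (hρ₁ hz)) hyz
  rwa [eq_of_le_of_dim_le hle (by rw [hd, (h𝒞 σ hσ).2])]

/-- The boundary of a cone is connected away from a face `ρ` of codimension at least three: if the
facets containing `ρ` are divided into two non-empty classes, then some facets of different classes
meet in a cone larger than `ρ`. The segment between relative interior points of two facets is
projected to the boundary from an interior point in general position. -/
theorem exists_facets_meeting {ρ γ : Δ.Cone} (hργ : ρ ≤ γ) (hd : dim ρ + 3 ≤ dim γ)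
    (P : Δ.Cone → Prop) {τ₁ τ₂ : Δ.Cone} (h₁ : IsFacet τ₁ γ) (h₂ : IsFacet τ₂ γ)
    (hρ₁ : ρ ≤ τ₁) (hρ₂ : ρ ≤ τ₂) (hP₁ : P τ₁) (hP₂ : ¬ P τ₂) :
    ∃ τ τ' κ : Δ.Cone, IsFacet τ γ ∧ IsFacet τ' γ ∧ P τ ∧ ¬ P τ' ∧ ρ < κ ∧ κ ≤ τ ∧ κ ≤ τ' := by
  have hne : τ₁ ≠ τ₂ := by
    rintro rfl
    exact hP₂ hP₁
  obtain ⟨x, hx⟩ := exists_relInterior τ₁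
  obtain ⟨y, hy⟩ := exists_relInterior τ₂
  set L := lin ρ ⊔ (Submodule.span ℝ {x} ⊔ Submodule.span ℝ {y}) with hL
  obtain ⟨z, hzγ, hzL, hzpos⟩ : ∃ z ∈ γ.1, z ∉ L ∧
      ∀ (τ : Δ.Cone) (hf : IsFacet τ γ), 0 < facetFormExt hf z := by
    obtain ⟨p, hp⟩ := exists_relInterior γ
    by_cases hpL : p ∈ L
    · obtain ⟨v, hv, hvL⟩ : ∃ v ∈ γ.1, v ∉ L := by
        by_contra! hc
        have h3 : lin γ ≤ L := Submodule.span_le.mpr hc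
        have h4 : dim γ ≤ Module.finrank ℝ L := Submodule.finrank_mono h3
        have h5 := Submodule.finrank_add_le_finrank_add_finrank (lin ρ)
          (Submodule.span ℝ {x} ⊔ Submodule.span ℝ {y})
        have h6 := Submodule.finrank_add_le_finrank_add_finrank (Submodule.span ℝ {x})
          (Submodule.span ℝ {y})
        have h7 := finrank_span_le_card (R := ℝ) ({x} : Set V)
        have h8 := finrank_span_le_card (R := ℝ) ({y} : Set V)
        simp only [Set.toFinset_singleton, Finset.card_singleton] at h7 h8
        have h9 : Module.finrank ℝ (lin ρ) = dim ρ := rfl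
        rw [← hL] at h5
        omega
      have := hp.add hv
      exact ⟨p + v, this.1, fun h => hvL (by simpa using sub_mem h hpL),
        fun τ hf => facetFormExt_pos_of_isRelInterior hf this⟩
    · exact ⟨p, hp.1, hpL, fun τ hf => facetFormExt_pos_of_isRelInterior hf hp⟩
  let 𝓕 := {τ : Δ.Cone // IsFacet τ γ ∧ ρ ≤ τ}
  -- the parameter at which the line through `x + t (y - x)` in the direction `-z` leaves the
  -- half-space of `τ`
  let g : 𝓕 → ℝ → ℝ := fun τ t => facetFormExt τ.2.1 (x + t • (y - x)) / facetFormExt τ.2.1 z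
  have hg : ∀ τ, Continuous (g τ) := by
    intro τ
    simp only [g, map_add, map_smul, smul_eq_mul]
    fun_prop
  have hg0 : ∀ τ t, 0 ≤ t → t ≤ 1 → 0 ≤ g τ t := by
    intro τ t h0 h1
    refine div_nonneg ?_ (hzpos _ τ.2.1).le
    have e1 := facetFormExt_nonneg τ.2.1 (h₁.1 hx.1)
    have e2 := facetFormExt_nonneg τ.2.1 (h₂.1 hy.1)
    rw [map_add, map_smul, map_sub, smul_eq_mul]
    nlinarith [mul_nonneg h0 e2, mul_nonneg (sub_nonneg.mpr h1) e1]
  -- the parameters `t` for which the line meets one of the facets in the given class first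
  let S : Set 𝓕 → Set ℝ := fun 𝒞 => ⋃ τ ∈ 𝒞, {t | ∀ τ', g τ t ≤ g τ' t}
  have hScl : ∀ 𝒞, IsClosed (S 𝒞) := by
    intro 𝒞
    refine (Set.toFinite 𝒞).isClosed_biUnion fun τ _ => ?_
    rw [Set.ofPred_forall]
    exact isClosed_iInter fun τ' => isClosed_le (hg τ) (hg τ')
  have hmem : ∀ 𝒞 t, t ∈ S 𝒞 ↔ ∃ τ ∈ 𝒞, ∀ τ', g τ t ≤ g τ' t := by
    intro 𝒞 t
    simp [S]
  let T₁ : 𝓕 := ⟨τ₁, h₁, hρ₁⟩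
  let T₂ : 𝓕 := ⟨τ₂, h₂, hρ₂⟩
  have hx0 : facetFormExt h₁ x = 0 :=
    (facetFormExt_eq_zero_iff h₁ (lin_mono h₁.1 (Submodule.subset_span hx.1))).mpr
      (Submodule.subset_span hx.1)
  have hy0 : facetFormExt h₂ y = 0 :=
    (facetFormExt_eq_zero_iff h₂ (lin_mono h₂.1 (Submodule.subset_span hy.1))).mpr
      (Submodule.subset_span hy.1)
  have hx2 : 0 < facetFormExt h₂ x := facetFormExt_pos h₂ (h₁.1 hx.1) fun h =>
    hne (h₁.eq_of_le h₂ (le_of_isRelInterior hx h))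
  have hy1 : 0 < facetFormExt h₁ y := facetFormExt_pos h₁ (h₂.1 hy.1) fun h =>
    hne (h₂.eq_of_le h₁ (le_of_isRelInterior hy h)).symm
  obtain ⟨t, ⟨ht0, ht1⟩, htS, htS'⟩ :=
    isPreconnected_closed_iff.mp (isPreconnected_Icc (a := (0 : ℝ)) (b := 1))
      (S {τ | P τ.1}) (S {τ | ¬ P τ.1}) (hScl _) (hScl _) (by
        intro t ht
        obtain ⟨τ, hτ⟩ := @Finite.exists_min 𝓕 ℝ _ ⟨T₁⟩ _ (fun τ => g τ t)
        by_cases hPτ : P τ.1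
        · exact Or.inl ((hmem _ _).mpr ⟨τ, hPτ, hτ⟩)
        · exact Or.inr ((hmem _ _).mpr ⟨τ, hPτ, hτ⟩))
      ⟨0, ⟨le_rfl, zero_le_one⟩, (hmem _ _).mpr ⟨T₁, hP₁, fun τ' => by
        refine le_trans (le_of_eq ?_) (hg0 τ' 0 le_rfl zero_le_one)
        simp [g, T₁, hx0]⟩⟩
      ⟨1, ⟨zero_le_one, le_rfl⟩, (hmem _ _).mpr ⟨T₂, hP₂, fun τ' => by
        refine le_trans (le_of_eq ?_) (hg0 τ' 1 zero_le_one le_rfl)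
        simp [g, T₂, hy0]⟩⟩
  obtain ⟨τ, hPτ, hτ⟩ := (hmem _ _).mp htS
  obtain ⟨τ', hPτ', hτ'⟩ := (hmem _ _).mp htS'
  set s := g τ t with hs
  have hs' : g τ' t = s := le_antisymm (hτ' τ) (hτ τ')
  -- `w` is the point on the boundary where a facet of each class is met
  set w := x + t • (y - x) - s • z with hw
  have hwγ : w ∈ lin γ := by
    have e1 : x ∈ lin γ := Submodule.subset_span (h₁.1 hx.1)
    have e2 : y ∈ lin γ := Submodule.subset_span (h₂.1 hy.1)
    have e3 : z ∈ lin γ := Submodule.subset_span hzγ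
    exact sub_mem (add_mem e1 (Submodule.smul_mem _ _ (sub_mem e2 e1))) (Submodule.smul_mem _ _ e3)
  have hval : ∀ (τ : Δ.Cone) (h : IsFacet τ γ ∧ ρ ≤ τ),
      facetFormExt h.1 w = (g ⟨τ, h⟩ t - s) * facetFormExt h.1 z := by
    intro τ h
    rw [sub_mul, hw, map_sub, map_smul, smul_eq_mul]
    congr 1
    exact (div_mul_cancel₀ _ (hzpos _ h.1).ne').symm
  have hwl : w ∈ localCone γ ρ := by
    rw [mem_localCone_iff hργ hwγ]
    intro τ' hf hle
    rw [hval τ' ⟨hf, hle⟩]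
    exact mul_nonneg (sub_nonneg.mpr (hτ _)) (hzpos _ _).le
  obtain ⟨κ, hρκ, hκγ, v, hv, hint⟩ := exists_carrier hργ hwl
  have hface : ∀ (τ : Δ.Cone) (h : IsFacet τ γ ∧ ρ ≤ τ), g ⟨τ, h⟩ t = s → κ ≤ τ := by
    intro τ h he
    refine le_of_isRelInterior hint (mem_of_facetFormExt_eq_zero h.1 (hκγ hint.1) ?_)
    have e1 : facetFormExt h.1 v = 0 :=
      (facetFormExt_eq_zero_iff h.1 (Submodule.subset_span (hργ hv))).mpr
        (Submodule.subset_span (h.2 hv))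
    rw [map_add, e1, add_zero, hval τ h, he, sub_self, zero_mul]
  refine ⟨τ.1, τ'.1, κ, τ.2.1, τ'.2.1, hPτ, hPτ', lt_of_le_of_ne hρκ ?_, hface _ τ.2 rfl,
    hface _ τ'.2 hs'⟩
  -- if that point were in `V_ρ`, general position would give `s = 0`, so that the open segment
  -- between the two facets would meet `V_ρ`
  rintro rfl
  have hwρ : w ∈ lin ρ := mem_lin_of_add_isRelInterior le_rfl hv hint
  have hxt : x + t • (y - x) ∈ Submodule.span ℝ {x} ⊔ Submodule.span ℝ {y} := by
    have e1 : x + t • (y - x) = (1 - t) • x + t • y := by module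
    rw [e1]
    exact add_mem (Submodule.mem_sup_left (Submodule.smul_mem _ _ (Submodule.mem_span_singleton_self _)))
      (Submodule.mem_sup_right (Submodule.smul_mem _ _ (Submodule.mem_span_singleton_self _)))
  have hs0 : s = 0 := by
    by_contra hs0
    refine hzL ((L.smul_mem_iff hs0).mp ?_)
    have e1 : s • z = (x + t • (y - x)) - w := by
      rw [hw]
      abel
    rw [e1]
    exact sub_mem (Submodule.mem_sup_right hxt) (Submodule.mem_sup_left hwρ)
  have hwx : w = x + t • (y - x) := by rw [hw, hs0, zero_smul, sub_zero]
  have z1 := (facetFormExt_eq_zero_iff h₁ hwγ).mpr (lin_mono hρ₁ hwρ)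
  have z2 := (facetFormExt_eq_zero_iff h₂ hwγ).mpr (lin_mono hρ₂ hwρ)
  rw [hwx, map_add, map_smul, map_sub, smul_eq_mul, hx0] at z1
  rw [hwx, map_add, map_smul, map_sub, smul_eq_mul, hy0] at z2
  nlinarith

end incidence

end Fan

/-! ### Determinants and the sign rule -/

section det

variable {W : Type u} [AddCommGroup W] [Module ℝ W] [FiniteDimensional ℝ W]

theorem DetDual.exists_eq_smul {ω : DetDual W} (hω : ω ≠ 0) (η : DetDual W) :
    ∃ c : ℝ, η = c • ω := by
  let b := Module.finBasis ℝ W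
  have h1 := ω.eq_smul_basis_det b
  have h2 := η.eq_smul_basis_det b
  have h0 : ω b ≠ 0 := by
    intro h
    rw [h, zero_smul] at h1
    exact hω h1
  refine ⟨η b / ω b, ?_⟩
  rw [h1, smul_smul]
  conv_lhs => rw [h2]
  congr 1
  rw [← h1]
  field_simp

theorem DetDual.exists_ne_zero (W : Type u) [AddCommGroup W] [Module ℝ W]
    [FiniteDimensional ℝ W] : ∃ ω : DetDual W, ω ≠ 0 := by
  let b := Module.finBasis ℝ W
  refine ⟨b.det, fun h => ?_⟩
  have := b.det_self
  rw [h] at this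
  simp at this

theorem cons_comp_finCongr {α : Type*} {m k : ℕ} (h : m = k) (a : α) (f : Fin k → α) :
    (Fin.cons a (f ∘ finCongr h) : Fin (m + 1) → α) =
      (Fin.cons a f : Fin (k + 1) → α) ∘ finCongr (congrArg (· + 1) h) := by
  subst h
  rfl

theorem cons_cons_comp_swap {α : Type*} {k : ℕ} (a b : α) (f : Fin k → α) :
    (Fin.cons a (Fin.cons b f) : Fin (k + 1 + 1) → α) ∘ Equiv.swap 0 1 =
      Fin.cons b (Fin.cons a f) := by
  funext i
  refine Fin.cases ?_ (fun i => Fin.cases ?_ (fun i => ?_) i) i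
  · simp
  · simp
  · have h0 : (i.succ.succ : Fin (k + 1 + 1)) ≠ 0 := Fin.succ_ne_zero _
    have h1 : (i.succ.succ : Fin (k + 1 + 1)) ≠ 1 := by
      rw [← Fin.succ_zero_eq_one, Ne, Fin.succ_inj]
      exact Fin.succ_ne_zero _
    rw [Function.comp_apply, Equiv.swap_apply_of_ne_of_ne h0 h1]
    simp

end det

namespace Fan

section sign

variable {V : Type u} [AddCommGroup V] [Module ℝ V] {Δ : Fan V} [FiniteDimensional ℝ V]

/-- The defining property of `ψ_h`: inserting an arbitrary vector `x` into the first slot amounts to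
multiplying `ψ_h` by `h x`. -/
theorem psi_spec {τ σ : Δ.Cone} {hf : IsFacet τ σ} {h : Module.Dual ℝ (lin σ)}
    (hh : IsFacetForm h hf) (ω : DetDual (lin σ)) (x : lin σ) (v : Fin (dim τ) → lin τ) :
    ω.domDomCongr (finCongr hf.2.symm) (Fin.cons x (linIncl hf.1 ∘ v)) = h x * psi hh ω v := by
  set Ω := ω.domDomCongr (finCongr hf.2.symm) with hΩ
  set e := hh.exists_eq_one.choose with he
  have he1 : h e = 1 := hh.exists_eq_one.choose_spec
  have hpsi : psi hh ω v = Ω.curryLeft e (linIncl hf.1 ∘ v) := rfl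
  have hx : Ω (Fin.cons x (linIncl hf.1 ∘ v)) = Ω.curryLeft x (linIncl hf.1 ∘ v) := rfl
  have hmem : x - h x • e ∈ LinearMap.ker h := by
    rw [LinearMap.mem_ker, map_sub, map_smul, he1, smul_eq_mul, mul_one, sub_self]
  rw [hh] at hmem
  obtain ⟨t, ht⟩ : ∃ t : lin τ, linIncl hf.1 t = x - h x • e := ⟨⟨_, hmem⟩, rfl⟩
  have hzero : Ω.curryLeft (linIncl hf.1 t) (linIncl hf.1 ∘ v) = 0 := by
    change Ω (Fin.cons (linIncl hf.1 t) (linIncl hf.1 ∘ v)) = 0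
    apply AlternatingMap.map_linearDependent
    intro hli
    have h1 : (Fin.cons (linIncl hf.1 t) (linIncl hf.1 ∘ v) : Fin (dim τ + 1) → lin σ) =
        linIncl hf.1 ∘ (Fin.cons t v : Fin (dim τ + 1) → lin τ) :=
      (Fin.comp_cons _ _ _).symm
    rw [h1] at hli
    have h2 := (LinearIndependent.of_comp _ hli).fintype_card_le_finrank
    rw [Fintype.card_fin] at h2
    have h3 : Module.finrank ℝ (lin τ) = dim τ := rfl
    omega
  rw [ht, map_sub, map_smul, AlternatingMap.sub_apply, AlternatingMap.smul_apply, sub_eq_zero]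
    at hzero
  rw [hx, hzero, hpsi, smul_eq_mul]

theorem psi_ne_zero {τ σ : Δ.Cone} {hf : IsFacet τ σ} {h : Module.Dual ℝ (lin σ)}
    (hh : IsFacetForm h hf) {ω : DetDual (lin σ)} (hω : ω ≠ 0) : psi hh ω ≠ 0 := by
  intro h0
  obtain ⟨e, he⟩ := hh.exists_eq_one
  let b : Module.Basis (Fin (dim τ)) ℝ (lin τ) := Module.finBasis ℝ (lin τ)
  have hli : LinearIndependent ℝ (Fin.cons e (linIncl hf.1 ∘ b) : Fin (dim τ + 1) → lin σ) := by
    rw [linearIndependent_finCons]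
    refine ⟨b.linearIndependent.map' _ (LinearMap.ker_eq_bot.mpr (Submodule.inclusion_injective _)),
      fun hc => ?_⟩
    have h1 : Submodule.span ℝ (Set.range (linIncl hf.1 ∘ b)) ≤ LinearMap.ker h := by
      rw [Submodule.span_le]
      rintro _ ⟨i, rfl⟩
      change h (linIncl hf.1 (b i)) = 0
      exact DFunLike.congr_fun hh.dualMap_eq_zero (b i)
    have h2 : h e = 0 := h1 hc
    rw [he] at h2
    exact one_ne_zero h2
  let B := basisOfLinearIndependentOfCardEqFinrank hli (by
    rw [Fintype.card_fin]
    exact hf.2)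
  have h3 : ω.domDomCongr (finCongr hf.2.symm) = 0 := by
    rw [(ω.domDomCongr (finCongr hf.2.symm)).eq_smul_basis_det B]
    have h4 : (B : Fin (dim τ + 1) → lin σ) = Fin.cons e (linIncl hf.1 ∘ b) :=
      coe_basisOfLinearIndependentOfCardEqFinrank _ _
    have h5 : psi hh ω (b : Fin (dim τ) → lin τ) = 0 :=
      DFunLike.congr_fun h0 (b : Fin (dim τ) → lin τ)
    rw [h4, psi_spec hh, h5, mul_zero, zero_smul]
  exact hω ((AlternatingMap.domDomCongr_eq_zero_iff _ _).mp h3)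

/-- The scalar `c` with `ψ_h(o_σ) = c • o_τ`, for the inner facet form `h`; its sign is the
transition coefficient. -/
theorem Orientation.exists_psi_eq_smul (o : Δ.Orientation) {τ σ : Δ.Cone} (hf : IsFacet τ σ) :
    ∃ c : ℝ, c ≠ 0 ∧ psi (isFacetForm_facetForm hf) (o.form σ) = c • o.form τ ∧
      o.sign hf * |c| = c := by
  obtain ⟨c, hc⟩ := DetDual.exists_eq_smul (o.form_ne_zero τ)
    (psi (isFacetForm_facetForm hf) (o.form σ))
  have hc0 : c ≠ 0 := by
    rintro rfl
    rw [zero_smul] at hc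
    exact psi_ne_zero _ (o.form_ne_zero σ) hc
  refine ⟨c, hc0, hc, ?_⟩
  rw [Orientation.sign]
  split_ifs with h
  · obtain ⟨d, hd, h⟩ := h
    have : c = d := by
      rw [hc] at h
      exact smul_left_injective ℝ (o.form_ne_zero τ) h
    rw [this, abs_of_pos hd, one_mul]
  · have : c < 0 := by
      rcases lt_trichotomy c 0 with h1 | h1 | h1
      · exact h1
      · exact absurd h1 hc0
      · exact absurd ⟨c, h1, hc⟩ h
    rw [abs_of_neg this]
    ring

theorem Orientation.sign_eq_one_or (o : Δ.Orientation) {τ σ : Δ.Cone} (hf : IsFacet τ σ) :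
    o.sign hf = 1 ∨ o.sign hf = -1 := by
  rw [Orientation.sign]
  split_ifs
  · exact Or.inl rfl
  · exact Or.inr rfl

/-- Two successive insertions: `ω(x, y, v) = h(x) k(y) ψ_k(ψ_h(ω))(v)` for `y` in `V_τ`. -/
theorem psi_psi {ρ τ σ : Δ.Cone} {hf : IsFacet τ σ} {h : Module.Dual ℝ (lin σ)}
    (hh : IsFacetForm h hf) {hρ : IsFacet ρ τ} {k : Module.Dual ℝ (lin τ)}
    (hk : IsFacetForm k hρ) (ω : DetDual (lin σ)) (x : lin σ) (y : lin τ)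
    (v : Fin (dim ρ) → lin ρ) (hd : dim σ = dim ρ + 1 + 1) :
    ω.domDomCongr (finCongr hd) (Fin.cons x (Fin.cons (linIncl hf.1 y)
      (linIncl (hρ.1.trans hf.1) ∘ v))) = h x * (k y * psi hk (psi hh ω) v) := by
  rw [← psi_spec hk (psi hh ω) y v]
  have h1 := psi_spec hh ω x
    ((Fin.cons y (linIncl hρ.1 ∘ v) : Fin (dim ρ + 1) → lin τ) ∘ finCongr hρ.2.symm)
  rw [← Function.comp_assoc, cons_comp_finCongr, Fin.comp_cons] at h1
  exact h1

/-- Points of two facets `τ₁`, `τ₂` of `σ` with the common facet `ρ` at which the inner facet forms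
of the other facet of `σ`, and of `ρ`, are positive. -/
structure DiamondData {ρ τ₁ τ₂ σ : Δ.Cone} (h₁ : IsFacet τ₁ σ) (h₂ : IsFacet τ₂ σ)
    (hρ₁ : IsFacet ρ τ₁) (hρ₂ : IsFacet ρ τ₂) where
  /-- a point of `τ₁` outside `ρ` -/
  v₁ : lin τ₁
  /-- a point of `τ₂` outside `ρ` -/
  v₂ : lin τ₂
  pos₁ : 0 < facetForm h₂ (linIncl h₁.1 v₁)
  pos₂ : 0 < facetForm h₁ (linIncl h₂.1 v₂)
  pos₁' : 0 < facetForm hρ₁ v₁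
  pos₂' : 0 < facetForm hρ₂ v₂

theorem facetForm_pos {τ σ : Δ.Cone} (hf : IsFacet τ σ) {x : lin σ} (hx : x.1 ∈ σ.1)
    (h : x.1 ∉ τ.1) : 0 < facetForm hf x := by
  rw [← facetFormExt_apply]
  exact facetFormExt_pos hf hx h

theorem notMem_of_isFacet_of_ne {ρ τ₁ τ₂ σ : Δ.Cone} (h₁ : IsFacet τ₁ σ) (h₂ : IsFacet τ₂ σ)
    (hρ₁ : IsFacet ρ τ₁) (hρ₂ : IsFacet ρ τ₂) (hne : τ₁ ≠ τ₂) {v : V} (hv : v ∈ τ₁.1)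
    (hvρ : v ∉ ρ.1) : v ∉ τ₂.1 := by
  intro hc
  have hlt : inf τ₁ τ₂ < τ₁ :=
    lt_of_le_of_ne (inf_le_left' _ _) fun he => hne (h₁.eq_of_le h₂ (he ▸ inf_le_right' _ _))
  have := hρ₁.eq_of_le_of_lt (le_inf' hρ₁.1 hρ₂.1) hlt
  apply hvρ
  rw [← this]
  exact ⟨hv, hc⟩

theorem exists_diamondData {ρ τ₁ τ₂ σ : Δ.Cone} (h₁ : IsFacet τ₁ σ) (h₂ : IsFacet τ₂ σ)
    (hρ₁ : IsFacet ρ τ₁) (hρ₂ : IsFacet ρ τ₂) (hne : τ₁ ≠ τ₂) :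
    Nonempty (DiamondData h₁ h₂ hρ₁ hρ₂) := by
  obtain ⟨v₁, hv₁, hv₁ρ⟩ := exists_mem_notMem_of_lt hρ₁.lt
  obtain ⟨v₂, hv₂, hv₂ρ⟩ := exists_mem_notMem_of_lt hρ₂.lt
  have hv₁ρ : v₁ ∉ ρ.1 := fun h => hv₁ρ (Submodule.subset_span h)
  have hv₂ρ : v₂ ∉ ρ.1 := fun h => hv₂ρ (Submodule.subset_span h)
  exact ⟨⟨⟨v₁, Submodule.subset_span hv₁⟩, ⟨v₂, Submodule.subset_span hv₂⟩,
    facetForm_pos _ (h₁.1 hv₁) (notMem_of_isFacet_of_ne h₁ h₂ hρ₁ hρ₂ hne hv₁ hv₁ρ),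
    facetForm_pos _ (h₂.1 hv₂) (notMem_of_isFacet_of_ne h₂ h₁ hρ₂ hρ₁ hne.symm hv₂ hv₂ρ),
    facetForm_pos _ hv₁ hv₁ρ, facetForm_pos _ hv₂ hv₂ρ⟩⟩

/-- Passing from `σ` to `ρ` through the two intermediate facets gives, up to positive factors,
opposite maps of determinants. -/
theorem DiamondData.psi_psi_eq {ρ τ₁ τ₂ σ : Δ.Cone} {h₁ : IsFacet τ₁ σ} {h₂ : IsFacet τ₂ σ}
    {hρ₁ : IsFacet ρ τ₁} {hρ₂ : IsFacet ρ τ₂} (D : DiamondData h₁ h₂ hρ₁ hρ₂)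
    (ω : DetDual (lin σ)) :
    (facetForm h₁ (linIncl h₂.1 D.v₂) * facetForm hρ₁ D.v₁) •
        psi (isFacetForm_facetForm hρ₁) (psi (isFacetForm_facetForm h₁) ω) =
      -((facetForm h₂ (linIncl h₁.1 D.v₁) * facetForm hρ₂ D.v₂) •
        psi (isFacetForm_facetForm hρ₂) (psi (isFacetForm_facetForm h₂) ω)) := by
  have hd : dim σ = dim ρ + 1 + 1 := by rw [hρ₁.2, h₁.2]
  refine AlternatingMap.ext fun (v : Fin (dim ρ) → lin ρ) => ?_
  have e1 := psi_psi (isFacetForm_facetForm h₁) (isFacetForm_facetForm hρ₁) ω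
    (linIncl h₂.1 D.v₂) D.v₁ v hd
  have e2 := psi_psi (isFacetForm_facetForm h₂) (isFacetForm_facetForm hρ₂) ω
    (linIncl h₁.1 D.v₁) D.v₂ v hd
  refine (mul_assoc _ _ _).trans
    (e1.symm.trans (Eq.trans ?_ (congrArg Neg.neg (e2.trans (mul_assoc _ _ _).symm))))
  rw [← AlternatingMap.map_swap _ _ (show (0 : Fin (dim ρ + 1 + 1)) ≠ 1 from Fin.zero_ne_one),
    cons_cons_comp_swap]

/-- The transition coefficients along the two chains between cones `ρ ≤ σ` of codimension two are
opposite. -/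
theorem Orientation.sign_mul_sign (o : Δ.Orientation) {ρ τ₁ τ₂ σ : Δ.Cone} (h₁ : IsFacet τ₁ σ)
    (h₂ : IsFacet τ₂ σ) (hρ₁ : IsFacet ρ τ₁) (hρ₂ : IsFacet ρ τ₂) (hne : τ₁ ≠ τ₂) :
    o.sign h₁ * o.sign hρ₁ = -(o.sign h₂ * o.sign hρ₂) := by
  obtain ⟨D⟩ := exists_diamondData h₁ h₂ hρ₁ hρ₂ hne
  obtain ⟨c₁, c₁0, e₁, s₁⟩ := o.exists_psi_eq_smul h₁
  obtain ⟨c₂, c₂0, e₂, s₂⟩ := o.exists_psi_eq_smul h₂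
  obtain ⟨d₁, d₁0, f₁, t₁⟩ := o.exists_psi_eq_smul hρ₁
  obtain ⟨d₂, d₂0, f₂, t₂⟩ := o.exists_psi_eq_smul hρ₂
  have key := D.psi_psi_eq (o.form σ)
  rw [e₁, e₂, map_smul, map_smul, f₁, f₂, smul_smul, smul_smul, smul_smul, smul_smul, ← neg_smul]
    at key
  have key := smul_left_injective ℝ (o.form_ne_zero ρ) key
  have p₁ := mul_pos D.pos₂ D.pos₁'
  have p₂ := mul_pos D.pos₁ D.pos₂'
  set A := facetForm h₁ (linIncl h₂.1 D.v₂) * facetForm hρ₁ D.v₁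
  set B := facetForm h₂ (linIncl h₁.1 D.v₁) * facetForm hρ₂ D.v₂
  have q₁ : 0 < A * (|c₁| * |d₁|) := by positivity
  have q₂ : 0 < B * (|c₂| * |d₂|) := by positivity
  have key : o.sign h₁ * o.sign hρ₁ * (A * (|c₁| * |d₁|)) =
      -(o.sign h₂ * o.sign hρ₂ * (B * (|c₂| * |d₂|))) := by
    linear_combination key + A * c₁ * t₁ + A * (o.sign hρ₁ * |d₁|) * s₁ +
      B * c₂ * t₂ + B * (o.sign hρ₂ * |d₂|) * s₂
  have hu : ∀ {a b : ℝ}, a = 1 ∨ a = -1 → b = 1 ∨ b = -1 → a * b = 1 ∨ a * b = -1 := by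
    rintro a b (rfl | rfl) (rfl | rfl) <;> norm_num
  rcases hu (o.sign_eq_one_or h₁) (o.sign_eq_one_or hρ₁) with r₁ | r₁ <;>
    rcases hu (o.sign_eq_one_or h₂) (o.sign_eq_one_or hρ₂) with r₂ | r₂ <;>
    rw [r₁, r₂] at key ⊢ <;> linarith

end sign

/-! ### Local connectivity of quasi-convex fans -/

section connectivity

variable {V : Type u} [AddCommGroup V] [Module ℝ V] {Δ : Fan V} [FiniteDimensional ℝ V]

/-- For a volume form on `V`, the number `h(x) ψ_h(ω)(v)` is `ω(x, v)`, hence does not depend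
on the full-dimensional cone that contains the facet `τ`. -/
theorem facetFormExt_smul_psi_detRes {τ σ σ' : Δ.Cone} (hf : IsFacet τ σ) (hf' : IsFacet τ σ')
    (hσ : dim σ = Module.finrank ℝ V) (hσ' : dim σ' = Module.finrank ℝ V) (ω : DetDual V) (x : V) :
    facetFormExt hf x • psi (isFacetForm_facetForm hf) (detRes σ hσ ω) =
      facetFormExt hf' x • psi (isFacetForm_facetForm hf') (detRes σ' hσ' ω) := by
  refine AlternatingMap.ext fun (v : Fin (dim τ) → lin τ) => ?_
  have hn : Module.finrank ℝ V = dim τ + 1 := by rw [← hσ, hf.2]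
  have key : ∀ {σ : Δ.Cone} (hf : IsFacet τ σ) (hσ : dim σ = Module.finrank ℝ V),
      facetFormExt hf x * psi (isFacetForm_facetForm hf) (detRes σ hσ ω) v =
        ω.domDomCongr (finCongr hn) (Fin.cons x ((lin τ).subtype ∘ v)) := by
    intro σ hf hσ
    have h1 := psi_spec (isFacetForm_facetForm hf) (detRes σ hσ ω)
      ⟨x, mem_lin_of_dim_eq hσ x⟩ v
    rw [← facetFormExt_apply] at h1
    refine h1.symm.trans ?_
    change ω _ = ω _
    congr 1
    have h2 : (Fin.cons x ((lin τ).subtype ∘ v) : Fin (dim τ + 1) → V) = (lin σ).subtype ∘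
        (Fin.cons ⟨x, mem_lin_of_dim_eq hσ x⟩ (linIncl hf.1 ∘ v) : Fin (dim τ + 1) → lin σ) := by
      rw [Fin.comp_cons]
      rfl
    rw [h2]
    rfl
  exact (key hf hσ).trans (key hf' hσ').symm

/-- Two full-dimensional cones with a common facet have opposite transition coefficients. -/
theorem Orientation.sign_eq_neg (o : Δ.Orientation) {τ σ σ' : Δ.Cone} (hf : IsFacet τ σ)
    (hf' : IsFacet τ σ') (hσ : dim σ = Module.finrank ℝ V) (hσ' : dim σ' = Module.finrank ℝ V)
    (hne : σ ≠ σ') : o.sign hf = -o.sign hf' := by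
  obtain ⟨ω, hω⟩ := o.const
  obtain ⟨a, ha, e⟩ := hω σ hσ
  obtain ⟨a', ha', e'⟩ := hω σ' hσ'
  obtain ⟨c, c0, h1, s1⟩ := o.exists_psi_eq_smul hf
  obtain ⟨c', c0', h1', s1'⟩ := o.exists_psi_eq_smul hf'
  obtain ⟨b, hb, hbe⟩ := exists_facetFormExt_eq_neg_smul hf hf' hσ hσ' hne
  obtain ⟨q, hq⟩ := exists_relInterior σ
  have hq := facetFormExt_pos_of_isRelInterior hf hq
  have key := facetFormExt_smul_psi_detRes hf hf' hσ hσ' ω q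
  have e2 : detRes σ hσ ω = a⁻¹ • o.form σ := by rw [e, smul_smul, inv_mul_cancel₀ ha.ne', one_smul]
  have e2' : detRes σ' hσ' ω = a'⁻¹ • o.form σ' := by
    rw [e', smul_smul, inv_mul_cancel₀ ha'.ne', one_smul]
  rw [e2, e2', map_smul, map_smul, h1, h1', hbe, smul_smul, smul_smul, smul_smul, smul_smul] at key
  have key := smul_left_injective ℝ (o.form_ne_zero τ) key
  rw [LinearMap.smul_apply, smul_eq_mul, ← s1, ← s1'] at key
  set H := facetFormExt hf q
  have p : 0 < H * a⁻¹ * |c| := by positivity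
  have p' : 0 < H * b * a'⁻¹ * |c'| := by positivity
  have key : o.sign hf * (H * a⁻¹ * |c|) = -(o.sign hf' * (H * b * a'⁻¹ * |c'|)) := by
    rw [s1, s1'] at key
    linear_combination key + H * a⁻¹ * s1 + H * b * a'⁻¹ * s1'
  rcases o.sign_eq_one_or hf with r | r <;> rcases o.sign_eq_one_or hf' with r' | r' <;>
    rw [r, r'] at key ⊢ <;> linarith

open Classical in
/-- The cellular boundary operator squares to zero. -/
theorem Orientation.sum_sign_mul_sign (o : Δ.Orientation) (ρ σ : Δ.Cone) :
    ∑ τ : Δ.Cone, (if h : IsFacet ρ τ ∧ IsFacet τ σ then o.sign h.1 * o.sign h.2 else 0) = 0 := by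
  by_cases hex : ∃ τ, IsFacet ρ τ ∧ IsFacet τ σ
  · obtain ⟨τ, h1, h2⟩ := hex
    obtain ⟨τ', h2', h1', hne⟩ := exists_isFacet_ne h2 h1
    rw [Finset.sum_eq_add τ τ' hne.symm]
    · rw [dif_pos ⟨h1, h2⟩, dif_pos ⟨h1', h2'⟩, mul_comm, o.sign_mul_sign h2 h2' h1 h1' hne.symm]
      ring
    · rintro κ - ⟨hκ, hκ'⟩
      rw [dif_neg]
      rintro ⟨h3, h4⟩
      rcases eq_or_eq_of_lt_of_lt h2 h2' h1 h1' hne.symm h3.lt h4.lt with h | h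
      · exact hκ h
      · exact hκ' h
    · simp
    · simp
  · refine Finset.sum_eq_zero fun τ _ => ?_
    rw [dif_neg fun h => hex ⟨τ, h⟩]

open Classical in
/-- The coefficient at `γ` of the boundary of the cellular chain that is the sum of the
full-dimensional cones satisfying `Q`. -/
def bdSum (o : Δ.Orientation) (Q : Δ.Cone → Prop) (γ : Δ.Cone) : ℝ :=
  ∑ σ : Δ.Cone, if h : IsFacet γ σ ∧ dim σ = Module.finrank ℝ V ∧ Q σ then o.sign h.1 else 0

theorem bdSum_eq_zero_of_dim (o : Δ.Orientation) (Q : Δ.Cone → Prop) {γ : Δ.Cone}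
    (h : dim γ + 1 ≠ Module.finrank ℝ V) : bdSum o Q γ = 0 := by
  refine Finset.sum_eq_zero fun σ _ => ?_
  rw [dif_neg]
  rintro ⟨h1, h2, -⟩
  exact h (h1.2.trans h2)

theorem bdSum_eq_sign (o : Δ.Orientation) (Q : Δ.Cone → Prop) {γ σ : Δ.Cone}
    (hf : IsFacet γ σ) (hσ : dim σ = Module.finrank ℝ V) (hQ : Q σ)
    (huniq : ∀ σ', IsFacet γ σ' → σ' = σ) : bdSum o Q γ = o.sign hf := by
  rw [bdSum, Finset.sum_eq_single σ]
  · rw [dif_pos ⟨hf, hσ, hQ⟩]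
  · intro σ' _ hne
    rw [dif_neg fun h => hne (huniq σ' h.1)]
  · simp

theorem bdSum_eq_zero_of_ne (o : Δ.Orientation) (Q : Δ.Cone → Prop) {γ σ σ' : Δ.Cone}
    (hf : IsFacet γ σ) (hf' : IsFacet γ σ') (hσ : dim σ = Module.finrank ℝ V) (hne : σ ≠ σ')
    (hQ : Q σ ↔ Q σ') : bdSum o Q γ = 0 := by
  have hσ' : dim σ' = Module.finrank ℝ V := by rw [← hf'.2, hf.2, hσ]
  rw [bdSum, Finset.sum_eq_add σ σ' hne]
  · by_cases h : Q σ
    · rw [dif_pos ⟨hf, hσ, h⟩, dif_pos ⟨hf', hσ', hQ.mp h⟩, o.sign_eq_neg hf hf' hσ hσ' hne,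
        neg_add_cancel]
    · rw [dif_neg fun h' => h h'.2.2, dif_neg fun h' => h (hQ.mpr h'.2.2), add_zero]
  · rintro κ - ⟨h1, h2⟩
    rw [dif_neg]
    rintro ⟨h3, -⟩
    rcases eq_or_eq_of_isFacet hf hf' h3 hσ hne with h | h
    · exact h1 h
    · exact h2 h
  · simp
  · simp

open Classical in
theorem sum_sign_mul_bdSum (o : Δ.Orientation) (Q : Δ.Cone → Prop) (δ : Δ.Cone) :
    ∑ γ : Δ.Cone, (if h : IsFacet δ γ then o.sign h * bdSum o Q γ else 0) = 0 := by
  have h1 : ∀ γ : Δ.Cone, (if h : IsFacet δ γ then o.sign h * bdSum o Q γ else 0) =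
      ∑ σ : Δ.Cone, if dim σ = Module.finrank ℝ V ∧ Q σ then
        (if h : IsFacet δ γ ∧ IsFacet γ σ then o.sign h.1 * o.sign h.2 else 0) else 0 := by
    intro γ
    split_ifs with h
    · rw [bdSum, Finset.mul_sum]
      refine Finset.sum_congr rfl fun σ _ => ?_
      by_cases h2 : IsFacet γ σ <;> by_cases h3 : dim σ = Module.finrank ℝ V ∧ Q σ <;>
        simp [h, h2, h3]
    · simp [h]
  rw [Finset.sum_congr rfl fun γ _ => h1 γ, Finset.sum_comm]
  refine Finset.sum_eq_zero fun σ _ => ?_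
  split_ifs
  · exact o.sum_sign_mul_sign δ σ
  · simp

theorem dim_lt_of_mem_boundary {γ : Δ.Cone} (h : γ ∈ Δ.boundary) : dim γ < Module.finrank ℝ V := by
  obtain ⟨τ, hle, hd, -⟩ := h
  have := dim_le_of_le hle
  omega

theorem exists_unique_of_mem_boundary {τ : Δ.Cone} (h : τ ∈ Δ.boundary)
    (hd : dim τ + 1 = Module.finrank ℝ V) :
    ∃ σ : Δ.Cone, IsFacet τ σ ∧ dim σ = Module.finrank ℝ V ∧ ∀ σ', IsFacet τ σ' → σ' = σ := by
  obtain ⟨τ', hle, hd', σ, ⟨h1, h2⟩, h3⟩ := h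
  obtain rfl : τ = τ' := eq_of_le_of_dim_le hle (by omega)
  exact ⟨σ, ⟨h1, by omega⟩, h2, fun σ' hf => h3 σ' ⟨hf.1, by rw [← hf.2, hd]⟩⟩

theorem bdSum_eq_zero_of_notMem_boundary (o : Δ.Orientation) {ρ : Δ.Cone} (Q : Δ.Cone → Prop)
    (hQ : ∀ τ σ σ' : Δ.Cone, ρ ≤ τ → IsFacet τ σ → IsFacet τ σ' →
      dim σ = Module.finrank ℝ V → (Q σ ↔ Q σ')) {γ : Δ.Cone} (hγ : ρ ≤ γ)
    (hb : γ ∉ Δ.boundary) : bdSum o Q γ = 0 := by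
  by_cases hex : ∃ σ, IsFacet γ σ ∧ dim σ = Module.finrank ℝ V
  · obtain ⟨σ, hf, hσ⟩ := hex
    obtain ⟨σ', hf', hne⟩ : ∃ σ', IsFacet γ σ' ∧ σ' ≠ σ := by
      by_contra! hc
      exact hb (mem_boundary_of_unique hf hσ hc)
    exact bdSum_eq_zero_of_ne o Q hf hf' hσ hne.symm (hQ γ σ σ' hγ hf hf' hσ)
  · refine Finset.sum_eq_zero fun σ _ => ?_
    rw [dif_neg fun h => hex ⟨σ, h.1, h.2.1⟩]

/-- The boundary of a sum of full-dimensional cones that is closed under crossing facets at `ρ` is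
a cycle of `∂Δ` at `ρ`. -/
theorem bdSum_mem_cycles (o : Δ.Orientation) (ρ : Δ.Cone) (Q : Δ.Cone → Prop)
    (hQ : ∀ τ σ σ' : Δ.Cone, ρ ≤ τ → IsFacet τ σ → IsFacet τ σ' →
      dim σ = Module.finrank ℝ V → (Q σ ↔ Q σ')) {i : ℕ} (hi : i + 1 = Module.finrank ℝ V) :
    (fun γ : BdStar ρ => bdSum o Q γ.1) ∈ LinearMap.ker (bdMap o ρ) ⊓ bdChains ρ i := by
  classical
  refine ⟨?_, fun γ hγ => bdSum_eq_zero_of_dim o Q (by omega)⟩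
  refine LinearMap.mem_ker.mpr (funext fun δ => ?_)
  let f : Δ.Cone → ℝ := fun γ => if h : IsFacet δ.1 γ then o.sign h * bdSum o Q γ else 0
  have h1 : bdMap o ρ (fun γ : BdStar ρ => bdSum o Q γ.1) δ = ∑ γ : BdStar ρ, f γ.1 := by
    change ∑ γ : BdStar ρ, _ = _
    exact Finset.sum_congr rfl fun γ _ => by congr
  have h2 : ∑ γ ∈ Finset.univ.filter (fun γ : Δ.Cone => γ ∈ Δ.boundary ∧ ρ ≤ γ), f γ =
      ∑ γ : BdStar ρ, f γ.1 := Finset.sum_subtype _ (by simp) f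
  have h3 : ∑ γ ∈ Finset.univ.filter (fun γ : Δ.Cone => γ ∈ Δ.boundary ∧ ρ ≤ γ), f γ =
      ∑ γ, f γ := by
    refine Finset.sum_subset (Finset.subset_univ _) fun γ _ hγ => ?_
    by_cases h : IsFacet δ.1 γ
    · have hργ := δ.2.2.trans h.1
      have hb : γ ∉ Δ.boundary := fun hb => hγ (by simp [hb, hργ])
      simp only [f, dif_pos h, bdSum_eq_zero_of_notMem_boundary o Q hQ hργ hb, mul_zero]
    · simp only [f, dif_neg h]
  rw [h1, ← h2, h3]
  exact sum_sign_mul_bdSum o Q δ.1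

/-- In a family of full-dimensional cones closed under crossing facets at `ρ`, either all facets
at `ρ` are interior, so that the family is complete, or its boundary is a non-zero cycle. -/
theorem forall_of_bdSum_eq_zero (o : Δ.Orientation) {ρ : Δ.Cone} (Q : Δ.Cone → Prop)
    (hQ : ∀ τ σ σ' : Δ.Cone, ρ ≤ τ → IsFacet τ σ → IsFacet τ σ' →
      dim σ = Module.finrank ℝ V → (Q σ ↔ Q σ'))
    (h0 : ∀ γ ∈ Δ.boundary, ρ ≤ γ → bdSum o Q γ = 0) {σ σ' : Δ.Cone}
    (hσ : dim σ = Module.finrank ℝ V) (hσ' : dim σ' = Module.finrank ℝ V) (hρσ : ρ ≤ σ)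
    (hρσ' : ρ ≤ σ') (h : Q σ) : Q σ' := by
  have := mem_of_crossing_closed (ρ := ρ)
    (𝒞 := {κ | (ρ ≤ κ ∧ dim κ = Module.finrank ℝ V) ∧ Q κ}) (fun κ hκ => hκ.1) (by
      rintro κ ⟨⟨h1, h2⟩, h3⟩ τ hf hρτ
      obtain ⟨κ', hf', hne⟩ : ∃ κ', IsFacet τ κ' ∧ κ' ≠ κ := by
        by_contra! hc
        have h4 := h0 τ (mem_boundary_of_unique hf h2 hc) hρτ
        rw [bdSum_eq_sign o Q hf h2 h3 hc] at h4
        rcases o.sign_eq_one_or hf with h5 | h5 <;> rw [h5] at h4 <;> norm_num at h4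
      exact ⟨κ', ⟨⟨hρτ.trans hf'.1, by rw [← hf'.2, hf.2, h2]⟩, (hQ τ κ κ' hρτ hf hf' h2).mp h3⟩,
        hne, hf'⟩)
    (σ₀ := σ) ⟨⟨hρσ, hσ⟩, h⟩ hσ' hρσ'
  exact this.2

/-- The full-dimensional cones containing `ρ` are connected through common facets containing
`ρ`: a decomposition into two classes would give two linearly independent cycles in the
one-dimensional local homology of the boundary. -/
theorem IsQuasiConvex.facet_connected (hΔ : Δ.IsQuasiConvex) {ρ : Δ.Cone} (P : Δ.Cone → Prop)
    (hP : ∀ τ σ σ' : Δ.Cone, ρ ≤ τ → IsFacet τ σ → IsFacet τ σ' →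
      dim σ = Module.finrank ℝ V → (P σ ↔ P σ')) {σ σ' : Δ.Cone}
    (hσ : dim σ = Module.finrank ℝ V) (hσ' : dim σ' = Module.finrank ℝ V) (hρσ : ρ ≤ σ)
    (hρσ' : ρ ≤ σ') (h : P σ) : P σ' := by
  by_contra h'
  obtain ⟨o, ho⟩ := hΔ.2
  have hP' : ∀ τ σ σ' : Δ.Cone, ρ ≤ τ → IsFacet τ σ → IsFacet τ σ' →
      dim σ = Module.finrank ℝ V → (¬ P σ ↔ ¬ P σ') :=
    fun τ σ σ' h1 h2 h3 h4 => not_congr (hP τ σ σ' h1 h2 h3 h4)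
  have n1 : ∃ γ ∈ Δ.boundary, ρ ≤ γ ∧ bdSum o P γ ≠ 0 := by
    by_contra! hc
    exact h' (forall_of_bdSum_eq_zero o P hP hc hσ hσ' hρσ hρσ' h)
  have n2 : ∃ γ ∈ Δ.boundary, ρ ≤ γ ∧ bdSum o (fun κ => ¬ P κ) γ ≠ 0 := by
    by_contra! hc
    exact forall_of_bdSum_eq_zero o (fun κ => ¬ P κ) hP' hc hσ' hσ hρσ' hρσ h' h
  obtain ⟨γ, hγ, hργ, hne⟩ := n1
  obtain ⟨γ', hγ', hργ', hne'⟩ := n2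
  have hρ : ρ ∈ Δ.boundary := by
    obtain ⟨τ, h1, h2⟩ := hγ
    exact ⟨τ, hργ.trans h1, h2⟩
  obtain ⟨i, hi⟩ : ∃ i, i + 1 = Module.finrank ℝ V :=
    ⟨_, Nat.succ_pred_eq_of_pos (Nat.zero_lt_of_lt (dim_lt_of_mem_boundary hρ))⟩
  have hrank := ho ρ hρ i
  rw [if_pos hi] at hrank
  obtain ⟨v, -, hv⟩ := finrank_eq_one_iff'.mp hrank
  let z : (Q : Δ.Cone → Prop) → (∀ τ σ σ' : Δ.Cone, ρ ≤ τ → IsFacet τ σ → IsFacet τ σ' →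
      dim σ = Module.finrank ℝ V → (Q σ ↔ Q σ')) →
      ↥(LinearMap.ker (bdMap o ρ) ⊓ bdChains ρ i) := fun Q hQ => ⟨_, bdSum_mem_cycles o ρ Q hQ hi⟩
  obtain ⟨c, hc⟩ := hv (Submodule.Quotient.mk (z P hP))
  obtain ⟨c', hc'⟩ := hv (Submodule.Quotient.mk (z (fun κ => ¬ P κ) hP'))
  -- there are no chains of dimension `n` in the boundary
  have hbot : ∀ x ∈ bdChains ρ (i + 1), x = 0 := by
    intro x hx
    funext γ
    exact hx γ (by have := dim_lt_of_mem_boundary γ.2.1; omega)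
  have hlin : c' • z P hP = c • z (fun κ => ¬ P κ) hP' := by
    have h1 : Submodule.Quotient.mk (c' • z P hP - c • z (fun κ => ¬ P κ) hP') =
        (0 : LocalHomology o ρ i) := by
      rw [Submodule.Quotient.mk_sub, Submodule.Quotient.mk_smul, Submodule.Quotient.mk_smul, ← hc,
        ← hc', smul_smul, smul_smul, mul_comm, sub_self]
    rw [Submodule.Quotient.mk_eq_zero] at h1
    obtain ⟨x, hx, hx'⟩ := h1
    rw [hbot x hx, map_zero] at hx'
    exact sub_eq_zero.mp (Subtype.ext hx'.symm)
  have heval : ∀ γ : BdStar ρ, c' * bdSum o P γ.1 = c * bdSum o (fun κ => ¬ P κ) γ.1 :=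
    fun γ => congrFun (congrArg Subtype.val hlin) γ
  -- the two cycles have disjoint supports
  have hdisj : ∀ γ ∈ Δ.boundary, bdSum o P γ ≠ 0 → bdSum o (fun κ => ¬ P κ) γ = 0 := by
    intro γ hγ hne
    refine Finset.sum_eq_zero fun κ _ => ?_
    rw [dif_neg]
    rintro ⟨h1, h2, h3⟩
    obtain ⟨κ', h4, h5, h6⟩ := exists_unique_of_mem_boundary hγ (h1.2.trans h2)
    obtain rfl := h6 κ h1
    refine hne (Finset.sum_eq_zero fun κ' _ => ?_)
    rw [dif_neg]
    rintro ⟨h7, -, h8⟩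
    exact h3 (h6 κ' h7 ▸ h8)
  have e1 := heval ⟨γ, hγ, hργ⟩
  have e2 := heval ⟨γ', hγ', hργ'⟩
  have hz : bdSum o P γ' = 0 := by
    by_contra hc
    exact hne' (hdisj γ' hγ' hc)
  rw [hz, mul_zero] at e2
  have hc0 : c = 0 := (mul_eq_zero.mp e2.symm).resolve_right hne'
  rw [hc0, zero_smul] at hc
  have h1 : (Submodule.Quotient.mk (z P hP) : LocalHomology o ρ i) = 0 := hc.symm
  rw [Submodule.Quotient.mk_eq_zero] at h1
  obtain ⟨x, hx, hx'⟩ := h1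
  rw [hbot x hx, map_zero] at hx'
  exact hne (congrFun hx'.symm ⟨γ, hγ, hργ⟩)

end connectivity

/-! ### Compatible families on a quasi-convex fan -/

section families

variable {V : Type u} [AddCommGroup V] [Module ℝ V] {Δ : Fan V} [FiniteDimensional ℝ V]

/-- In a pure fan, a property that passes from cones to their facets has to be checked only for the
cones of full dimension. -/
theorem IsPure.induction (hΔ : Δ.IsPure) {P : Δ.Cone → Prop}
    (hP : ∀ σ, dim σ = Module.finrank ℝ V → P σ) (hstep : ∀ τ σ, IsFacet τ σ → P σ → P τ)
    (ρ : Δ.Cone) : P ρ := by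
  obtain ⟨σ, hρσ, hσ⟩ := hΔ ρ
  have key : ∀ (d : ℕ) (κ : Δ.Cone), dim κ ≤ dim ρ + d → ρ ≤ κ → P κ → P ρ := by
    intro d
    induction d with
    | zero =>
      intro κ hd hle h
      rwa [eq_of_le_of_dim_le hle hd]
    | succ d ih =>
      intro κ hd hle h
      rcases hle.eq_or_lt with rfl | hlt
      · exact h
      · obtain ⟨τ, hf, hρτ⟩ := exists_isFacet_ge hlt
        exact ih τ (by have := hf.2; omega) hρτ (hstep τ κ hf h)
  exact key (dim σ) σ (by omega) hρσ (hP σ hσ)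

theorem exists_isFacet_le {ρ κ : Δ.Cone} (h : ρ < κ) : ∃ τ, IsFacet ρ τ ∧ τ ≤ κ := by
  have key : ∀ (d : ℕ) (κ : Δ.Cone), dim κ ≤ dim ρ + d → ρ < κ → ∃ τ, IsFacet ρ τ ∧ τ ≤ κ := by
    intro d
    induction d with
    | zero =>
      intro κ hd hlt
      have := dim_lt_of_lt hlt
      omega
    | succ d ih =>
      intro κ hd hlt
      obtain ⟨τ, hf, hρτ⟩ := exists_isFacet_ge hlt
      rcases hρτ.eq_or_lt with rfl | hlt'
      · exact ⟨κ, hf, le_rfl⟩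
      · obtain ⟨τ', h1, h2⟩ := ih τ (by have := hf.2; omega) hlt'
        exact ⟨τ', h1, h2.trans hf.1⟩
  exact key (dim κ) κ (by omega) h

/-- A function on the cones of dimension `dim ρ + 1` containing `ρ` that is constant on the faces
of every cone of dimension `dim ρ + 2` is constant on the faces of every cone. -/
theorem eq_of_le_of_diamond {ρ : Δ.Cone} {Y : Type*} (val : ∀ τ : Δ.Cone, IsFacet ρ τ → Y)
    (hval : ∀ (κ τ τ' : Δ.Cone) (hf : IsFacet ρ τ) (hf' : IsFacet ρ τ'), IsFacet τ κ →
      IsFacet τ' κ → val τ hf = val τ' hf') {γ τ τ' : Δ.Cone} (hf : IsFacet ρ τ)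
    (hf' : IsFacet ρ τ') (h : τ ≤ γ) (h' : τ' ≤ γ) : val τ hf = val τ' hf' := by
  induction hd : dim γ using Nat.strong_induction_on generalizing γ τ τ' with
  | _ d ih =>
    have e := hf.2
    have e' := hf'.2
    have hργ : ρ ≤ γ := hf.1.trans h
    rcases h.eq_or_lt with rfl | hlt
    · have := dim_le_of_le h'
      obtain rfl := eq_of_le_of_dim_le h' (by omega)
      rfl
    rcases h'.eq_or_lt with rfl | hlt'
    · have := dim_le_of_le h
      obtain rfl := eq_of_le_of_dim_le h (by omega)
      rfl
    have hdlt := dim_lt_of_lt hlt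
    by_cases h2 : dim γ = dim ρ + 2
    · exact hval γ τ τ' hf hf' ⟨h, by omega⟩ ⟨h', by omega⟩
    obtain ⟨τ₁, hf₁, hle₁⟩ := exists_isFacet_ge hlt
    obtain ⟨τ₂, hf₂, hle₂⟩ := exists_isFacet_ge hlt'
    have e₁ := hf₁.2
    have e₂ := hf₂.2
    let P : Δ.Cone → Prop := fun κ =>
      ∀ (τ'' : Δ.Cone) (hf'' : IsFacet ρ τ''), τ'' ≤ κ → val τ'' hf'' = val τ hf
    have hP₁ : P τ₁ := fun τ'' hf'' hle => ih (dim τ₁) (by omega) hf'' hf hle hle₁ rfl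
    have hP₂ : P τ₂ := by
      by_contra hP₂
      obtain ⟨α, β, κ, hα, hβ, hPα, hPβ, hρκ, hκα, hκβ⟩ := exists_facets_meeting hργ (by omega) P
        hf₁ hf₂ (hf.1.trans hle₁) (hf'.1.trans hle₂) hP₁ hP₂
      obtain ⟨τ₀, hf₀, hle₀⟩ := exists_isFacet_le hρκ
      have eβ := hβ.2
      exact hPβ fun τ'' hf'' hle => (ih (dim β) (by omega) hf'' hf₀ hle (hle₀.trans hκβ) rfl).trans
        (hPα τ₀ hf₀ (hle₀.trans hκα))
    exact (hP₂ τ' hf' hle₂).symm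

/-- On a quasi-convex fan and for `ρ` of codimension at least two, a function on the cones of
dimension `dim ρ + 1` containing `ρ` that is constant on the faces of every cone of dimension
`dim ρ + 2` is constant. -/
theorem IsQuasiConvex.eq_of_diamond (hΔ : Δ.IsQuasiConvex) {ρ : Δ.Cone}
    (hρ : dim ρ + 2 ≤ Module.finrank ℝ V) {Y : Type*} (val : ∀ τ : Δ.Cone, IsFacet ρ τ → Y)
    (hval : ∀ (κ τ τ' : Δ.Cone) (hf : IsFacet ρ τ) (hf' : IsFacet ρ τ'), IsFacet τ κ →
      IsFacet τ' κ → val τ hf = val τ' hf') {τ τ' : Δ.Cone} (hf : IsFacet ρ τ)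
    (hf' : IsFacet ρ τ') : val τ hf = val τ' hf' := by
  obtain ⟨σ, hτσ, hσ⟩ := hΔ.1 τ
  obtain ⟨σ', hτσ', hσ'⟩ := hΔ.1 τ'
  let P : Δ.Cone → Prop := fun κ =>
    ∀ (τ'' : Δ.Cone) (hf'' : IsFacet ρ τ''), τ'' ≤ κ → val τ'' hf'' = val τ hf
  have hcross : ∀ μ κ κ' : Δ.Cone, ρ ≤ μ → IsFacet μ κ → IsFacet μ κ' →
      dim κ = Module.finrank ℝ V → P κ → P κ' := by
    intro μ κ κ' hρμ hμ hμ' hκ hPκ τ'' hf'' hle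
    have hlt : ρ < μ := lt_of_le_of_ne hρμ (by rintro rfl; have := hμ.2; omega)
    obtain ⟨τ₀, hf₀, hle₀⟩ := exists_isFacet_le hlt
    exact (eq_of_le_of_diamond val hval hf'' hf₀ hle (hle₀.trans hμ'.1)).trans
      (hPκ τ₀ hf₀ (hle₀.trans hμ.1))
  have hPσ' : P σ' := hΔ.facet_connected (ρ := ρ) P
    (fun μ κ κ' h1 h2 h3 h4 => ⟨hcross μ κ κ' h1 h2 h3 h4,
      hcross μ κ' κ h1 h3 h2 (by rw [← h3.2, h2.2, h4])⟩)
    hσ hσ' (hf.1.trans hτσ) (hf'.1.trans hτσ')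
    (fun τ'' hf'' hle => eq_of_le_of_diamond val hval hf'' hf hle hτσ)
  exact (hPσ' τ' hf' hτσ').symm

/-- For restriction maps to facets that commute along the two chains between cones of
codimension two, a family on the full-dimensional cones of a quasi-convex fan extends to a
compatible family as soon as it is compatible on the cones of codimension one. -/
theorem IsQuasiConvex.exists_compatible (hΔ : Δ.IsQuasiConvex) {X : Δ.Cone → Type*}
    (r : ∀ {τ σ : Δ.Cone}, IsFacet τ σ → X σ → X τ)
    (hr : ∀ {ρ τ τ' σ : Δ.Cone} (h : IsFacet τ σ) (h' : IsFacet τ' σ) (hρ : IsFacet ρ τ)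
      (hρ' : IsFacet ρ τ') (x : X σ), r hρ (r h x) = r hρ' (r h' x))
    (t : ∀ σ, X σ)
    (ht : ∀ {τ σ σ' : Δ.Cone} (h : IsFacet τ σ) (h' : IsFacet τ σ'),
      dim σ = Module.finrank ℝ V → r h (t σ) = r h' (t σ')) :
    ∃ s : ∀ σ, X σ, (∀ σ, dim σ = Module.finrank ℝ V → s σ = t σ) ∧
      ∀ (τ σ : Δ.Cone) (h : IsFacet τ σ), r h (s σ) = s τ := by
  classical
  set n := Module.finrank ℝ V with hn
  -- extend the family by descending induction over the dimension
  have key : ∀ k : ℕ, ∃ s : ∀ σ, X σ, (∀ σ, dim σ = n → s σ = t σ) ∧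
      ∀ (τ σ : Δ.Cone) (h : IsFacet τ σ), n ≤ dim τ + k → r h (s σ) = s τ := by
    intro k
    induction k with
    | zero =>
      refine ⟨t, fun _ _ => rfl, fun τ σ h hd => ?_⟩
      have := h.2
      have := dim_le_finrank σ
      omega
    | succ k ih =>
      obtain ⟨s, hs, hcomp⟩ := ih
      -- the value on a cone `ρ` of codimension `k + 1` does not depend on the cone it comes from
      have hwd : ∀ {ρ τ τ' : Δ.Cone} (h : IsFacet ρ τ) (h' : IsFacet ρ τ'), dim ρ + k + 1 = n →
          r h (s τ) = r h' (s τ') := by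
        intro ρ τ τ' h h' hd
        have e := h.2
        have e' := h'.2
        rcases Nat.eq_zero_or_pos k with rfl | hk
        · rw [hs τ (by omega), hs τ' (by omega)]
          exact ht h h' (by omega)
        · refine hΔ.eq_of_diamond (by omega) (fun τ h => r h (s τ)) ?_ h h'
          intro κ τ τ' hf hf' hτ hτ'
          have := hf.2
          have := hf'.2
          rw [← hcomp τ κ hτ (by omega), ← hcomp τ' κ hτ' (by omega)]
          exact hr hτ hτ' hf hf' _
      refine ⟨fun ρ => if h : dim ρ + k + 1 = n ∧ ∃ τ, IsFacet ρ τ then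
        r h.2.choose_spec (s h.2.choose) else s ρ, fun σ hσ => ?_, fun τ σ h hd => ?_⟩
      · beta_reduce
        rw [dif_neg (by rintro ⟨h, -⟩; omega)]
        exact hs σ hσ
      · have e := h.2
        beta_reduce
        rw [dif_neg (by rintro ⟨h, -⟩; omega)]
        by_cases hk : dim τ + k + 1 = n
        · have hex : dim τ + k + 1 = n ∧ ∃ τ', IsFacet τ τ' := ⟨hk, σ, h⟩
          rw [dif_pos hex]
          exact hwd h hex.2.choose_spec hk
        · rw [dif_neg fun h => hk h.1]
          exact hcomp τ σ h (by omega)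
  obtain ⟨s, h1, h2⟩ := key n
  exact ⟨s, h1, fun τ σ h => h2 τ σ h (by omega)⟩

end families

end Fan

/-! ### Polynomial algebras -/

section poly

variable {W : Type u} [AddCommGroup W] [Module ℝ W]

theorem polyRes_id (a : Poly W) : polyRes LinearMap.id a = a := by
  have : polyRes (LinearMap.id : W →ₗ[ℝ] W) = AlgHom.id ℝ _ := by
    apply SymmetricAlgebra.algHom_ext
    ext l
    simp [polyRes_ι]
  rw [this]
  rfl

theorem poly_ι_injective : Function.Injective (SymmetricAlgebra.ι ℝ (Module.Dual ℝ W)) := by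
  rw [injective_iff_map_eq_zero]
  intro l hl
  ext x
  have h := congrArg (SymmetricAlgebra.lift (LinearMap.applyₗ x : Module.Dual ℝ W →ₗ[ℝ] ℝ)) hl
  rw [SymmetricAlgebra.lift_ι_apply, map_zero] at h
  exact h

/-- A polynomial that vanishes on the kernel `U` of a non-zero linear form `h` is divisible
by `h`. -/
theorem ι_dvd_of_polyRes_eq_zero {h : Module.Dual ℝ W} {U : Submodule ℝ W}
    (hU : LinearMap.ker h = U) (h0 : h ≠ 0) {a : Poly W} (ha : polyRes U.subtype a = 0) :
    SymmetricAlgebra.ι ℝ _ h ∣ a := by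
  obtain ⟨v, hv⟩ := DFunLike.ne_iff.mp h0
  have hv : h v ≠ 0 := hv
  -- the projection onto `U` along `v`
  let p : W →ₗ[ℝ] W := LinearMap.id - (LinearMap.toSpanSingleton ℝ W ((h v)⁻¹ • v)) ∘ₗ h
  have hp : ∀ x, p x ∈ U := by
    intro x
    rw [← hU, LinearMap.mem_ker]
    simp [p, hv]
  have h1 : polyRes p a = 0 := by
    have : p = U.subtype ∘ₗ p.codRestrict U hp := rfl
    rw [this, ← polyRes_comp, ha, map_zero]
  let I : Ideal (Poly W) := Ideal.span {SymmetricAlgebra.ι ℝ _ h}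
  have h2 : (Ideal.Quotient.mkₐ ℝ I).comp (polyRes p) = Ideal.Quotient.mkₐ ℝ I := by
    apply SymmetricAlgebra.algHom_ext
    ext l
    refine (Ideal.Quotient.mk_eq_mk_iff_sub_mem _ _).mpr ?_
    change polyRes p (SymmetricAlgebra.ι ℝ _ l) - SymmetricAlgebra.ι ℝ _ l ∈ I
    have h3 : p.dualMap l - l = (-(l ((h v)⁻¹ • v))) • h := by
      ext x
      simp [p]
      ring
    rw [polyRes_ι, ← map_sub, h3, map_smul, Algebra.smul_def]
    exact Ideal.mul_mem_left _ _ (Ideal.mem_span_singleton_self _)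
  have h3 := DFunLike.congr_fun h2 a
  rw [AlgHom.comp_apply, h1, map_zero] at h3
  exact Ideal.mem_span_singleton.mp (Ideal.Quotient.eq_zero_iff_mem.mp h3.symm)

theorem prod_ι_dvd_of_polyRes_eq_zero [FiniteDimensional ℝ W] {S : Finset (Submodule ℝ W)}
    {h : Submodule ℝ W → Module.Dual ℝ W} (hker : ∀ H ∈ S, LinearMap.ker (h H) = H)
    (h0 : ∀ H ∈ S, h H ≠ 0) {a : Poly W} (ha : ∀ H ∈ S, polyRes H.subtype a = 0) :
    ∏ H ∈ S, SymmetricAlgebra.ι ℝ _ (h H) ∣ a := by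
  classical
  induction S using Finset.induction_on with
  | empty => simp
  | insert H S hH ih =>
    simp only [Finset.forall_mem_insert] at hker h0 ha
    obtain ⟨b, rfl⟩ := ih hker.2 h0.2 ha.2
    have hprod : polyRes H.subtype (∏ K ∈ S, SymmetricAlgebra.ι ℝ _ (h K)) ≠ 0 := by
      rw [map_prod, Finset.prod_ne_zero_iff]
      intro K hK
      rw [polyRes_ι]
      intro hc
      have hc := poly_ι_injective (hc.trans (map_zero _).symm)
      have hle : H ≤ K := by
        intro x hx
        rw [← hker.2 K hK]
        exact DFunLike.congr_fun hc ⟨x, hx⟩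
      have e1 : Module.finrank ℝ H + 1 = Module.finrank ℝ W := by
        conv_lhs => rw [← hker.1]
        exact Module.Dual.finrank_ker_add_one_of_ne_zero h0.1
      have e2 : Module.finrank ℝ K + 1 = Module.finrank ℝ W := by
        conv_lhs => rw [← hker.2 K hK]
        exact Module.Dual.finrank_ker_add_one_of_ne_zero (h0.2 K hK)
      obtain rfl : H = K := Submodule.eq_of_le_of_finrank_le hle (by omega)
      exact hH hK
    have h1 := ha.1
    rw [map_mul] at h1
    obtain ⟨c, rfl⟩ := ι_dvd_of_polyRes_eq_zero hker.1 h0.1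
      ((mul_eq_zero.mp h1).resolve_left hprod)
    rw [Finset.prod_insert hH]
    exact ⟨c, by ring⟩

/-- Scaling by `4` acts on the polynomials of degree `q` by `2 ^ q`. -/
theorem polyGr_le_eigenspace (q : ℤ) :
    polyGr W q ≤ Module.End.eigenspace
      (polyRes ((4 : ℝ) • (LinearMap.id : W →ₗ[ℝ] W))).toLinearMap ((2 : ℝ) ^ q) := by
  refine iSup₂_le ?_
  rintro k rfl
  have h4 : (2 : ℝ) ^ (2 * (k : ℤ)) = 4 ^ k := by
    rw [zpow_mul, zpow_natCast]
    norm_num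
  rw [h4]
  clear h4
  induction k with
  | zero =>
    rw [pow_zero, Submodule.one_le, Module.End.mem_eigenspace_iff]
    simp
  | succ k ih =>
    rw [pow_succ, Submodule.mul_le]
    rintro a ha _ ⟨l, rfl⟩
    have h1 := Module.End.mem_eigenspace_iff.mp (ih ha)
    rw [AlgHom.toLinearMap_apply] at h1
    have h2 : ((4 : ℝ) • (LinearMap.id : W →ₗ[ℝ] W)).dualMap l = (4 : ℝ) • l := by
      ext x
      simp
    rw [Module.End.mem_eigenspace_iff, AlgHom.toLinearMap_apply, map_mul, h1, polyRes_ι, h2,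
      map_smul, smul_mul_smul_comm, pow_succ]

theorem iSup_range_ι_pow :
    ⨆ k : ℕ, LinearMap.range (SymmetricAlgebra.ι ℝ (Module.Dual ℝ W)) ^ k = ⊤ := by
  set M := LinearMap.range (SymmetricAlgebra.ι ℝ (Module.Dual ℝ W)) with hM
  rw [eq_top_iff]
  rintro a -
  induction a using SymmetricAlgebra.induction with
  | algebraMap r =>
    refine Submodule.mem_iSup_of_mem 0 ?_
    rw [pow_zero]
    exact Submodule.algebraMap_mem r
  | ι l =>
    refine Submodule.mem_iSup_of_mem 1 ?_
    rw [pow_one]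
    exact ⟨l, rfl⟩
  | add a b ha hb => exact add_mem ha hb
  | mul a b ha hb =>
    have h1 : (⨆ k : ℕ, M ^ k) * (⨆ k : ℕ, M ^ k) ≤ ⨆ k : ℕ, M ^ k := by
      rw [Submodule.iSup_mul]
      refine iSup_le fun i => ?_
      rw [Submodule.mul_iSup]
      refine iSup_le fun j => ?_
      rw [← pow_add]
      exact le_iSup (fun k : ℕ => M ^ k) _
    exact h1 (Submodule.mul_mem_mul ha hb)

theorem polyGr_two_mul (k : ℕ) : polyGr W (2 * (k : ℤ)) =
    LinearMap.range (SymmetricAlgebra.ι ℝ (Module.Dual ℝ W)) ^ k := by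
  refine le_antisymm (iSup₂_le fun j hj => ?_) (le_iSup₂_of_le k rfl le_rfl)
  obtain rfl : k = j := by omega
  exact le_rfl

/-- The polynomials of degree `q` are the eigenvectors for the eigenvalue `2 ^ q` of scaling
by `4`. -/
theorem mem_polyGr_iff {q : ℤ} {a : Poly W} :
    a ∈ polyGr W q ↔ polyRes ((4 : ℝ) • (LinearMap.id : W →ₗ[ℝ] W)) a = (2 : ℝ) ^ q • a := by
  set T := (polyRes ((4 : ℝ) • (LinearMap.id : W →ₗ[ℝ] W))).toLinearMap with hT
  have hev : ∀ {q : ℤ} {a : Poly W}, a ∈ Module.End.eigenspace T ((2 : ℝ) ^ q) ↔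
      polyRes ((4 : ℝ) • (LinearMap.id : W →ₗ[ℝ] W)) a = (2 : ℝ) ^ q • a :=
    Module.End.mem_eigenspace_iff
  rw [← hev]
  refine ⟨fun h => polyGr_le_eigenspace q h, fun h => ?_⟩
  have hinj : Function.Injective fun q : ℤ => (2 : ℝ) ^ q :=
    zpow_right_injective₀ (by norm_num) (by norm_num)
  have htop : (⊤ : Submodule ℝ (Poly W)) ≤
      polyGr W q ⊔ ⨆ (μ : ℝ) (_ : μ ≠ (2 : ℝ) ^ q), Module.End.eigenspace T μ := by
    rw [← iSup_range_ι_pow]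
    refine iSup_le fun k => ?_
    rw [← polyGr_two_mul]
    by_cases hk : 2 * (k : ℤ) = q
    · rw [hk]
      exact le_sup_left
    · exact le_trans (le_trans (polyGr_le_eigenspace _)
        (le_iSup₂_of_le ((2 : ℝ) ^ (2 * (k : ℤ))) (fun h => hk (hinj h)) le_rfl)) le_sup_right
  obtain ⟨b, hb, c, hc, hbc⟩ := Submodule.mem_sup.mp (htop (Submodule.mem_top (x := a)))
  have hc' : c ∈ Module.End.eigenspace T ((2 : ℝ) ^ q) := by
    have : c = a - b := by rw [← hbc, add_sub_cancel_left]
    rw [this]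
    exact sub_mem h (polyGr_le_eigenspace q hb)
  have h0 : c = 0 := Submodule.disjoint_def.mp
    ((Module.End.eigenspaces_iSupIndep T) ((2 : ℝ) ^ q)) c hc' hc
  rw [← hbc, h0, add_zero]
  exact hb

theorem ι_mem_polyGr (l : Module.Dual ℝ W) : SymmetricAlgebra.ι ℝ _ l ∈ polyGr W 2 := by
  refine Submodule.mem_iSup_of_mem 1 (Submodule.mem_iSup_of_mem (by norm_num) ?_)
  rw [pow_one]
  exact ⟨l, rfl⟩

theorem one_mem_polyGr : (1 : Poly W) ∈ polyGr W 0 := by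
  rw [mem_polyGr_iff]
  simp

theorem mul_mem_polyGr {i j : ℤ} {a b : Poly W} (ha : a ∈ polyGr W i) (hb : b ∈ polyGr W j) :
    a * b ∈ polyGr W (i + j) := by
  rw [mem_polyGr_iff] at ha hb ⊢
  rw [map_mul, ha, hb, smul_mul_smul_comm, zpow_add₀ two_ne_zero]

theorem polyRes_mem_polyGr {U : Type u} [AddCommGroup U] [Module ℝ U] (f : U →ₗ[ℝ] W) {q : ℤ}
    {a : Poly W} (ha : a ∈ polyGr W q) : polyRes f a ∈ polyGr U q := by
  rw [mem_polyGr_iff] at ha ⊢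
  have : f ∘ₗ ((4 : ℝ) • LinearMap.id) = ((4 : ℝ) • LinearMap.id) ∘ₗ f := by
    ext x
    simp
  rw [polyRes_comp, this, ← polyRes_comp, ha, map_smul]

/-- A factor of a homogeneous polynomial whose complementary factor is homogeneous is
homogeneous. -/
theorem mem_polyGr_of_mul_mem [FiniteDimensional ℝ W] {i j : ℤ} {a b : Poly W}
    (ha : a ∈ polyGr W i) (h0 : a ≠ 0) (hab : a * b ∈ polyGr W (i + j)) : b ∈ polyGr W j := by
  rw [mem_polyGr_iff] at ha hab ⊢
  have h2 : (2 : ℝ) ^ i ≠ 0 := zpow_ne_zero _ two_ne_zero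
  rw [map_mul, ha, zpow_add₀ two_ne_zero, mul_smul, smul_mul_assoc] at hab
  have h3 := smul_right_injective (Poly W) h2 hab
  have h4 : a * polyRes ((4 : ℝ) • LinearMap.id) b = a * ((2 : ℝ) ^ j • b) := by
    rw [mul_smul_comm]
    exact h3
  exact mul_left_cancel₀ h0 h4

theorem prod_ι_mem_polyGr {S : Finset (Submodule ℝ W)} (h : Submodule ℝ W → Module.Dual ℝ W) :
    ∏ H ∈ S, SymmetricAlgebra.ι ℝ _ (h H) ∈ polyGr W (2 * (S.card : ℤ)) := by
  classical
  induction S using Finset.induction_on with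
  | empty => simpa using one_mem_polyGr
  | insert H S hH ih =>
    rw [Finset.prod_insert hH, Finset.card_insert_of_notMem hH]
    have := mul_mem_polyGr (ι_mem_polyGr (h H)) ih
    convert this using 2
    push_cast
    ring

end poly

/-! ### Tensor products with determinants -/

section tensor

variable {W : Type u} [AddCommGroup W] [Module ℝ W] [FiniteDimensional ℝ W]
  {M : Type*} [AddCommGroup M] [Module ℝ M]

theorem exists_eq_tmul {ω : DetDual W} (hω : ω ≠ 0) (t : M ⊗[ℝ] DetDual W) :
    ∃ m : M, t = m ⊗ₜ[ℝ] ω := by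
  induction t using TensorProduct.induction_on with
  | zero => exact ⟨0, by simp⟩
  | tmul m η =>
    obtain ⟨c, rfl⟩ := DetDual.exists_eq_smul hω η
    exact ⟨c • m, by rw [TensorProduct.smul_tmul]⟩
  | add x y hx hy =>
    obtain ⟨a, rfl⟩ := hx
    obtain ⟨b, rfl⟩ := hy
    exact ⟨a + b, by rw [TensorProduct.add_tmul]⟩

omit [FiniteDimensional ℝ W] in
theorem tmul_left_injective {ω : DetDual W} (hω : ω ≠ 0) :
    Function.Injective fun m : M => m ⊗ₜ[ℝ] ω := by
  obtain ⟨f, hf⟩ : ∃ f : Module.Dual ℝ (DetDual W), f ω ≠ 0 := by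
    by_contra! hc
    exact hω ((Module.forall_dual_apply_eq_zero_iff ℝ ω).mp hc)
  intro m m' h
  have := congrArg (TensorProduct.rid ℝ M ∘ LinearMap.lTensor M f) h
  simp only [Function.comp_apply, LinearMap.lTensor_tmul, TensorProduct.rid_tmul] at this
  exact smul_right_injective M hf this

end tensor

open Fan

namespace FanSheaf

/-! ### Restriction maps of the dual sheaf -/

section dualRes

variable {V : Type u} [AddCommGroup V] [Module ℝ V] {Δ : Fan V} {F : FanSheaf.{u, w} Δ}

/-- In a flabby sheaf, a section on `ρ` that vanishes on `∂ρ` extends to a global section that is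
supported on the star of `ρ`. -/
theorem IsFlabby.exists_section (hF : F.IsFlabby) {ρ : Δ.Cone} (g : F.relCone ρ) :
    ∃ s : F.sections Set.univ, s.1 ⟨ρ, trivial⟩ = g.1 ∧
      ∀ κ : Δ.Cone, ¬ ρ ≤ κ → s.1 ⟨κ, trivial⟩ = 0 := by
  classical
  let Λ : Set Δ.Cone := {κ | ¬ ρ < κ}
  have hΛ : IsLowerSet Λ := fun κ κ' hle hκ h => hκ (h.trans_le hle)
  let s : F.sections Λ := ⟨fun κ => Pi.single (M := F.obj) ρ g.1 κ.1, by
    rintro ⟨κ, hκ⟩ ⟨κ', -⟩ h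
    dsimp only at h ⊢
    by_cases he : κ = ρ
    · subst he
      rcases h.eq_or_lt with h' | h'
      · subst h'
        exact F.res_refl _ _
      · rw [Pi.single_eq_same, Pi.single_eq_of_ne h'.ne]
        exact g.2 κ' h'
    · have he' : κ' ≠ ρ := by
        rintro rfl
        exact hκ (lt_of_le_of_ne h (Ne.symm he))
      rw [Pi.single_eq_of_ne he, Pi.single_eq_of_ne he', map_zero]⟩
  obtain ⟨t, ht⟩ := hF Λ hΛ s
  have key : ∀ κ (hκ : κ ∈ Λ), t.1 ⟨κ, trivial⟩ = Pi.single (M := F.obj) ρ g.1 κ :=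
    fun κ hκ => congrFun (congrArg Subtype.val ht) ⟨κ, hκ⟩
  refine ⟨t, ?_, fun κ hκ => ?_⟩
  · rw [key ρ (lt_irrefl ρ), Pi.single_eq_same]
  · rw [key κ (fun h => hκ h.le), Pi.single_eq_of_ne]
    rintro rfl
    exact hκ le_rfl

theorem dualMap_eq_zero_of_le [FiniteDimensional ℝ V] {κ τ σ : Δ.Cone} (hf : IsFacet τ σ)
    (hκ : κ ≤ τ) (hκσ : κ ≤ σ) : (linIncl hκσ).dualMap (facetForm hf) = 0 := by
  ext x
  exact (facetForm_eq_zero_iff hf).mpr (lin_mono hκ x.2)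

variable [FiniteDimensional ℝ V]

theorem isExt_of_section {ρ τ : Δ.Cone} (hf : IsFacet ρ τ) {g : F.relCone ρ}
    {s : F.sections Set.univ} (hs : s.1 ⟨ρ, trivial⟩ = g.1)
    (hs0 : ∀ κ : Δ.Cone, ¬ ρ ≤ κ → s.1 ⟨κ, trivial⟩ = 0) : F.IsExt hf g (s.1 ⟨τ, trivial⟩) := by
  refine ⟨(s.2 ⟨τ, trivial⟩ ⟨ρ, trivial⟩ hf.1).trans hs, fun κ hκ hne => ?_⟩
  rw [s.2 ⟨τ, trivial⟩ ⟨κ, trivial⟩ hκ.le]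
  exact hs0 κ fun h => hne (hf.eq_of_le_of_lt h hκ)

theorem phi_apply (hF : F.IsFlabby) {τ σ : Δ.Cone} {hf : IsFacet τ σ}
    {h : Module.Dual ℝ (lin σ)} (hh : IsFacetForm h hf)
    (f : F.relCone σ →ₗ[Poly (lin σ)] Poly (lin σ)) {g : F.relCone τ} {k : F.obj σ}
    (hk : F.IsExt hf g k) :
    phi hF hh f g = polyRes (linIncl hf.1) (f ⟨_, hk.smul_mem hh⟩) :=
  (hF.exists_isExt hf g).choose_spec.congr hk hh f

theorem facetForm_smul_dualMap {ρ τ σ : Δ.Cone} {τ' : Δ.Cone} (hτ : IsFacet τ σ)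
    (hτ' : IsFacet τ' σ) (hρ : IsFacet ρ τ) (hρ' : ρ ≤ τ') {v : lin τ}
    (hv : facetForm hρ v ≠ 0) :
    (linIncl hτ.1).dualMap (facetForm hτ') =
      (facetForm hτ' (linIncl hτ.1 v) / facetForm hρ v) • facetForm hρ := by
  ext x
  have h1 : facetForm hρ (x - (facetForm hρ x / facetForm hρ v) • v) = 0 := by
    rw [map_sub, map_smul, smul_eq_mul, div_mul_cancel₀ _ hv, sub_self]
  rw [facetForm_eq_zero_iff] at h1
  have h2 : facetForm hτ' (linIncl hτ.1 (x - (facetForm hρ x / facetForm hρ v) • v)) = 0 :=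
    (facetForm_eq_zero_iff hτ').mpr (lin_mono hρ' h1)
  rw [map_sub, map_smul, map_sub, map_smul, smul_eq_mul, sub_eq_zero] at h2
  rw [LinearMap.dualMap_apply, h2, LinearMap.smul_apply, smul_eq_mul]
  ring

/-- The composition of two maps `φ_h` along `ρ < τ₁ < σ` is, up to a positive factor,
`f ↦ f (h₁ h₂ ĝ)|_ρ`, where `h₁` and `h₂` are the forms of the two facets of `σ` containing `ρ`
and `ĝ` is an extension of `g`. -/
theorem phi_phi_apply (hF : F.IsFlabby) {ρ τ₁ τ₂ σ : Δ.Cone} {h₁ : IsFacet τ₁ σ}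
    {h₂ : IsFacet τ₂ σ} {hρ₁ : IsFacet ρ τ₁} {hρ₂ : IsFacet ρ τ₂} (hne : τ₁ ≠ τ₂)
    (D : DiamondData h₁ h₂ hρ₁ hρ₂) (f : F.relCone σ →ₗ[Poly (lin σ)] Poly (lin σ))
    {g : F.relCone ρ} {s : F.sections Set.univ} (hs : s.1 ⟨ρ, trivial⟩ = g.1)
    (hs0 : ∀ κ : Δ.Cone, ¬ ρ ≤ κ → s.1 ⟨κ, trivial⟩ = 0) :
    ∃ hm : SymmetricAlgebra.ι ℝ _ (facetForm h₁) • SymmetricAlgebra.ι ℝ _ (facetForm h₂) •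
        s.1 ⟨σ, trivial⟩ ∈ F.relCone σ,
      (facetForm h₂ (linIncl h₁.1 D.v₁) / facetForm hρ₁ D.v₁) •
        phi hF (isFacetForm_facetForm hρ₁) (phi hF (isFacetForm_facetForm h₁) f) g =
      polyRes (linIncl (hρ₁.1.trans h₁.1)) (f ⟨_, hm⟩) := by
  set c := facetForm h₂ (linIncl h₁.1 D.v₁) / facetForm hρ₁ D.v₁ with hc
  have e1 := isExt_of_section hρ₁ hs hs0
  let g₁ : F.relCone τ₁ := ⟨_, e1.smul_mem (isFacetForm_facetForm hρ₁)⟩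
  -- on `τ₁` the form of `τ₂` is `c` times that of `ρ`, so `h₂ ĝ` extends `c h_ρ ĝ|τ₁`
  have hK : F.IsExt h₁ (algebraMap ℝ (Poly (lin τ₁)) c • g₁)
      (SymmetricAlgebra.ι ℝ _ (facetForm h₂) • s.1 ⟨σ, trivial⟩) := by
    refine ⟨?_, fun κ hκ hne' => ?_⟩
    · rw [F.res_smul, polyRes_ι, s.2 ⟨σ, trivial⟩ ⟨τ₁, trivial⟩ h₁.1,
        facetForm_smul_dualMap h₁ h₂ hρ₁ hρ₂.1 D.pos₁'.ne', map_smul, Algebra.smul_def, mul_smul]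
      rfl
    · rw [F.res_smul, polyRes_ι, s.2 ⟨σ, trivial⟩ ⟨κ, trivial⟩ hκ.le]
      by_cases hρκ : ρ ≤ κ
      · have hκ₂ : κ ≤ τ₂ := by
          rcases hρκ.eq_or_lt with rfl | hlt
          · exact hρ₂.1
          · exact ((eq_or_eq_of_lt_of_lt h₁ h₂ hρ₁ hρ₂ hne hlt hκ).resolve_left hne').le
        rw [dualMap_eq_zero_of_le h₂ hκ₂, map_zero, zero_smul]
      · rw [hs0 κ hρκ, smul_zero]
  refine ⟨hK.smul_mem (isFacetForm_facetForm h₁), ?_⟩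
  rw [phi_apply hF _ _ e1, ← map_smul, Algebra.smul_def, ← smul_eq_mul, ← map_smul,
    phi_apply hF _ _ hK, polyRes_comp]
  rfl

theorem neg_smul_tmul_eq_smul_tmul {M N : Type*} [AddCommGroup M] [Module ℝ M] [AddCommGroup N]
    [Module ℝ N] {x₁ x₂ : M} {y₁ y₂ : N} {a₁ a₂ b₁ b₂ : ℝ} (ha₁ : 0 < a₁) (ha₂ : 0 < a₂) (hb₁ : 0 < b₁)
    (hb₂ : 0 < b₂) (hx : (a₁ / b₁) • x₁ = (a₂ / b₂) • x₂)
    (hy : (a₂ * b₁) • y₁ = -((a₁ * b₂) • y₂)) (r : ℝ) :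
    (-r) • (x₁ ⊗ₜ[ℝ] y₁) = r • (x₂ ⊗ₜ[ℝ] y₂) := by
  have hx₁ : x₁ = (b₁ / a₁ * (a₂ / b₂)) • x₂ := by
    rw [mul_smul, ← hx, smul_smul, div_mul_div_cancel₀ ha₁.ne', div_self hb₁.ne', one_smul]
  have hy₁ : y₁ = (-(a₁ * b₂) / (a₂ * b₁)) • y₂ := by
    rw [div_eq_inv_mul, mul_smul, neg_smul, ← hy, smul_smul, inv_mul_cancel₀ (by positivity),
      one_smul]
  rw [hx₁, hy₁, TensorProduct.smul_tmul_smul, smul_smul]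
  congr 1
  field_simp

theorem phi_phi_smul_eq (hF : F.IsFlabby) {ρ τ₁ τ₂ σ : Δ.Cone} {h₁ : IsFacet τ₁ σ}
    {h₂ : IsFacet τ₂ σ} {hρ₁ : IsFacet ρ τ₁} {hρ₂ : IsFacet ρ τ₂} (hne : τ₁ ≠ τ₂)
    (D : DiamondData h₁ h₂ hρ₁ hρ₂) (f : F.relCone σ →ₗ[Poly (lin σ)] Poly (lin σ)) :
    (facetForm h₂ (linIncl h₁.1 D.v₁) / facetForm hρ₁ D.v₁) •
        phi hF (isFacetForm_facetForm hρ₁) (phi hF (isFacetForm_facetForm h₁) f) =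
      (facetForm h₁ (linIncl h₂.1 D.v₂) / facetForm hρ₂ D.v₂) •
        phi hF (isFacetForm_facetForm hρ₂) (phi hF (isFacetForm_facetForm h₂) f) := by
  refine LinearMap.ext fun g => ?_
  obtain ⟨s, hs, hs0⟩ := hF.exists_section g
  obtain ⟨m₁, e₁⟩ := phi_phi_apply hF hne D f hs hs0
  obtain ⟨m₂, e₂⟩ := phi_phi_apply hF (Ne.symm hne)
    (⟨D.v₂, D.v₁, D.pos₂, D.pos₁, D.pos₂', D.pos₁'⟩ : DiamondData h₂ h₁ hρ₂ hρ₁) f hs hs0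
  rw [LinearMap.smul_apply, LinearMap.smul_apply, e₁]
  refine Eq.trans ?_ e₂.symm
  congr 2
  exact Subtype.ext (smul_comm _ _ _)

/-- The restriction maps of the dual sheaf along the two chains between cones of codimension two
agree: exchanging the chains changes the sign of `ψ_h ∘ ψ_h'` and that of the product of the
transition coefficients. -/
theorem dualRes_dualRes (o : Δ.Orientation) (hF : F.IsFlabby) {ρ τ₁ τ₂ σ : Δ.Cone}
    (h₁ : IsFacet τ₁ σ) (h₂ : IsFacet τ₂ σ) (hρ₁ : IsFacet ρ τ₁) (hρ₂ : IsFacet ρ τ₂)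
    (t : F.DualObj σ) :
    dualRes o hF hρ₁ (dualRes o hF h₁ t) = dualRes o hF hρ₂ (dualRes o hF h₂ t) := by
  by_cases hne : τ₁ = τ₂
  · subst hne
    rfl
  obtain ⟨D⟩ := exists_diamondData h₁ h₂ hρ₁ hρ₂ hne
  induction t using TensorProduct.induction_on with
  | zero => simp only [map_zero]
  | add x y hx hy => simp only [map_add, hx, hy]
  | tmul f ω =>
    simp only [dualRes, LinearMap.smul_apply, TensorProduct.map_tmul, map_smul]
    rw [smul_smul, smul_smul, o.sign_mul_sign h₁ h₂ hρ₁ hρ₂ hne]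
    exact neg_smul_tmul_eq_smul_tmul D.pos₁ D.pos₂ D.pos₁' D.pos₂' (phi_phi_smul_eq hF hne D f)
      (D.psi_psi_eq ω) _

/-- Over a common facet of two full-dimensional cones, compatibility of sections of the
dual sheaf means that the maps `φ_h`, for one linear form `h` on `V`, add up to zero. -/
theorem dualRes_tmul_detRes_eq_iff (o : Δ.Orientation) (hF : F.IsFlabby) {τ σ σ' : Δ.Cone}
    (hf : IsFacet τ σ) (hf' : IsFacet τ σ') (hσ : dim σ = Module.finrank ℝ V)
    (hσ' : dim σ' = Module.finrank ℝ V) (hne : σ ≠ σ') {ω : DetDual V} (hω : detRes σ hσ ω ≠ 0)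
    (f : F.relCone σ →ₗ[Poly (lin σ)] Poly (lin σ))
    (f' : F.relCone σ' →ₗ[Poly (lin σ')] Poly (lin σ')) {c : ℝ}
    (hcf : facetFormExt hf' = -c • facetFormExt hf) :
    dualRes o hF hf (f ⊗ₜ[ℝ] detRes σ hσ ω) = dualRes o hF hf' (f' ⊗ₜ[ℝ] detRes σ' hσ' ω) ↔
      c • phi hF (isFacetForm_facetForm hf) f = phi hF (isFacetForm_facetForm hf') f' := by
  obtain ⟨q, hq⟩ := exists_relInterior σ
  have hq := (facetFormExt_pos_of_isRelInterior hf hq).ne'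
  have key := facetFormExt_smul_psi_detRes hf hf' hσ hσ' ω q
  rw [hcf, LinearMap.smul_apply, smul_eq_mul, mul_comm, mul_smul] at key
  have key := smul_right_injective _ hq key
  simp only [dualRes, LinearMap.smul_apply, TensorProduct.map_tmul]
  have hpsi := psi_ne_zero (isFacetForm_facetForm hf') (ω := detRes σ' hσ' ω) (by
    intro h0
    rw [h0, map_zero, smul_zero] at key
    exact psi_ne_zero _ hω key)
  rw [key, o.sign_eq_neg hf hf' hσ hσ' hne, TensorProduct.tmul_smul, smul_smul, neg_mul_neg,
    mul_smul]
  have hs : o.sign hf' ≠ 0 := by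
    rcases o.sign_eq_one_or hf' with h | h <;> rw [h] <;> norm_num
  rw [(smul_right_injective _ hs).eq_iff, TensorProduct.smul_tmul']
  exact (tmul_left_injective hpsi).eq_iff

end dualRes

end FanSheaf

namespace Fan

/-! ### The walls of a fan -/

section walls

variable {V : Type u} [AddCommGroup V] [Module ℝ V] {Δ : Fan V} [FiniteDimensional ℝ V]

theorem exists_isFacet_ge_ne {ρ τ σ : Δ.Cone} (hf : IsFacet τ σ) (hρ : ρ < σ) (hne : ρ ≠ τ) :
    ∃ τ' : Δ.Cone, IsFacet τ' σ ∧ ρ ≤ τ' ∧ τ' ≠ τ := by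
  by_cases hle : ρ ≤ τ
  · obtain ⟨κ, hκ, hρκ⟩ := exists_isFacet_ge (lt_of_le_of_ne hle hne)
    obtain ⟨τ', h1, h2, h3⟩ := exists_isFacet_ne hf hκ
    exact ⟨τ', h1, hρκ.trans h2.1, h3⟩
  · obtain ⟨τ', h1, h2⟩ := exists_isFacet_ge hρ
    exact ⟨τ', h1, h2, by rintro rfl; exact hle h2⟩

theorem IsFacet.eq_of_lin_eq {τ τ' σ : Δ.Cone} (hf : IsFacet τ σ) (hf' : IsFacet τ' σ)
    (h : lin τ = lin τ') : τ = τ' :=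
  hf.eq_of_le hf' fun _ hx =>
    mem_of_mem_of_mem_lin hf'.1 (hf.1 hx) (h ▸ Submodule.subset_span hx)

/-- The identification of `V` with `V_σ` for a cone `σ` of full dimension. -/
def toLin (σ : Δ.Cone) (hσ : dim σ = Module.finrank ℝ V) : V →ₗ[ℝ] lin σ :=
  LinearMap.codRestrict (lin σ) LinearMap.id (mem_lin_of_dim_eq hσ)

theorem polyRes_subtype_toLin {σ : Δ.Cone} (hσ : dim σ = Module.finrank ℝ V) (a : Poly (lin σ)) :
    polyRes (lin σ).subtype (polyRes (toLin σ hσ) a) = a := by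
  rw [polyRes_comp]
  exact polyRes_id a

theorem polyRes_toLin_subtype {σ : Δ.Cone} (hσ : dim σ = Module.finrank ℝ V) (a : Poly V) :
    polyRes (toLin σ hσ) (polyRes (lin σ).subtype a) = a := by
  rw [polyRes_comp]
  exact polyRes_id a

theorem polyRes_subtype_toLin_of_le {τ σ : Δ.Cone} (hle : τ ≤ σ)
    (hσ : dim σ = Module.finrank ℝ V) (a : Poly (lin σ)) :
    polyRes (lin τ).subtype (polyRes (toLin σ hσ) a) = polyRes (linIncl hle) a := by
  rw [polyRes_comp]
  rfl

open Classical in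
variable (Δ) in
/-- The walls of a fan: the hyperplanes spanned by its cones of codimension one. -/
def walls : Finset (Submodule ℝ V) :=
  (Finset.univ.filter fun τ : Δ.Cone => dim τ + 1 = Module.finrank ℝ V).image lin

omit [FiniteDimensional ℝ V] in
theorem IsFacet.lin_mem_walls {τ σ : Δ.Cone} (hf : IsFacet τ σ)
    (hσ : dim σ = Module.finrank ℝ V) : lin τ ∈ Δ.walls := by
  classical
  exact Finset.mem_image_of_mem _ (Finset.mem_filter.mpr ⟨Finset.mem_univ _, hf.2.trans hσ⟩)

open Classical in
/-- A linear form with kernel `H`, and zero if there is none. -/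
def wallForm (H : Submodule ℝ V) : Module.Dual ℝ V :=
  if h : ∃ l : Module.Dual ℝ V, LinearMap.ker l = H then h.choose else 0

theorem IsFacet.ker_wallForm {τ σ : Δ.Cone} (hf : IsFacet τ σ)
    (hσ : dim σ = Module.finrank ℝ V) : LinearMap.ker (wallForm (lin τ)) = lin τ := by
  have h : ∃ l : Module.Dual ℝ V, LinearMap.ker l = lin τ :=
    ⟨facetFormExt hf, Submodule.ext fun x => facetFormExt_eq_zero_iff hf (mem_lin_of_dim_eq hσ x)⟩
  rw [wallForm, dif_pos h]
  exact h.choose_spec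

omit [FiniteDimensional ℝ V] in
theorem IsPure.exists_isFacet_of_mem_walls (hΔ : Δ.IsPure) {H : Submodule ℝ V} (hH : H ∈ Δ.walls) :
    ∃ τ σ : Δ.Cone, IsFacet τ σ ∧ dim σ = Module.finrank ℝ V ∧ lin τ = H := by
  classical
  obtain ⟨τ, hτ, rfl⟩ := Finset.mem_image.mp hH
  obtain ⟨σ, hle, hσ⟩ := hΔ τ
  exact ⟨τ, σ, ⟨hle, (Finset.mem_filter.mp hτ).2.trans hσ.symm⟩, hσ, rfl⟩

theorem IsPure.ker_wallForm (hΔ : Δ.IsPure) {H : Submodule ℝ V} (hH : H ∈ Δ.walls) :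
    LinearMap.ker (wallForm H) = H := by
  obtain ⟨τ, σ, hf, hσ, rfl⟩ := hΔ.exists_isFacet_of_mem_walls hH
  exact hf.ker_wallForm hσ

theorem IsPure.wallForm_ne_zero (hΔ : Δ.IsPure) {H : Submodule ℝ V} (hH : H ∈ Δ.walls) :
    wallForm H ≠ 0 := by
  intro h0
  have h1 := hΔ.ker_wallForm hH
  rw [h0, LinearMap.ker_zero] at h1
  obtain ⟨τ, σ, hf, hσ, rfl⟩ := hΔ.exists_isFacet_of_mem_walls hH
  have h2 : dim τ = Module.finrank ℝ V := by rw [dim, ← h1, finrank_top]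
  have := hf.2
  omega

theorem IsFacet.exists_wallForm_eq_smul {τ σ : Δ.Cone} (hf : IsFacet τ σ)
    (hσ : dim σ = Module.finrank ℝ V) : ∃ d : ℝ, wallForm (lin τ) = d • facetFormExt hf := by
  obtain ⟨q, hq⟩ := exists_relInterior σ
  have hq := (facetFormExt_pos_of_isRelInterior hf hq).ne'
  refine ⟨wallForm (lin τ) q / facetFormExt hf q, LinearMap.ext fun x => ?_⟩
  have h1 : x - (facetFormExt hf x / facetFormExt hf q) • q ∈ lin τ := by
    rw [← facetFormExt_eq_zero_iff hf (mem_lin_of_dim_eq hσ _), map_sub, map_smul, smul_eq_mul,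
      div_mul_cancel₀ _ hq, sub_self]
  rw [← hf.ker_wallForm hσ, LinearMap.mem_ker, map_sub, map_smul, smul_eq_mul, sub_eq_zero] at h1
  rw [h1, LinearMap.smul_apply, smul_eq_mul]
  ring

/-- The product of linear forms defining the hyperplanes in `S`. -/
def formProd (S : Finset (Submodule ℝ V)) : Poly V :=
  ∏ H ∈ S, SymmetricAlgebra.ι ℝ _ (wallForm H)

theorem IsPure.formProd_walls_ne_zero (hΔ : Δ.IsPure) : formProd Δ.walls ≠ 0 :=
  Finset.prod_ne_zero_iff.mpr fun _ hH h0 =>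
    hΔ.wallForm_ne_zero hH (poly_ι_injective (h0.trans (map_zero _).symm))

theorem IsFacet.polyRes_formProd {ρ τ σ : Δ.Cone} (hf : IsFacet τ σ)
    (hσ : dim σ = Module.finrank ℝ V) {S : Finset (Submodule ℝ V)} (hS : lin τ ∈ S) (hρ : ρ ≤ τ) :
    polyRes (lin ρ).subtype (formProd S) = 0 := by
  rw [formProd, map_prod, Finset.prod_eq_zero hS]
  rw [polyRes_ι]
  have : (lin ρ).subtype.dualMap (wallForm (lin τ)) = 0 := by
    ext x
    have hx : x.1 ∈ LinearMap.ker (wallForm (lin τ)) := by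
      rw [hf.ker_wallForm hσ]
      exact lin_mono hρ x.2
    exact hx
  rw [this, map_zero]

end walls

end Fan

namespace FanSheaf

/-! ### Linear forms on compactly supported sections -/

section compact

variable {V : Type u} [AddCommGroup V] [Module ℝ V] {Δ : Fan V} {F : FanSheaf.{u, w} Δ}
  [FiniteDimensional ℝ V]

theorem extendByZero_apply_self {σ : Δ.Cone} (hσ : dim σ = Module.finrank ℝ V)
    (x : F.relCone σ) : (F.extendByZero σ hσ x).1.1 ⟨σ, trivial⟩ = x.1 := by
  classical
  exact Pi.single_eq_same _ _

theorem extendByZero_apply_of_ne {σ κ : Δ.Cone} (hσ : dim σ = Module.finrank ℝ V)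
    (x : F.relCone σ) (h : κ ≠ σ) : (F.extendByZero σ hσ x).1.1 ⟨κ, trivial⟩ = 0 := by
  classical
  exact Pi.single_eq_of_ne h _

omit [FiniteDimensional ℝ V] in
theorem compactSections_ext (hΔ : Δ.IsPure) {s t : F.compactSections}
    (h : ∀ σ : Δ.Cone, dim σ = Module.finrank ℝ V →
      s.1.1 ⟨σ, trivial⟩ = t.1.1 ⟨σ, trivial⟩) : s = t := by
  refine Subtype.ext (Subtype.ext (funext fun κ => ?_))
  obtain ⟨σ, hle, hσ⟩ := hΔ κ.1
  have h1 := s.1.2 ⟨σ, trivial⟩ κ hle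
  have h2 := t.1.2 ⟨σ, trivial⟩ κ hle
  rw [← h1, ← h2, h σ hσ]

omit [FiniteDimensional ℝ V] in
theorem compactSections_apply_eq_zero (s : F.compactSections) {τ : Δ.Cone} (hτ : τ ∈ Δ.boundary) :
    s.1.1 ⟨τ, trivial⟩ = 0 :=
  congrFun (congrArg Subtype.val (LinearMap.mem_ker.mp s.2)) ⟨τ, hτ⟩

theorem extendByZero_add {σ : Δ.Cone} (hσ : dim σ = Module.finrank ℝ V) (x y : F.relCone σ) :
    F.extendByZero σ hσ (x + y) = F.extendByZero σ hσ x + F.extendByZero σ hσ y := by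
  classical
  refine Subtype.ext (Subtype.ext (funext fun κ => ?_))
  exact congrFun (Pi.single_add (f := F.obj) σ x.1 y.1) κ.1

theorem extendByZero_smul {σ : Δ.Cone} (hσ : dim σ = Module.finrank ℝ V) (a : Poly V)
    (x : F.relCone σ) :
    F.extendByZero σ hσ (polyRes (lin σ).subtype a • x) = a • F.extendByZero σ hσ x := by
  refine Subtype.ext (Subtype.ext (funext fun κ => ?_))
  obtain ⟨κ, -⟩ := κ
  change (F.extendByZero σ hσ (polyRes (lin σ).subtype a • x)).1.1 ⟨κ, trivial⟩ =
    a • (F.extendByZero σ hσ x).1.1 ⟨κ, trivial⟩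
  by_cases h : κ = σ
  · subst h
    rw [extendByZero_apply_self, extendByZero_apply_self]
    rfl
  · rw [extendByZero_apply_of_ne _ _ h, extendByZero_apply_of_ne _ _ h, smul_zero]

/-- The map `ψ ↦ ψ ∘ ext_σ` for a cone `σ` of full dimension. -/
def dualRestrict (σ : Δ.Cone) (hσ : dim σ = Module.finrank ℝ V) :
    (F.compactSections →ₗ[Poly V] Poly V) →ₗ[ℝ] (F.relCone σ →ₗ[Poly (lin σ)] Poly (lin σ)) where
  toFun ψ :=
    { toFun := fun x => polyRes (lin σ).subtype (ψ (F.extendByZero σ hσ x))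
      map_add' := fun x y => by rw [extendByZero_add, map_add, map_add]
      map_smul' := fun a x => by
        obtain ⟨b, rfl⟩ := polyRes_surjective (lin σ).subtype (lin σ).injective_subtype a
        rw [extendByZero_smul, map_smul, smul_eq_mul, map_mul, RingHom.id_apply, smul_eq_mul] }
  map_add' ψ ψ' := LinearMap.ext fun x => map_add (polyRes (lin σ).subtype) _ _
  map_smul' r ψ := LinearMap.ext fun x => map_smul (polyRes (lin σ).subtype) r _

theorem dualRestrict_apply {σ : Δ.Cone} (hσ : dim σ = Module.finrank ℝ V)
    (ψ : F.compactSections →ₗ[Poly V] Poly V) (x : F.relCone σ) :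
    dualRestrict σ hσ ψ x = polyRes (lin σ).subtype (ψ (F.extendByZero σ hσ x)) := rfl

theorem apply_extendByZero {σ : Δ.Cone} (hσ : dim σ = Module.finrank ℝ V)
    (ψ : F.compactSections →ₗ[Poly V] Poly V) (x : F.relCone σ) :
    ψ (F.extendByZero σ hσ x) = polyRes (toLin σ hσ) (dualRestrict σ hσ ψ x) := by
  rw [dualRestrict_apply, polyRes_toLin_subtype]

/-- Over a cone of full dimension, the product of the wall forms annihilates all proper faces. -/
theorem formProd_walls_smul_mem {σ : Δ.Cone} (hσ : dim σ = Module.finrank ℝ V) (x : F.obj σ) :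
    formProd Δ.walls • x ∈ F.relCone σ := by
  intro ρ hρ
  obtain ⟨τ, hf, hle⟩ := exists_isFacet_ge hρ
  rw [F.res_poly_smul, smul_eq, hf.polyRes_formProd hσ (hf.lin_mem_walls hσ) hle, zero_smul]

/-- Over a facet `τ` of a cone of full dimension, the product of the forms of the walls other than
that of `τ` annihilates all proper faces. -/
theorem formProd_erase_smul_mem {τ σ : Δ.Cone} (hf : IsFacet τ σ) (hσ : dim σ = Module.finrank ℝ V)
    (x : F.obj τ) : formProd (Δ.walls.erase (lin τ)) • x ∈ F.relCone τ := by
  intro ρ hρ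
  obtain ⟨τ', hf', hle, hne⟩ := exists_isFacet_ge_ne hf (hρ.trans hf.lt) hρ.ne
  rw [F.res_poly_smul, smul_eq, hf'.polyRes_formProd hσ (Finset.mem_erase.mpr
    ⟨fun h => hne (hf'.eq_of_lin_eq hf h), hf'.lin_mem_walls hσ⟩) hle, zero_smul]

theorem isExt_formProd_erase_smul {τ σ : Δ.Cone} (hf : IsFacet τ σ)
    (hσ : dim σ = Module.finrank ℝ V) (s : F.sections Set.univ) :
    F.IsExt hf ⟨_, formProd_erase_smul_mem hf hσ (s.1 ⟨τ, trivial⟩)⟩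
      (formProd (Δ.walls.erase (lin τ)) • s.1 ⟨σ, trivial⟩) := by
  refine ⟨?_, fun ρ hρ hne => ?_⟩
  · rw [F.res_poly_smul, s.2 ⟨σ, trivial⟩ ⟨τ, trivial⟩ hf.1]
  · obtain ⟨τ', hf', hle, hne⟩ := exists_isFacet_ge_ne hf hρ hne
    rw [F.res_poly_smul, smul_eq, hf'.polyRes_formProd hσ (Finset.mem_erase.mpr
      ⟨fun h => hne (hf'.eq_of_lin_eq hf h), hf'.lin_mem_walls hσ⟩) hle, zero_smul]

/-- The section that is `formProd Δ.walls • s` on `σ` and zero on all other cones is a part of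
`formProd Δ.walls • s`, which is the sum of these parts. -/
theorem formProd_walls_smul_eq_sum [Fintype {σ : Δ.Cone // dim σ = Module.finrank ℝ V}]
    (hΔ : Δ.IsPure) (s : F.compactSections) :
    formProd Δ.walls • s = ∑ σ : {σ : Δ.Cone // dim σ = Module.finrank ℝ V},
      F.extendByZero σ.1 σ.2 ⟨_, formProd_walls_smul_mem σ.2 (s.1.1 ⟨σ.1, trivial⟩)⟩ := by
  refine compactSections_ext hΔ fun κ hκ => ?_
  have h1 : ∀ (T : Finset {σ : Δ.Cone // dim σ = Module.finrank ℝ V})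
      (g : {σ : Δ.Cone // dim σ = Module.finrank ℝ V} → F.compactSections),
      (∑ σ ∈ T, g σ).1.1 ⟨κ, trivial⟩ = ∑ σ ∈ T, (g σ).1.1 ⟨κ, trivial⟩ := by
    classical
    intro T g
    induction T using Finset.induction_on with
    | empty => rfl
    | insert a T ha ih =>
      rw [Finset.sum_insert ha, Finset.sum_insert ha, ← ih]
      rfl
  rw [h1, Finset.sum_eq_single ⟨κ, hκ⟩ _ (fun h => (h (Finset.mem_univ _)).elim),
    extendByZero_apply_self]
  · rfl
  · intro σ _ hne
    exact extendByZero_apply_of_ne _ _ fun h => hne (Subtype.ext h.symm)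

theorem formProd_walls_mul_apply [Fintype {σ : Δ.Cone // dim σ = Module.finrank ℝ V}]
    (hΔ : Δ.IsPure) (ψ : F.compactSections →ₗ[Poly V] Poly V) (s : F.compactSections) :
    formProd Δ.walls * ψ s = ∑ σ : {σ : Δ.Cone // dim σ = Module.finrank ℝ V},
      polyRes (toLin σ.1 σ.2) (dualRestrict σ.1 σ.2 ψ
        ⟨_, formProd_walls_smul_mem σ.2 (s.1.1 ⟨σ.1, trivial⟩)⟩) := by
  rw [← smul_eq_mul, ← map_smul, formProd_walls_smul_eq_sum hΔ, map_sum]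
  exact Finset.sum_congr rfl fun σ _ => apply_extendByZero _ _ _

/-- A linear form on `F_{(Δ,∂Δ)}` is determined by its restrictions to the cones of full
dimension. -/
theorem eq_of_dualRestrict_eq (hΔ : Δ.IsPure) {ψ ψ' : F.compactSections →ₗ[Poly V] Poly V}
    (h : ∀ (σ : Δ.Cone) (hσ : dim σ = Module.finrank ℝ V),
      dualRestrict σ hσ ψ = dualRestrict σ hσ ψ') : ψ = ψ' := by
  classical
  refine LinearMap.ext fun s => mul_left_cancel₀ hΔ.formProd_walls_ne_zero ?_
  rw [formProd_walls_mul_apply hΔ, formProd_walls_mul_apply hΔ]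
  exact Finset.sum_congr rfl fun σ _ => by rw [h]

end compact

/-! ### Gluing linear forms on compactly supported sections -/

section glue

variable {V : Type u} [AddCommGroup V] [Module ℝ V] {Δ : Fan V} {F : FanSheaf.{u, w} Δ}
  [FiniteDimensional ℝ V]

/-- The value of `φ_h` for the inner facet form, computed with a multiple of that form. -/
theorem phi_smul_real (hF : F.IsFlabby) {τ σ : Δ.Cone} (hf : IsFacet τ σ) {c : ℝ}
    {l : Module.Dual ℝ (lin σ)} (hl : l = c • facetForm hf)
    (f : F.relCone σ →ₗ[Poly (lin σ)] Poly (lin σ)) {g : F.relCone τ} {k : F.obj σ}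
    (hk : F.IsExt hf g k) :
    ∃ hm : SymmetricAlgebra.ι ℝ _ l • k ∈ F.relCone σ,
      polyRes (linIncl hf.1) (f ⟨_, hm⟩) = c • phi hF (isFacetForm_facetForm hf) f g := by
  have h1 : SymmetricAlgebra.ι ℝ _ l • k =
      algebraMap ℝ (Poly (lin σ)) c • SymmetricAlgebra.ι ℝ _ (facetForm hf) • k := by
    rw [hl, map_smul, Algebra.smul_def, mul_smul]
  have hm := (F.relCone σ).smul_mem (algebraMap ℝ (Poly (lin σ)) c)
    (hk.smul_mem (isFacetForm_facetForm hf))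
  refine ⟨h1 ▸ hm, ?_⟩
  have h2 : (⟨_, h1 ▸ hm⟩ : F.relCone σ) = algebraMap ℝ (Poly (lin σ)) c •
      ⟨_, hk.smul_mem (isFacetForm_facetForm hf)⟩ := Subtype.ext h1
  rw [h2, map_smul, smul_eq_mul, map_mul, AlgHom.commutes, ← Algebra.smul_def,
    phi_apply hF _ _ hk]

theorem dualMap_subtype_facetFormExt {τ σ : Δ.Cone} (hf : IsFacet τ σ) :
    (lin σ).subtype.dualMap (facetFormExt hf) = facetForm hf :=
  LinearMap.ext fun x => facetFormExt_apply hf x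

/-- The restrictions of a linear form on `F_{(Δ,∂Δ)}` to two cones of full dimension fit together
over their common facet `τ`: if `s` is supported on the star of `τ` and `h` vanishes on `τ`, then
`h s` is the sum of sections supported on the two cones, and `ψ (h s) = h ψ s` vanishes
on `τ`. -/
theorem smul_phi_dualRestrict (hF : F.IsFlabby) (hΔ : Δ.IsPure) {τ σ σ' : Δ.Cone}
    (hf : IsFacet τ σ) (hf' : IsFacet τ σ') (hσ : dim σ = Module.finrank ℝ V)
    (hσ' : dim σ' = Module.finrank ℝ V) (hne : σ ≠ σ') {c : ℝ}
    (hcf : facetFormExt hf' = -c • facetFormExt hf)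
    (ψ : F.compactSections →ₗ[Poly V] Poly V) :
    c • phi hF (isFacetForm_facetForm hf) (dualRestrict σ hσ ψ) =
      phi hF (isFacetForm_facetForm hf') (dualRestrict σ' hσ' ψ) := by
  refine LinearMap.ext fun g => ?_
  obtain ⟨s, hs, hs0⟩ := hF.exists_section g
  have hmem : s ∈ F.compactSections := by
    refine LinearMap.mem_ker.mpr (Subtype.ext (funext fun κ => hs0 κ.1 fun hle => ?_))
    have hτ : τ ∈ Δ.boundary := by
      obtain ⟨κ', h1, h2⟩ := κ.2
      exact ⟨κ', hle.trans h1, h2⟩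
    obtain ⟨κ', -, -, h3⟩ := exists_unique_of_mem_boundary hτ (hf.2.trans hσ)
    exact hne ((h3 σ hf).trans (h3 σ' hf').symm)
  have e := isExt_of_section hf hs hs0
  have e' := isExt_of_section hf' hs hs0
  -- `l` is a form with kernel `V_τ`: a facet form on `σ'`, and `-c` times a facet form on `σ`
  set l := facetFormExt hf' with hl
  obtain ⟨m, hm⟩ := phi_smul_real hF hf (l := (lin σ).subtype.dualMap l)
    (by rw [hcf, map_smul, dualMap_subtype_facetFormExt]) (dualRestrict σ hσ ψ) e
  obtain ⟨m', hm'⟩ := phi_smul_real hF hf' (c := 1) (l := (lin σ').subtype.dualMap l)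
    (by rw [one_smul, dualMap_subtype_facetFormExt]) (dualRestrict σ' hσ' ψ) e'
  have key : SymmetricAlgebra.ι ℝ _ l • (⟨s, hmem⟩ : F.compactSections) =
      F.extendByZero σ hσ ⟨_, m⟩ + F.extendByZero σ' hσ' ⟨_, m'⟩ := by
    refine compactSections_ext hΔ fun κ hκ => ?_
    change SymmetricAlgebra.ι ℝ _ l • s.1 ⟨κ, trivial⟩ =
      (F.extendByZero σ hσ ⟨_, m⟩).1.1 ⟨κ, trivial⟩ +
        (F.extendByZero σ' hσ' ⟨_, m'⟩).1.1 ⟨κ, trivial⟩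
    by_cases h1 : κ = σ
    · subst h1
      rw [extendByZero_apply_self, extendByZero_apply_of_ne _ _ hne, add_zero, smul_eq, polyRes_ι]
    by_cases h2 : κ = σ'
    · subst h2
      rw [extendByZero_apply_self, extendByZero_apply_of_ne _ _ h1, zero_add, smul_eq, polyRes_ι]
    rw [extendByZero_apply_of_ne _ _ h1, extendByZero_apply_of_ne _ _ h2, hs0, smul_zero, add_zero]
    intro hle
    rcases eq_or_eq_of_isFacet hf hf' ⟨hle, by rw [hf.2, hσ, hκ]⟩ hσ hne with h | h
    exacts [h1 h, h2 h]
  have key2 := congrArg (polyRes (lin τ).subtype) (congrArg ψ key)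
  have h0 : (lin τ).subtype.dualMap l = 0 := LinearMap.ext fun x =>
    (facetFormExt_eq_zero_iff hf' (mem_lin_of_dim_eq hσ' _)).mpr x.2
  rw [map_smul, smul_eq_mul, map_mul, polyRes_ι, h0, map_zero, zero_mul, map_add, map_add,
    apply_extendByZero, apply_extendByZero, polyRes_subtype_toLin_of_le hf.1,
    polyRes_subtype_toLin_of_le hf'.1, hm, hm', one_smul, neg_smul] at key2
  rw [LinearMap.smul_apply]
  exact (neg_add_eq_zero.mp key2.symm)

/-- A sum whose non-zero terms cancel in pairs. -/
theorem sum_eq_zero_of_pairing {ι M : Type*} [Fintype ι] [AddCommMonoid M] {R : ι → ι → Prop}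
    (hsymm : ∀ a b, R a b → R b a) (hirr : ∀ a, ¬ R a a)
    (huniq : ∀ a b c, R a b → R a c → b = c) {f : ι → M}
    (h0 : ∀ a, (∀ b, ¬ R a b) → f a = 0) (hadd : ∀ a b, R a b → f a + f b = 0) :
    ∑ a, f a = 0 := by
  classical
  let g : ι → ι := fun a => if h : ∃ b, R a b then h.choose else a
  have hg : ∀ a b, R a b → g a = b := fun a b h => by
    have h' : ∃ b, R a b := ⟨b, h⟩
    simp only [g, dif_pos h']
    exact huniq a _ _ h'.choose_spec h
  have hg' : ∀ a, (∀ b, ¬ R a b) → g a = a := fun a h => dif_neg (not_exists.mpr h)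
  refine Finset.sum_involution (fun a _ => g a) (fun a _ => ?_) (fun a _ ha => ?_)
    (fun a _ => Finset.mem_univ _) (fun a _ => ?_)
  · by_cases h : ∃ b, R a b
    · obtain ⟨b, hb⟩ := h
      rw [hg a b hb, hadd a b hb]
    · have h := not_exists.mp h
      rw [hg' a h, h0 a h, add_zero]
  · by_cases h : ∃ b, R a b
    · obtain ⟨b, hb⟩ := h
      rw [hg a b hb]
      rintro rfl
      exact hirr _ hb
    · exact (ha (h0 a (not_exists.mp h))).elim
  · by_cases h : ∃ b, R a b
    · obtain ⟨b, hb⟩ := h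
      rw [hg a b hb, hg b a (hsymm a b hb)]
    · have h := not_exists.mp h
      rw [hg' a h, hg' a h]

theorem exists_smul_eq_of_forall_dvd {R M : Type*} [CommRing R] [IsDomain R] [AddCommGroup M]
    [Module R M] (N : M →ₗ[R] R) {p : R} (hp : p ≠ 0) (h : ∀ x, p ∣ N x) :
    ∃ ψ : M →ₗ[R] R, ∀ x, p * ψ x = N x := by
  choose f hf using h
  refine ⟨⟨⟨f, fun x y => mul_left_cancel₀ hp ?_⟩, fun a x => mul_left_cancel₀ hp ?_⟩,
    fun x => (hf x).symm⟩
  · rw [mul_add, ← hf, ← hf, ← hf, map_add]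
  · rw [RingHom.id_apply, smul_eq_mul, mul_left_comm, ← hf, ← hf, map_smul, smul_eq_mul]

omit [FiniteDimensional ℝ V] in
theorem formProd_walls_smul {H : Submodule ℝ V} (hH : H ∈ Δ.walls) {σ : Δ.Cone} (x : F.obj σ) :
    formProd Δ.walls • x = SymmetricAlgebra.ι ℝ _ ((lin σ).subtype.dualMap (wallForm H)) •
      formProd (Δ.walls.erase H) • x := by
  rw [formProd, ← Finset.mul_prod_erase _ _ hH, mul_smul, smul_eq, polyRes_ι]
  rfl

/-- If `H` is not the span of a facet of `σ`, or is the span of one on which `s` vanishes,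
then `φ (p s)` vanishes on `H`, where `p` is the product of all wall forms. -/
theorem polyRes_apply_formProd_smul_eq_zero {σ : Δ.Cone} (hσ : dim σ = Module.finrank ℝ V)
    (hΔ : Δ.IsPure) {H : Submodule ℝ V} (hH : H ∈ Δ.walls) (s : F.sections Set.univ)
    (h : ∀ τ : Δ.Cone, IsFacet τ σ → lin τ = H → s.1 ⟨τ, trivial⟩ = 0)
    (φ : F.relCone σ →ₗ[Poly (lin σ)] Poly (lin σ)) :
    polyRes H.subtype (polyRes (toLin σ hσ)
      (φ ⟨_, formProd_walls_smul_mem hσ (s.1 ⟨σ, trivial⟩)⟩)) = 0 := by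
  have hm : formProd (Δ.walls.erase H) • s.1 ⟨σ, trivial⟩ ∈ F.relCone σ := by
    intro ρ hρ
    rw [F.res_poly_smul]
    obtain ⟨τ, hf, hle⟩ := exists_isFacet_ge hρ
    by_cases hτ : lin τ = H
    · rw [s.2 ⟨σ, trivial⟩ ⟨ρ, trivial⟩ hρ.le, ← s.2 ⟨τ, trivial⟩ ⟨ρ, trivial⟩ hle, h τ hf hτ,
        map_zero, smul_zero]
    · rw [smul_eq, hf.polyRes_formProd hσ (Finset.mem_erase.mpr ⟨hτ, hf.lin_mem_walls hσ⟩) hle,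
        zero_smul]
  have e : (⟨_, formProd_walls_smul_mem hσ (s.1 ⟨σ, trivial⟩)⟩ : F.relCone σ) =
      SymmetricAlgebra.ι ℝ _ ((lin σ).subtype.dualMap (wallForm H)) • ⟨_, hm⟩ :=
    Subtype.ext (formProd_walls_smul hH _)
  have h0 : H.subtype.dualMap (wallForm H) = 0 := LinearMap.ext fun x => by
    have : x.1 ∈ LinearMap.ker (wallForm H) := by
      rw [hΔ.ker_wallForm hH]
      exact x.2
    exact this
  rw [e, map_smul, smul_eq_mul, map_mul, map_mul, ← polyRes_ι, polyRes_toLin_subtype, polyRes_ι,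
    h0, map_zero, zero_mul]

/-- If `H` is the span of the facet `τ` of `σ`, then the restriction of `φ (p s)` to `H` is a
value of `φ_h φ`. -/
theorem polyRes_apply_formProd_smul_eq (hF : F.IsFlabby) {τ σ : Δ.Cone} (hf : IsFacet τ σ)
    (hσ : dim σ = Module.finrank ℝ V) {d : ℝ} (hd : wallForm (lin τ) = d • facetFormExt hf)
    (s : F.sections Set.univ) (φ : F.relCone σ →ₗ[Poly (lin σ)] Poly (lin σ)) :
    polyRes (lin τ).subtype (polyRes (toLin σ hσ)
        (φ ⟨_, formProd_walls_smul_mem hσ (s.1 ⟨σ, trivial⟩)⟩)) =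
      d • phi hF (isFacetForm_facetForm hf) φ
        ⟨_, formProd_erase_smul_mem hf hσ (s.1 ⟨τ, trivial⟩)⟩ := by
  obtain ⟨m, hm⟩ := phi_smul_real hF hf (l := (lin σ).subtype.dualMap (wallForm (lin τ)))
    (by rw [hd, map_smul, dualMap_subtype_facetFormExt]) φ (isExt_formProd_erase_smul hf hσ s)
  rw [← hm, polyRes_subtype_toLin_of_le hf.1]
  congr 2
  exact Subtype.ext (formProd_walls_smul (hf.lin_mem_walls hσ) _)

/-- The contribution `s ↦ φ (p s)` of a cone of full dimension to the glued form, where `p` is the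
product of all wall forms. -/
def wallTerm (σ : Δ.Cone) (hσ : dim σ = Module.finrank ℝ V)
    (φ : F.relCone σ →ₗ[Poly (lin σ)] Poly (lin σ)) : F.compactSections →ₗ[Poly V] Poly V where
  toFun s := polyRes (toLin σ hσ) (φ ⟨_, formProd_walls_smul_mem hσ (s.1.1 ⟨σ, trivial⟩)⟩)
  map_add' s s' := by
    rw [← map_add, ← map_add]
    congr 2
    exact Subtype.ext (smul_add (formProd Δ.walls) (s.1.1 ⟨σ, trivial⟩) (s'.1.1 ⟨σ, trivial⟩))
  map_smul' a s := by
    rw [RingHom.id_apply, smul_eq_mul, ← polyRes_toLin_subtype hσ a, ← map_mul, ← smul_eq_mul,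
      ← map_smul, polyRes_toLin_subtype]
    congr 2
    exact Subtype.ext (smul_comm (formProd Δ.walls) a (s.1.1 ⟨σ, trivial⟩))

theorem wallTerm_extendByZero_self {σ : Δ.Cone} (hσ : dim σ = Module.finrank ℝ V)
    (φ : F.relCone σ →ₗ[Poly (lin σ)] Poly (lin σ)) (x : F.relCone σ) :
    wallTerm σ hσ φ (F.extendByZero σ hσ x) =
      formProd Δ.walls * polyRes (toLin σ hσ) (φ x) := by
  rw [← polyRes_toLin_subtype hσ (formProd Δ.walls), ← map_mul, ← smul_eq_mul, ← map_smul]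
  change polyRes (toLin σ hσ) (φ ⟨_, _⟩) = _
  congr 2
  refine Subtype.ext ?_
  change formProd Δ.walls • (F.extendByZero σ hσ x).1.1 ⟨σ, trivial⟩ = _
  rw [extendByZero_apply_self]
  rfl

theorem wallTerm_extendByZero_of_ne {σ κ : Δ.Cone} (hσ : dim σ = Module.finrank ℝ V)
    (hκ : dim κ = Module.finrank ℝ V) (φ : F.relCone κ →ₗ[Poly (lin κ)] Poly (lin κ))
    (x : F.relCone σ) (hne : κ ≠ σ) : wallTerm κ hκ φ (F.extendByZero σ hσ x) = 0 := by
  have h : (⟨_, formProd_walls_smul_mem hκ ((F.extendByZero σ hσ x).1.1 ⟨κ, trivial⟩)⟩ :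
      F.relCone κ) = 0 := Subtype.ext <| by
    change formProd Δ.walls • (F.extendByZero σ hσ x).1.1 ⟨κ, trivial⟩ = 0
    rw [extendByZero_apply_of_ne _ _ hne, smul_zero]
  change polyRes (toLin κ hκ) (φ ⟨_, _⟩) = 0
  rw [h, map_zero, map_zero]

/-- Linear forms on the modules `F_{(σ,∂σ)}`, for the cones `σ` of full dimension, that fit
together over the common facets glue to a linear form on `F_{(Δ,∂Δ)}`. With `p` the product of all
wall forms, the glued form has to be `p⁻¹ ∑ φ_σ (p s)`; the sum is divisible by every wall form,
since the contributions of the cones on the two sides of the wall cancel there. -/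
theorem exists_dualRestrict_eq (hF : F.IsFlabby) (hΔ : Δ.IsPure)
    (φ : ∀ σ : Δ.Cone, F.relCone σ →ₗ[Poly (lin σ)] Poly (lin σ))
    (hφ : ∀ {τ σ σ' : Δ.Cone} (hf : IsFacet τ σ) (hf' : IsFacet τ σ'),
      dim σ = Module.finrank ℝ V → dim σ' = Module.finrank ℝ V → σ ≠ σ' → ∀ c : ℝ,
      facetFormExt hf' = -c • facetFormExt hf →
      c • phi hF (isFacetForm_facetForm hf) (φ σ) = phi hF (isFacetForm_facetForm hf') (φ σ')) :
    ∃ ψ : F.compactSections →ₗ[Poly V] Poly V,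
      ∀ (σ : Δ.Cone) (hσ : dim σ = Module.finrank ℝ V), dualRestrict σ hσ ψ = φ σ := by
  classical
  let T := {σ : Δ.Cone // dim σ = Module.finrank ℝ V}
  obtain ⟨ψ, hψ⟩ := exists_smul_eq_of_forall_dvd
    (∑ σ : T, wallTerm (F := F) σ.1 σ.2 (φ σ.1)) hΔ.formProd_walls_ne_zero
    fun s : F.compactSections => by
    refine prod_ι_dvd_of_polyRes_eq_zero (fun H hH => hΔ.ker_wallForm hH)
      (fun H hH => hΔ.wallForm_ne_zero hH) fun H hH => ?_
    rw [LinearMap.sum_apply, map_sum]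
    -- the non-zero terms cancel in pairs of cones with a common facet that spans `H`
    refine sum_eq_zero_of_pairing (R := fun σ σ' : T => σ ≠ σ' ∧ ∃ τ : Δ.Cone,
      lin τ = H ∧ IsFacet τ σ.1 ∧ IsFacet τ σ'.1) ?_ ?_ ?_ ?_ ?_
    · rintro a b ⟨h1, τ, h2, h3, h4⟩
      exact ⟨h1.symm, τ, h2, h4, h3⟩
    · rintro a ⟨h, -⟩
      exact h rfl
    · rintro a b c ⟨h1, τ, h2, h3, h4⟩ ⟨h1', τ', h2', h3', h4'⟩
      obtain rfl := h3.eq_of_lin_eq h3' (h2.trans h2'.symm)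
      rcases eq_or_eq_of_isFacet h3 h4 h4' a.2 (fun h => h1 (Subtype.ext h)) with h | h
      · exact (h1' (Subtype.ext h.symm)).elim
      · exact (Subtype.ext h.symm)
    · intro σ h
      refine polyRes_apply_formProd_smul_eq_zero σ.2 hΔ hH s.1 (fun τ hf hτ => ?_) _
      refine compactSections_apply_eq_zero s (mem_boundary_of_unique hf σ.2 fun σ' hf' => ?_)
      by_contra hne
      exact h ⟨σ', by rw [← hf'.2, hf.2, σ.2]⟩
        ⟨fun he => hne (congrArg Subtype.val he).symm, τ, hτ, hf, hf'⟩
    · rintro ⟨σ, hσ⟩ ⟨σ', hσ'⟩ ⟨hne, τ, rfl, hf, hf'⟩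
      have hne : σ ≠ σ' := fun h => hne (Subtype.ext h)
      obtain ⟨c, -, hcf⟩ := exists_facetFormExt_eq_neg_smul hf hf' hσ hσ' hne
      obtain ⟨d, hd⟩ := hf'.exists_wallForm_eq_smul hσ'
      have hd' : wallForm (lin τ) = (-(d * c)) • facetFormExt hf := by
        rw [hd, hcf, smul_smul, mul_neg]
      refine (congrArg₂ (· + ·) (polyRes_apply_formProd_smul_eq hF hf hσ hd' s.1 (φ σ))
        (polyRes_apply_formProd_smul_eq hF hf' hσ' hd s.1 (φ σ'))).trans ?_
      rw [← hφ hf hf' hσ hσ' hne c hcf, LinearMap.smul_apply, smul_smul, neg_smul]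
      exact neg_add_cancel _
  refine ⟨ψ, fun σ hσ => LinearMap.ext fun x => ?_⟩
  have h1 : formProd Δ.walls * ψ (F.extendByZero σ hσ x) =
      formProd Δ.walls * polyRes (toLin σ hσ) (φ σ x) := by
    rw [hψ, LinearMap.sum_apply, Finset.sum_eq_single ⟨σ, hσ⟩ _
      (fun h => (h (Finset.mem_univ _)).elim), wallTerm_extendByZero_self]
    intro κ _ hne
    exact wallTerm_extendByZero_of_ne _ _ _ _ fun h => hne (Subtype.ext h)
  rw [dualRestrict_apply, mul_left_cancel₀ hΔ.formProd_walls_ne_zero h1, polyRes_subtype_toLin]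

end glue

/-! ### Global sections of the dual sheaf -/

section equiv

variable {V : Type u} [AddCommGroup V] [Module ℝ V] {Δ : Fan V} [FiniteDimensional ℝ V]

theorem detRes_ne_zero {σ : Δ.Cone} (hσ : dim σ = Module.finrank ℝ V) {ω : DetDual V}
    (hω : ω ≠ 0) : detRes σ hσ ω ≠ 0 := by
  intro h
  refine hω (AlternatingMap.ext fun v => ?_)
  exact DFunLike.congr_fun h fun i => toLin σ hσ (v (Fin.cast hσ i))

variable {F : FanSheaf.{u, w} Δ}

theorem tensorMap_smul {A B M M' N N' : Type*} [Semiring A]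
    [Algebra ℝ A] [Semiring B] [Algebra ℝ B] [AddCommGroup M] [Module ℝ M] [Module A M]
    [IsScalarTower ℝ A M] [AddCommGroup M'] [Module ℝ M'] [Module B M'] [IsScalarTower ℝ B M']
    [AddCommGroup N] [Module ℝ N] [AddCommGroup N'] [Module ℝ N'] (f : M →ₗ[ℝ] M')
    (g : N →ₗ[ℝ] N') (a : A) (b : B) (h : ∀ m, f (a • m) = b • f m) (t : M ⊗[ℝ] N) :
    TensorProduct.map f g (a • t) = b • TensorProduct.map f g t := by
  induction t using TensorProduct.induction_on with
  | zero => rw [smul_zero, map_zero, smul_zero]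
  | add x y hx hy => rw [smul_add, map_add, map_add, hx, hy, smul_add]
  | tmul m n =>
    rw [TensorProduct.smul_tmul', TensorProduct.map_tmul, TensorProduct.map_tmul,
      TensorProduct.smul_tmul', h]

theorem dualRestrict_smul {σ : Δ.Cone} (hσ : dim σ = Module.finrank ℝ V) (a : Poly V)
    (ψ : F.compactSections →ₗ[Poly V] Poly V) :
    dualRestrict σ hσ (a • ψ) = polyRes (lin σ).subtype a • dualRestrict σ hσ ψ := by
  refine LinearMap.ext fun x => ?_
  rw [dualRestrict_apply, LinearMap.smul_apply, LinearMap.smul_apply, smul_eq_mul, map_mul,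
    dualRestrict_apply, smul_eq_mul]

/-- The restriction `ψ ⊗ ω ↦ (ψ ∘ ext_σ) ⊗ ω` to a cone of full dimension. -/
def evalTop (σ : Δ.Cone) (hσ : dim σ = Module.finrank ℝ V) :
    F.GlobalDual →ₗ[Poly V] F.DualObj σ where
  toFun := TensorProduct.map (dualRestrict σ hσ) (detRes σ hσ)
  map_add' := map_add _
  map_smul' a t := tensorMap_smul _ _ a _ (dualRestrict_smul hσ a) t

theorem evalTop_tmul {σ : Δ.Cone} (hσ : dim σ = Module.finrank ℝ V)
    (ψ : F.compactSections →ₗ[Poly V] Poly V) (ω : DetDual V) :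
    evalTop σ hσ (ψ ⊗ₜ[ℝ] ω) = dualRestrict σ hσ ψ ⊗ₜ[ℝ] detRes σ hσ ω := rfl

theorem eq_of_evalTop_eq (hΔ : Δ.IsPure) {t t' : F.GlobalDual}
    (h : ∀ (σ : Δ.Cone) (hσ : dim σ = Module.finrank ℝ V), evalTop σ hσ t = evalTop σ hσ t') :
    t = t' := by
  obtain ⟨ω, hω⟩ := DetDual.exists_ne_zero V
  obtain ⟨ψ, rfl⟩ := exists_eq_tmul hω t
  obtain ⟨ψ', rfl⟩ := exists_eq_tmul hω t'
  exact congrArg (· ⊗ₜ[ℝ] ω)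
    (eq_of_dualRestrict_eq hΔ fun σ hσ => tmul_left_injective (detRes_ne_zero hσ hω) (h σ hσ))

theorem dualSections_ext (hΔ : Δ.IsPure) {o : Δ.Orientation} {hF : F.IsFlabby}
    {s s' : dualSections o hF}
    (h : ∀ σ : Δ.Cone, dim σ = Module.finrank ℝ V → s.1 σ = s'.1 σ) : s = s' := by
  refine Subtype.ext (funext fun κ => ?_)
  refine hΔ.induction (P := fun κ => s.1 κ = s'.1 κ) h (fun τ σ hf hσ => ?_) κ
  rw [← s.2 τ σ hf, ← s'.2 τ σ hf, hσ]

/-- The family of the `(ψ ∘ ext_σ) ⊗ ω` on the cones of full dimension extends to a global section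
of the dual sheaf. -/
theorem exists_dualSections_eq_evalTop (hΔ : Δ.IsQuasiConvex) (o : Δ.Orientation)
    (hF : F.IsFlabby) (t : F.GlobalDual) :
    ∃ s : dualSections o hF, ∀ (σ : Δ.Cone) (hσ : dim σ = Module.finrank ℝ V),
      s.1 σ = evalTop σ hσ t := by
  classical
  obtain ⟨ω, hω⟩ := DetDual.exists_ne_zero V
  obtain ⟨ψ, rfl⟩ := exists_eq_tmul hω t
  obtain ⟨s, hs, hs'⟩ := hΔ.exists_compatible (X := fun σ => F.DualObj σ)
    (fun hf => dualRes o hF hf)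
    (fun h h' hρ hρ' x => dualRes_dualRes o hF h h' hρ hρ' x)
    (fun σ => if hσ : dim σ = Module.finrank ℝ V then evalTop σ hσ (ψ ⊗ₜ[ℝ] ω) else 0) (by
      intro τ σ σ' hf hf' hσ
      by_cases hne : σ = σ'
      · subst hne
        rfl
      have hσ' : dim σ' = Module.finrank ℝ V := by rw [← hf'.2, hf.2, hσ]
      obtain ⟨c, -, hcf⟩ := exists_facetFormExt_eq_neg_smul hf hf' hσ hσ' hne
      rw [dif_pos hσ, dif_pos hσ', evalTop_tmul, evalTop_tmul,
        dualRes_tmul_detRes_eq_iff o hF hf hf' hσ hσ' hne (detRes_ne_zero hσ hω) _ _ hcf]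
      exact smul_phi_dualRestrict hF hΔ.1 hf hf' hσ hσ' hne hcf ψ)
  exact ⟨⟨s, hs'⟩, fun σ hσ => (hs σ hσ).trans (dif_pos hσ)⟩

theorem exists_evalTop_eq_dualSections (hΔ : Δ.IsPure) (o : Δ.Orientation)
    (hF : F.IsFlabby) (s : dualSections o hF) :
    ∃ t : F.GlobalDual, ∀ (σ : Δ.Cone) (hσ : dim σ = Module.finrank ℝ V),
      evalTop σ hσ t = s.1 σ := by
  classical
  obtain ⟨ω, hω⟩ := DetDual.exists_ne_zero V
  have h1 : ∀ σ : Δ.Cone, ∃ φ : F.relCone σ →ₗ[Poly (lin σ)] Poly (lin σ),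
      ∀ hσ : dim σ = Module.finrank ℝ V, s.1 σ = φ ⊗ₜ[ℝ] detRes σ hσ ω := by
    intro σ
    by_cases hσ : dim σ = Module.finrank ℝ V
    · obtain ⟨φ, hφ⟩ := exists_eq_tmul (detRes_ne_zero hσ hω) (s.1 σ)
      exact ⟨φ, fun _ => hφ⟩
    · exact ⟨0, fun h => (hσ h).elim⟩
  choose φ hφ using h1
  obtain ⟨ψ, hψ⟩ := exists_dualRestrict_eq hF hΔ φ (by
    intro τ σ σ' hf hf' hσ hσ' hne c hcf
    rw [← dualRes_tmul_detRes_eq_iff o hF hf hf' hσ hσ' hne (detRes_ne_zero hσ hω) _ _ hcf,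
      ← hφ σ hσ, ← hφ σ' hσ', s.2 τ σ hf, s.2 τ σ' hf'])
  exact ⟨ψ ⊗ₜ[ℝ] ω, fun σ hσ => by rw [evalTop_tmul, hψ, hφ σ hσ]⟩

theorem exists_linearEquiv_of_range_eq {R M N X : Type*} [Semiring R] [AddCommMonoid M]
    [Module R M] [AddCommMonoid N] [Module R N] [AddCommMonoid X] [Module R X] {f : M →ₗ[R] X} {g : N →ₗ[R] X}
    (hf : Function.Injective f) (hg : Function.Injective g)
    (h : LinearMap.range f = LinearMap.range g) : ∃ e : M ≃ₗ[R] N, ∀ m, g (e m) = f m := by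
  refine ⟨(LinearEquiv.ofInjective f hf).trans ((LinearEquiv.ofEq _ _ h).trans
    (LinearEquiv.ofInjective g hg).symm), fun m => ?_⟩
  have := LinearEquiv.apply_symm_apply (LinearEquiv.ofInjective g hg)
    (LinearEquiv.ofEq _ _ h (LinearEquiv.ofInjective f hf m))
  exact congrArg Subtype.val this

theorem exists_dualEquiv (hΔ : Δ.IsQuasiConvex) (o : Δ.Orientation) (hF : F.IsFlabby) :
    ∃ e : dualSections o hF ≃ₗ[Poly V] F.GlobalDual,
      ∀ (s : dualSections o hF) (σ : Δ.Cone) (hσ : dim σ = Module.finrank ℝ V),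
        evalTop σ hσ (e s) = s.1 σ := by
  let R : dualSections o hF →ₗ[Poly V]
      ∀ σ : {σ : Δ.Cone // dim σ = Module.finrank ℝ V}, F.DualObj σ.1 :=
    LinearMap.pi fun σ => LinearMap.proj σ.1 ∘ₗ (dualSections o hF).subtype
  let E : F.GlobalDual →ₗ[Poly V]
      ∀ σ : {σ : Δ.Cone // dim σ = Module.finrank ℝ V}, F.DualObj σ.1 :=
    LinearMap.pi fun σ => evalTop σ.1 σ.2
  have hR : Function.Injective R := fun s s' h =>
    dualSections_ext hΔ.1 fun σ hσ => congrFun h ⟨σ, hσ⟩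
  have hE : Function.Injective E := fun t t' h =>
    eq_of_evalTop_eq hΔ.1 fun σ hσ => congrFun h ⟨σ, hσ⟩
  have hrange : LinearMap.range R = LinearMap.range E := by
    refine le_antisymm ?_ ?_
    · rintro _ ⟨s, rfl⟩
      obtain ⟨t, ht⟩ := exists_evalTop_eq_dualSections hΔ.1 o hF s
      exact ⟨t, funext fun σ => ht σ.1 σ.2⟩
    · rintro _ ⟨t, rfl⟩
      obtain ⟨s, hs⟩ := exists_dualSections_eq_evalTop hΔ o hF t
      exact ⟨s, funext fun σ => hs σ.1 σ.2⟩
  obtain ⟨e, he⟩ := exists_linearEquiv_of_range_eq hR hE hrange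
  exact ⟨e, fun s σ hσ => congrFun (he s) ⟨σ, hσ⟩⟩

/-- The isomorphism `(DF)_Δ ≅ Hom(F_{(Δ,∂Δ)}, A) ⊗ det V^*`, characterized by its values on the
cones of full dimension. -/
def dualEquiv (hΔ : Δ.IsQuasiConvex) (o : Δ.Orientation) (hF : F.IsFlabby) :
    dualSections o hF ≃ₗ[Poly V] F.GlobalDual :=
  (exists_dualEquiv hΔ o hF).choose

theorem evalTop_dualEquiv (hΔ : Δ.IsQuasiConvex) (o : Δ.Orientation) (hF : F.IsFlabby)
    (s : dualSections o hF) {σ : Δ.Cone} (hσ : dim σ = Module.finrank ℝ V) :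
    evalTop σ hσ (dualEquiv hΔ o hF s) = s.1 σ :=
  (exists_dualEquiv hΔ o hF).choose_spec s σ hσ

theorem dualEquiv_symm_apply (hΔ : Δ.IsQuasiConvex) (o : Δ.Orientation) (hF : F.IsFlabby)
    (t : F.GlobalDual) {σ : Δ.Cone} (hσ : dim σ = Module.finrank ℝ V) :
    ((dualEquiv hΔ o hF).symm t).1 σ = evalTop σ hσ t := by
  rw [← evalTop_dualEquiv hΔ o hF _ hσ, LinearEquiv.apply_symm_apply]

end equiv

/-! ### Naturality -/

section naturality

variable {V : Type u} [AddCommGroup V] [Module ℝ V] {Δ : Fan V} [FiniteDimensional ℝ V]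
  {F G : FanSheaf.{u, w} Δ}

theorem Hom.phi_lcomp (f : Hom F G) (hF : F.IsFlabby) (hG : G.IsFlabby) {τ σ : Δ.Cone}
    {hf : IsFacet τ σ} {h : Module.Dual ℝ (lin σ)} (hh : IsFacetForm h hf)
    (φ : G.relCone σ →ₗ[Poly (lin σ)] Poly (lin σ)) :
    phi hF hh (φ ∘ₗ f.relCone σ) = phi hG hh φ ∘ₗ f.relCone τ := by
  refine LinearMap.ext fun g => ?_
  obtain ⟨k, hk⟩ := hF.exists_isExt hf g
  have hk' : G.IsExt hf (f.relCone τ g) (f.app σ k) := by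
    refine ⟨?_, fun ρ hρ hne => ?_⟩
    · rw [← f.app_res, hk.1]
      rfl
    · rw [← f.app_res, hk.2 ρ hρ hne, map_zero]
  rw [phi_apply hF hh _ hk, LinearMap.comp_apply, LinearMap.comp_apply, phi_apply hG hh _ hk']
  congr 2
  exact Subtype.ext (map_smul (f.app σ) _ _)

theorem Hom.dualRes_dualObj (f : Hom F G) (o : Δ.Orientation) (hF : F.IsFlabby) (hG : G.IsFlabby)
    {τ σ : Δ.Cone} (hf : IsFacet τ σ) (t : G.DualObj σ) :
    dualRes o hF hf (f.dualObj σ t) = f.dualObj τ (dualRes o hG hf t) := by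
  induction t using TensorProduct.induction_on with
  | zero => simp only [map_zero]
  | add x y hx hy => simp only [map_add, hx, hy]
  | tmul φ ω =>
    simp only [dualRes, LinearMap.smul_apply, map_smul]
    congr 1
    exact congrArg (· ⊗ₜ[ℝ] psi (isFacetForm_facetForm hf) ω) (f.phi_lcomp hF hG _ φ)

theorem Hom.compactSections_extendByZero (f : Hom F G) {σ : Δ.Cone}
    (hσ : dim σ = Module.finrank ℝ V) (x : F.relCone σ) :
    f.compactSections (F.extendByZero σ hσ x) = G.extendByZero σ hσ (f.relCone σ x) := by
  refine Subtype.ext (Subtype.ext (funext fun κ => ?_))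
  obtain ⟨κ, -⟩ := κ
  change f.app κ ((F.extendByZero σ hσ x).1.1 ⟨κ, trivial⟩) = _
  by_cases h : κ = σ
  · subst h
    rw [extendByZero_apply_self, extendByZero_apply_self]
    rfl
  · rw [extendByZero_apply_of_ne _ _ h, extendByZero_apply_of_ne _ _ h, map_zero]

theorem Hom.evalTop_globalDual (f : Hom F G) {σ : Δ.Cone} (hσ : dim σ = Module.finrank ℝ V)
    (t : G.GlobalDual) : evalTop σ hσ (f.globalDual t) = f.dualObj σ (evalTop σ hσ t) := by
  induction t using TensorProduct.induction_on with
  | zero => simp only [map_zero]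
  | add x y hx hy => simp only [map_add, hx, hy]
  | tmul ψ ω =>
    refine congrArg (· ⊗ₜ[ℝ] detRes σ hσ ω) (LinearMap.ext fun x => ?_)
    exact congrArg (fun s => polyRes (lin σ).subtype (ψ s)) (f.compactSections_extendByZero hσ x)

theorem Hom.dualEquiv_symm_globalDual (f : Hom F G) (hΔ : Δ.IsQuasiConvex) (o : Δ.Orientation)
    (hF : F.IsFlabby) (hG : G.IsFlabby) (t : G.GlobalDual) (σ : Δ.Cone) :
    ((dualEquiv hΔ o hF).symm (f.globalDual t)).1 σ =
      f.dualObj σ (((dualEquiv hΔ o hG).symm t).1 σ) := by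
  refine hΔ.1.induction (P := fun σ => ((dualEquiv hΔ o hF).symm (f.globalDual t)).1 σ =
    f.dualObj σ (((dualEquiv hΔ o hG).symm t).1 σ)) (fun σ hσ => ?_) (fun τ σ hf h => ?_) σ
  · rw [dualEquiv_symm_apply _ _ _ _ hσ, dualEquiv_symm_apply _ _ _ _ hσ, f.evalTop_globalDual]
  · rw [← ((dualEquiv hΔ o hF).symm (f.globalDual t)).2 τ σ hf, h, f.dualRes_dualObj o hF hG,
      ((dualEquiv hΔ o hG).symm t).2 τ σ hf]

end naturality

/-! ### Degrees -/

section degrees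

theorem tmul_mem_span_iff {W : Type*} [AddCommGroup W] [Module ℝ W] [FiniteDimensional ℝ W]
    {M : Type*} [AddCommGroup M] [Module ℝ M] (N : Submodule ℝ M) {ω : DetDual W} (hω : ω ≠ 0)
    {m : M} : m ⊗ₜ[ℝ] ω ∈ Submodule.span ℝ
      {t : M ⊗[ℝ] DetDual W | ∃ (f : M) (η : DetDual W), f ∈ N ∧ t = f ⊗ₜ[ℝ] η} ↔ m ∈ N := by
  refine ⟨fun h => ?_, fun h => Submodule.subset_span ⟨m, ω, h, rfl⟩⟩
  have key : ∀ t ∈ Submodule.span ℝ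
      {t : M ⊗[ℝ] DetDual W | ∃ (f : M) (η : DetDual W), f ∈ N ∧ t = f ⊗ₜ[ℝ] η},
      ∃ f ∈ N, t = f ⊗ₜ[ℝ] ω := by
    intro t ht
    induction ht using Submodule.span_induction with
    | mem t ht =>
      obtain ⟨f, η, hf, rfl⟩ := ht
      obtain ⟨c, rfl⟩ := DetDual.exists_eq_smul hω η
      exact ⟨c • f, N.smul_mem c hf, (TensorProduct.smul_tmul c f ω).symm⟩
    | zero => exact ⟨0, N.zero_mem, (TensorProduct.zero_tmul _ _).symm⟩
    | add x y _ _ hx hy =>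
      obtain ⟨a, ha, rfl⟩ := hx
      obtain ⟨b, hb, rfl⟩ := hy
      exact ⟨a + b, N.add_mem ha hb, (TensorProduct.add_tmul _ _ _).symm⟩
    | smul r x _ hx =>
      obtain ⟨a, ha, rfl⟩ := hx
      exact ⟨r • a, N.smul_mem r ha, rfl⟩
  obtain ⟨f, hf, he⟩ := key _ h
  rwa [tmul_left_injective hω he]

variable {V : Type u} [AddCommGroup V] [Module ℝ V] {Δ : Fan V} (F : FanSheaf.{u, w} Δ)

/-- The linear forms `F_{(σ,∂σ)} → S(V_σ^*)` that are homogeneous of degree `q`. -/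
def relConeHomGr (σ : Δ.Cone) (q : ℤ) :
    Submodule ℝ (F.relCone σ →ₗ[Poly (lin σ)] Poly (lin σ)) where
  carrier := {f | ∀ (p : ℤ) (x : F.relCone σ), x.1 ∈ F.gr σ p → f x ∈ polyGr (lin σ) (p + q)}
  zero_mem' _ _ _ := zero_mem _
  add_mem' ha hb p x hx := add_mem (ha p x hx) (hb p x hx)
  smul_mem' r _ ha p x hx := Submodule.smul_mem _ r (ha p x hx)

/-- The linear forms `F_{(Δ,∂Δ)} → S(V^*)` that are homogeneous of degree `q`. -/
def compactHomGr (q : ℤ) : Submodule ℝ (F.compactSections →ₗ[Poly V] Poly V) where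
  carrier := {f | ∀ (p : ℤ) (s : F.compactSections), (∀ σ, s.1.1 σ ∈ F.gr σ.1 p) →
    f s ∈ polyGr V (p + q)}
  zero_mem' _ _ _ := zero_mem _
  add_mem' ha hb p x hx := add_mem (ha p x hx) (hb p x hx)
  smul_mem' r _ ha p x hx := Submodule.smul_mem _ r (ha p x hx)

variable {F} [FiniteDimensional ℝ V]

theorem tmul_mem_dualGr_iff {σ : Δ.Cone} {q : ℤ} {ω : DetDual (lin σ)} (hω : ω ≠ 0)
    {f : F.relCone σ →ₗ[Poly (lin σ)] Poly (lin σ)} :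
    f ⊗ₜ[ℝ] ω ∈ F.dualGr σ q ↔ f ∈ F.relConeHomGr σ (q - 2 * (dim σ : ℤ)) :=
  tmul_mem_span_iff (F.relConeHomGr σ (q - 2 * (dim σ : ℤ))) hω

theorem tmul_mem_globalDualGr_iff {q : ℤ} {ω : DetDual V} (hω : ω ≠ 0)
    {f : F.compactSections →ₗ[Poly V] Poly V} :
    f ⊗ₜ[ℝ] ω ∈ F.globalDualGr q ↔ f ∈ F.compactHomGr (q - 2 * (Module.finrank ℝ V : ℤ)) :=
  tmul_mem_span_iff (F.compactHomGr (q - 2 * (Module.finrank ℝ V : ℤ))) hω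

omit [FiniteDimensional ℝ V] in
/-- The homogeneous part of degree `p` of a section `k` has the same restriction as `k` to every
face on which `k` is homogeneous of degree `p`. -/
theorem exists_mem_gr_res_eq (σ : Δ.Cone) (p : ℤ) (k : F.obj σ) :
    ∃ k' ∈ F.gr σ p, ∀ (τ : Δ.Cone) (h : τ ≤ σ), F.res h k ∈ F.gr τ p →
      F.res h k' = F.res h k := by
  have hk : k ∈ F.gr σ p ⊔ ⨆ (j : ℤ) (_ : j ≠ p), F.gr σ j := by
    have h1 : k ∈ ⨆ j, F.gr σ j := by
      obtain ⟨x, rfl⟩ := (F.isInternal_gr σ).surjective k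
      induction x using DirectSum.induction_on with
      | zero => exact zero_mem _
      | of j y =>
        rw [DirectSum.coeAddMonoidHom_of]
        exact le_iSup (F.gr σ) j y.2
      | add x y hx hy => exact map_add (DirectSum.coeAddMonoidHom (F.gr σ)) x y ▸ add_mem hx hy
    refine (iSup_le fun j => ?_ : ⨆ j, F.gr σ j ≤ _) h1
    by_cases hj : j = p
    · exact hj ▸ le_sup_left
    · exact le_sup_of_le_right (le_iSup₂_of_le j hj le_rfl)
  obtain ⟨k', hk', k'', hk'', rfl⟩ := AddSubgroup.mem_sup.mp hk
  refine ⟨k', hk', fun τ h hmem => ?_⟩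
  rw [map_add] at hmem
  have h1 : F.res h k'' ∈ F.gr τ p := (add_mem_cancel_left (F.res_mem_gr h hk')).mp hmem
  have h2 : F.res h k'' ∈ ⨆ (j : ℤ) (_ : j ≠ p), F.gr τ j := by
    refine (iSup₂_le fun j hj => ?_ : ⨆ (j : ℤ) (_ : j ≠ p), F.gr σ j ≤
      (⨆ (j : ℤ) (_ : j ≠ p), F.gr τ j).comap (F.res h)) hk''
    exact fun x hx => (le_iSup₂ (f := fun (j : ℤ) (_ : j ≠ p) => F.gr τ j) j hj)
      (F.res_mem_gr h hx)
  have h3 : F.res h k'' = 0 :=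
    AddSubgroup.disjoint_def.mp ((F.isInternal_gr τ).addSubgroup_iSupIndep p) h1 h2
  rw [map_add, h3, add_zero]

theorem phi_mem_relConeHomGr (hF : F.IsFlabby) {τ σ : Δ.Cone} {hf : IsFacet τ σ}
    {h : Module.Dual ℝ (lin σ)} (hh : IsFacetForm h hf) {q : ℤ}
    {f : F.relCone σ →ₗ[Poly (lin σ)] Poly (lin σ)} (hq : f ∈ F.relConeHomGr σ q) :
    phi hF hh f ∈ F.relConeHomGr τ (q + 2) := by
  intro p g hg
  obtain ⟨k, hk⟩ := hF.exists_isExt hf g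
  obtain ⟨k', hk', h'⟩ := exists_mem_gr_res_eq σ p k
  have hext : F.IsExt hf g k' := by
    refine ⟨?_, fun ρ hρ hne => ?_⟩
    · rw [h' τ hf.1 (hk.1 ▸ hg), hk.1]
    · have h0 := hk.2 ρ hρ hne
      rw [h' ρ hρ.le (h0 ▸ zero_mem _), h0]
  rw [phi_apply hF hh f hext]
  refine polyRes_mem_polyGr _ ?_
  have := hq _ ⟨_, hext.smul_mem hh⟩ (F.smul_mem_gr σ (ι_mem_polyGr h) hk')
  rwa [show p + (q + 2) = 2 + p + q by ring]

theorem dualRes_mem_dualGr (o : Δ.Orientation) (hF : F.IsFlabby) {τ σ : Δ.Cone}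
    (hf : IsFacet τ σ) {q : ℤ} {t : F.DualObj σ} (ht : t ∈ F.dualGr σ q) :
    dualRes o hF hf t ∈ F.dualGr τ q := by
  have h : F.dualGr σ q ≤ (F.dualGr τ q).comap (dualRes o hF hf) := by
    refine Submodule.span_le.mpr ?_
    rintro _ ⟨f, ω, hfq, rfl⟩
    refine Submodule.smul_mem (F.dualGr τ q) _ (Submodule.subset_span
      ⟨_, _, ?_, TensorProduct.map_tmul _ _ _ _⟩)
    have := phi_mem_relConeHomGr hF (isFacetForm_facetForm hf) (f := f) hfq
    have hd := hf.2
    rwa [show q - 2 * (dim σ : ℤ) + 2 = q - 2 * (dim τ : ℤ) by rw [← hd]; push_cast; ring] at this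
  exact h ht

theorem dualRestrict_mem_relConeHomGr_iff (hΔ : Δ.IsPure)
    {ψ : F.compactSections →ₗ[Poly V] Poly V} {q : ℤ} :
    (∀ (σ : Δ.Cone) (hσ : dim σ = Module.finrank ℝ V),
      dualRestrict σ hσ ψ ∈ F.relConeHomGr σ q) ↔ ψ ∈ F.compactHomGr q := by
  classical
  refine ⟨fun h p s hs => ?_, fun h σ hσ p x hx => polyRes_mem_polyGr _ (h p _ ?_)⟩
  · refine mem_polyGr_of_mul_mem (prod_ι_mem_polyGr (S := Δ.walls) wallForm)
      hΔ.formProd_walls_ne_zero ?_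
    refine (formProd_walls_mul_apply hΔ ψ s).symm ▸ Submodule.sum_mem _ fun σ _ =>
      polyRes_mem_polyGr _ ?_
    rw [← add_assoc]
    exact h σ.1 σ.2 _ ⟨_, formProd_walls_smul_mem σ.2 (s.1.1 ⟨σ.1, trivial⟩)⟩ (F.smul_mem_gr _
      (polyRes_mem_polyGr _ (prod_ι_mem_polyGr (S := Δ.walls) wallForm)) (hs ⟨σ.1, trivial⟩))
  · rintro ⟨κ, -⟩
    by_cases hκ : κ = σ
    · subst hκ
      rw [extendByZero_apply_self]
      exact hx
    · rw [extendByZero_apply_of_ne _ _ hκ]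
      exact zero_mem _

theorem mem_dualGr_iff_dualEquiv_mem (hΔ : Δ.IsQuasiConvex) (o : Δ.Orientation) (hF : F.IsFlabby)
    (q : ℤ) (s : dualSections o hF) :
    (∀ σ, s.1 σ ∈ F.dualGr σ q) ↔ dualEquiv hΔ o hF s ∈ F.globalDualGr q := by
  obtain ⟨ω, hω⟩ := DetDual.exists_ne_zero V
  obtain ⟨ψ, hψ⟩ := exists_eq_tmul hω (dualEquiv hΔ o hF s)
  have h1 : ∀ (σ : Δ.Cone) (hσ : dim σ = Module.finrank ℝ V), s.1 σ ∈ F.dualGr σ q ↔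
      dualRestrict σ hσ ψ ∈ F.relConeHomGr σ (q - 2 * (Module.finrank ℝ V : ℤ)) := by
    intro σ hσ
    rw [← evalTop_dualEquiv hΔ o hF s hσ, hψ, evalTop_tmul,
      tmul_mem_dualGr_iff (detRes_ne_zero hσ hω), hσ]
  rw [hψ, tmul_mem_globalDualGr_iff hω, ← dualRestrict_mem_relConeHomGr_iff hΔ.1]
  refine ⟨fun h σ hσ => (h1 σ hσ).mp (h σ), fun h => ?_⟩
  refine hΔ.1.induction (fun σ hσ => (h1 σ hσ).mpr (h σ hσ)) fun τ σ hf hσ => ?_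
  rw [← s.2 τ σ hf]
  exact dualRes_mem_dualGr o hF hf hσ

end degrees

end FanSheaf

end FanDuality

end

theorem mainTheorem6 {V : Type u} [AddCommGroup V] [Module ℝ V] [FiniteDimensional ℝ V]
    (Δ : FanDuality.Fan V) (hΔ : Δ.IsQuasiConvex) (o : Δ.Orientation) :
    ∃ e : ∀ (F : FanDuality.FanSheaf.{u, w} Δ) (hF : F.IsPerverse),
        FanDuality.FanSheaf.dualSections o hF.flabby ≃ₗ[FanDuality.Poly V] F.GlobalDual,
      -- the isomorphisms are homogeneous of degree zero
      (∀ (F : FanDuality.FanSheaf.{u, w} Δ) (hF : F.IsPerverse) (q : ℤ)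
        (s : FanDuality.FanSheaf.dualSections o hF.flabby),
        (∀ σ, s.1 σ ∈ F.dualGr σ q) ↔ e F hF s ∈ F.globalDualGr q) ∧
      -- over a cone `σ` of full dimension, the section corresponding to `ψ ⊗ ω` is given by the
      -- restriction of `ψ` along the trivial extension of sections from `(σ, ∂σ)` to `(Δ, ∂Δ)`
      (∀ (F : FanDuality.FanSheaf.{u, w} Δ) (hF : F.IsPerverse)
        (ψ : F.compactSections →ₗ[FanDuality.Poly V] FanDuality.Poly V)
        (ω : FanDuality.DetDual V) (σ : Δ.Cone)
        (hσ : FanDuality.Fan.dim σ = Module.finrank ℝ V),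
        ∃ φ : F.relCone σ →ₗ[FanDuality.Poly (FanDuality.Fan.lin σ)]
            FanDuality.Poly (FanDuality.Fan.lin σ),
          (∀ x : F.relCone σ, φ x =
            FanDuality.polyRes (FanDuality.Fan.lin σ).subtype (ψ (F.extendByZero σ hσ x))) ∧
          ((e F hF).symm (ψ ⊗ₜ[ℝ] ω)).1 σ = φ ⊗ₜ[ℝ] FanDuality.Fan.detRes σ hσ ω) ∧
      -- naturality with respect to homomorphisms of perverse sheaves
      (∀ (F G : FanDuality.FanSheaf.{u, w} Δ) (hF : F.IsPerverse) (hG : G.IsPerverse)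
        (f : FanDuality.FanSheaf.Hom F G) (t : G.GlobalDual) (σ : Δ.Cone),
        ((e F hF).symm (f.globalDual t)).1 σ = f.dualObj σ (((e G hG).symm t).1 σ)) ∧
      -- a volume form identifies the global sections of the dual with the dual module
      (∀ (F : FanDuality.FanSheaf.{u, w} Δ) (hF : F.IsPerverse) (ω : FanDuality.DetDual V),
        ω ≠ 0 → Function.Bijective
          fun ψ : F.compactSections →ₗ[FanDuality.Poly V] FanDuality.Poly V =>
            (e F hF).symm (ψ ⊗ₜ[ℝ] ω)) := by
  refine ⟨fun F hF => FanDuality.FanSheaf.dualEquiv hΔ o hF.flabby,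
    fun F hF q s => FanDuality.FanSheaf.mem_dualGr_iff_dualEquiv_mem hΔ o hF.flabby q s,
    fun F hF ψ ω σ hσ => ⟨FanDuality.FanSheaf.dualRestrict σ hσ ψ, fun _ => rfl,
      FanDuality.FanSheaf.dualEquiv_symm_apply hΔ o hF.flabby _ hσ⟩,
    fun F G hF hG f t σ => f.dualEquiv_symm_globalDual hΔ o hF.flabby hG.flabby t σ,
    fun F hF ω hω => (FanDuality.FanSheaf.dualEquiv hΔ o hF.flabby).symm.bijective.comp
      ⟨FanDuality.tmul_left_injective hω, fun t => ?_⟩⟩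
  obtain ⟨ψ, rfl⟩ := FanDuality.exists_eq_tmul hω t
  exact ⟨ψ, rfl⟩
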